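/- **Setting.** A *tile* is a non-rotating unit square whose four edges are labelled with glues from a finite set $\Sigma$; each unordered pair of glues has a strength ${\rm str}(g,h)={\rm str}(h,g)\in\mathbb{Z}_{\ge 0}$. A *configuration* is a partial function from $\mathbb{Z}^2$ to tiles; an *assembly* is the class of all translations of a configuration, and $|A|$ is the number of tiles of an assembly $A$. The *bond graph* of a configuration has the positions of its domain as vertices, and two adjacent positions are joined by an edge, with weight the strength of the two coincident glues, when this strength is nonzero. An assembly is *$\tau$-stable* if its bond graph is connected and every edge cut has weight at least $\tau$. An assembly $B$ is a *subassembly* of $A$, written $B\sqsubseteq A$, if some configuration of $B$ is contained in some configuration of $A$. Assemblies $A$ and $B$ are *$\tau$-combinable* into an assembly $C$ if $C$ is $\tau$-stable and some configuration of $C$ is the disjoint union of a configuration of $A$ and a configuration of $B$. A *two-handed assembly system* is a pair $\Gamma=(T,\tau)$ of a finite set $T$ of tiles and a temperature $\tau\ge 1$. Its *producible* assemblies are the single tiles of $T$ and, recursively, every assembly into which two producible assemblies are $\tau$-combinable; a producible assembly is *terminal* if it is not $\tau$-combinable with any producible assembly. $\Gamma$ *uniquely produces* $A$ if $A$ is its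 only terminal assembly and $B\sqsubseteq A$ for every producible $B$. An assembly is *tree-bonded* if its bond graph is acyclic. **Theorem 2.** There is an $\mathcal{O}(|A|^5)$ time algorithm that decides the following problem (Temp2-Tree-UAV). Input: a two-handed assembly system $\Gamma=(T,2)$ of temperature $2$ and a nonempty finite tree-bonded assembly $A$. Output: does $\Gamma$ uniquely produce $A$? Time is measured on a unit-cost random access machine with integer registers and memory cells, whose operations are constants, addition, subtraction, comparison and indirect memory access. The input is given in memory as $|\Sigma|$, $|T|$, $|A|$, the list of the tiles of $T$ (without repetition), the list of the positions and glues of the tiles of one configuration of $A$ (without repetition), and the strength function as a two-dimensional array (an array of row addresses, followed by the rows). A single program works for all instances, and the constant in $\mathcal{O}(|A|^5)$ is absolute: the time does not depend on $|\Sigma|$ or $|T|$. -/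

import Mathlib

/-! Two-handed tile self-assembly, and a unit-cost random access machine. -/

namespace TwoHAM

/-- A non-rotating unit square tile: a glue on each of its four edges. -/
@[ext]
structure Tile (G : Type) where
  north : G
  east : G
  south : G
  west : G

/-- A configuration: a partial function from the square grid to tiles. -/
def Config (G : Type) : Type := ℤ × ℤ → Option (Tile G)

namespace Config

variable {G : Type}

/-- The domain of a configuration. -/
def dom (a : Config G) : Set (ℤ × ℤ) := {p | ∃ t, a p = some t}

/-- The graph of a configuration, as a set of (position, tile) pairs. -/
def cells (a : Config G) : Set ((ℤ × ℤ) × Tile G) := {x | a x.1 = some x.2}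

/-- The configuration `a + u`. -/
def translate (a : Config G) (u : ℤ × ℤ) : Config G := fun p => a (p + u)

/-- The configuration whose only tile is `t`, at the origin. -/
def single (t : Tile G) : Config G := fun p => if p = 0 then some t else none

theorem translate_dom_ncard (a : Config G) (u : ℤ × ℤ) :
    (a.translate u).dom.ncard = a.dom.ncard := by
  have h : a.dom = (fun p => p + u) '' (a.translate u).dom := by
    ext p
    constructor
    · rintro ⟨t, ht⟩
      exact ⟨p - u, ⟨t, by simpa [translate] using ht⟩, by simp⟩
    · rintro ⟨q, ⟨t, ht⟩, rfl⟩
      exact ⟨t, ht⟩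
  rw [h]
  exact (Set.ncard_image_of_injective _ (add_left_injective u)).symm

/-- Two configurations are equivalent when the second is a translation of the first. -/
def translationSetoid (G : Type) : Setoid (Config G) where
  r a b := ∃ u, b = a.translate u
  iseqv :=
    { refl := fun a => ⟨0, by funext p; simp [translate]⟩
      symm := by
        rintro a b ⟨u, rfl⟩
        exact ⟨-u, by funext p; simp [translate]⟩
      trans := by
        rintro a b c ⟨u, rfl⟩ ⟨v, rfl⟩
        exact ⟨v + u, by funext p; simp [translate, add_assoc]⟩ }

end Config

/-- An assembly: the class of all translations of a configuration. -/
def Assembly (G : Type) : Type := Quotient (Config.translationSetoid G)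

/-- The assembly of a configuration. -/
def Config.assembly {G : Type} (a : Config G) : Assembly G :=
  Quotient.mk (Config.translationSetoid G) a

namespace Assembly

variable {G : Type}

/-- `|A|`: the number of tiles in a configuration of `A` (for finite assemblies). -/
noncomputable def size (A : Assembly G) : ℕ :=
  Quotient.lift (s := Config.translationSetoid G) (fun a => a.dom.ncard)
    (by rintro a b ⟨u, rfl⟩; exact (a.translate_dom_ncard u).symm) A

/-- `A` is a subassembly of `B`. -/
def Sub (A B : Assembly G) : Prop :=
  ∃ a b : Config G, a.assembly = A ∧ b.assembly = B ∧ a.cells ⊆ b.cells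

end Assembly

/-- A two-handed assembly system over the glues `G`: a finite set of tiles, a strength for each
(unordered) pair of glues, and a positive temperature. -/
structure System (G : Type) where
  tiles : Finset (Tile G)
  str : G → G → ℕ
  str_comm : ∀ g h, str g h = str h g
  temp : ℕ
  temp_pos : 0 < temp

namespace System

variable {G : Type} (Γ : System G)

/-- The strength of the coincident glue pair when tile `s` is at `p` and tile `t` is at `q`
(zero unless the positions are adjacent). -/
def tileBond (p : ℤ × ℤ) (s : Tile G) (q : ℤ × ℤ) (t : Tile G) : ℕ :=
  if q = p + (1, 0) then Γ.str s.east t.west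
  else if p = q + (1, 0) then Γ.str s.west t.east
  else if q = p + (0, 1) then Γ.str s.north t.south
  else if p = q + (0, 1) then Γ.str s.south t.north
  else 0

/-- The weight in the bond graph of `a` of the pair of positions `p`, `q`. -/
def weight (a : Config G) (p q : ℤ × ℤ) : ℕ :=
  match a p, a q with
  | some s, some t => Γ.tileBond p s q t
  | _, _ => 0

theorem tileBond_comm (p q : ℤ × ℤ) (s t : Tile G) :
    Γ.tileBond p s q t = Γ.tileBond q t p s := by
  obtain ⟨x, y⟩ := p
  obtain ⟨x', y'⟩ := q
  simp only [tileBond, Prod.mk_add_mk, Prod.mk.injEq]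
  split_ifs <;> first | omega | exact Γ.str_comm _ _

theorem weight_comm (a : Config G) (p q : ℤ × ℤ) : Γ.weight a p q = Γ.weight a q p := by
  unfold weight
  cases a p <;> cases a q <;> simp [Γ.tileBond_comm p q]

theorem weight_self (a : Config G) (p : ℤ × ℤ) : Γ.weight a p p = 0 := by
  obtain ⟨x, y⟩ := p
  unfold weight
  cases a (x, y) <;> simp [tileBond]

/-- The bond graph of `a`: its vertices are the positions in the domain of `a`, its edges the
pairs of positions between which the glue strength is nonzero. -/
def bondGraph (a : Config G) : SimpleGraph a.dom where
  Adj p q := 0 < Γ.weight a p q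
  symm := ⟨fun p q h => by rw [Γ.weight_comm]; exact h⟩
  loopless := ⟨fun p h => by rw [Γ.weight_self] at h; exact lt_irrefl 0 h⟩

/-- Stability at the temperature of the system: the bond graph is connected, and each of its edge
cuts has a total weight of at least the temperature. The cut edges are listed as pairs directed
from `S` to its complement; asking for a finite set of them that is heavy enough makes the
definition right for infinite configurations too. -/
def Stable (a : Config G) : Prop :=
  (Γ.bondGraph a).Connected ∧
  ∀ S : Set a.dom, S.Nonempty → Sᶜ.Nonempty →
    ∃ E : Finset (a.dom × a.dom), (∀ e ∈ E, e.1 ∈ S ∧ e.2 ∉ S) ∧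
      Γ.temp ≤ ∑ e ∈ E, Γ.weight a e.1 e.2

/-- The assemblies `A` and `B` are combinable into the assembly `C`. -/
def Combinable (A B C : Assembly G) : Prop :=
  ∃ a b c : Config G, a.assembly = A ∧ b.assembly = B ∧ c.assembly = C ∧
    a.cells ∪ b.cells = c.cells ∧ a.cells ∩ b.cells = ∅ ∧ Γ.Stable c

/-- The producible assemblies. -/
inductive Producible : Assembly G → Prop
  | tile (t : Tile G) (ht : t ∈ Γ.tiles) : Producible (Config.single t).assembly
  | combine (A B C : Assembly G) (hA : Producible A) (hB : Producible B)
      (hC : Γ.Combinable A B C) : Producible C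

/-- The terminal assemblies: producible, and combinable with no producible assembly. -/
def Terminal (A : Assembly G) : Prop :=
  Γ.Producible A ∧ ∀ B C, Γ.Producible B → ¬ Γ.Combinable A B C

/-- The system uniquely produces the assembly `A`. -/
def UniquelyProduces (A : Assembly G) : Prop :=
  {B | Γ.Terminal B} = {A} ∧ ∀ B, Γ.Producible B → B.Sub A

/-- The assembly `A` is tree-bonded: its bond graph is acyclic. -/
def TreeBonded (A : Assembly G) : Prop :=
  ∀ a : Config G, a.assembly = A → (Γ.bondGraph a).IsAcyclic

end System

/-! ### The random access machine

Registers and memory cells hold integers. The available operations are constants, addition,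
subtraction, comparison and indirect memory access (no multiplication and no bit operations), and
each of them takes one step. -/

namespace RAM

/-- The registers and the memory. -/
structure State where
  reg : ℕ → ℤ
  mem : ℤ → ℤ

/-- Arithmetic expressions. -/
inductive Expr
  | const (k : ℤ)
  | reg (r : ℕ)
  | mem (addr : Expr)
  | add (e f : Expr)
  | sub (e f : Expr)

namespace Expr

/-- The value of an expression. -/
def eval (σ : State) : Expr → ℤ
  | const k => k
  | reg r => σ.reg r
  | mem a => σ.mem (a.eval σ)
  | add e f => e.eval σ + f.eval σ
  | sub e f => e.eval σ - f.eval σ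

/-- The number of steps that evaluating an expression takes: one for each of its operations. -/
def cost : Expr → ℕ
  | const _ => 1
  | reg _ => 1
  | mem a => a.cost + 1
  | add e f => e.cost + f.cost + 1
  | sub e f => e.cost + f.cost + 1

end Expr

/-- Comparisons. -/
inductive Test
  | eq (e f : Expr)
  | le (e f : Expr)

namespace Test

/-- When a comparison succeeds. -/
def Holds (σ : State) : Test → Prop
  | eq e f => e.eval σ = f.eval σ
  | le e f => e.eval σ ≤ f.eval σ

/-- The number of steps that a comparison takes. -/
def cost : Test → ℕ
  | eq e f => e.cost + f.cost + 1
  | le e f => e.cost + f.cost + 1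

end Test

/-- Programs. -/
inductive Program
  | skip
  | assign (r : ℕ) (e : Expr)
  | store (addr e : Expr)
  | seq (P Q : Program)
  | cond (b : Test) (P Q : Program)
  | loop (b : Test) (P : Program)

/-- `Runs P σ σ' n`: started in the state `σ`, the program `P` halts after exactly `n` steps, in
the state `σ'`. -/
inductive Runs : Program → State → State → ℕ → Prop
  | skip (σ : State) : Runs .skip σ σ 1
  | assign (r : ℕ) (e : Expr) (σ : State) :
      Runs (.assign r e) σ ⟨Function.update σ.reg r (e.eval σ), σ.mem⟩ (e.cost + 1)
  | store (a e : Expr) (σ : State) :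
      Runs (.store a e) σ ⟨σ.reg, Function.update σ.mem (a.eval σ) (e.eval σ)⟩
        (a.cost + e.cost + 1)
  | seq {P Q : Program} {σ₁ σ₂ σ₃ : State} {m n : ℕ}
      (hP : Runs P σ₁ σ₂ m) (hQ : Runs Q σ₂ σ₃ n) : Runs (.seq P Q) σ₁ σ₃ (m + n)
  | cond_true {b : Test} {P Q : Program} {σ σ' : State} {n : ℕ}
      (hb : b.Holds σ) (hP : Runs P σ σ' n) : Runs (.cond b P Q) σ σ' (b.cost + n)
  | cond_false {b : Test} {P Q : Program} {σ σ' : State} {n : ℕ}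
      (hb : ¬ b.Holds σ) (hQ : Runs Q σ σ' n) : Runs (.cond b P Q) σ σ' (b.cost + n)
  | loop_true {b : Test} {P : Program} {σ₁ σ₂ σ₃ : State} {m n : ℕ}
      (hb : b.Holds σ₁) (hP : Runs P σ₁ σ₂ m) (hL : Runs (.loop b P) σ₂ σ₃ n) :
      Runs (.loop b P) σ₁ σ₃ (b.cost + m + n)
  | loop_false {b : Test} {P : Program} {σ : State}
      (hb : ¬ b.Holds σ) : Runs (.loop b P) σ σ b.cost

/-- The initial state: the input word is in the memory cells `0, 1, 2, …`, and everything else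
is zero. -/
def start (w : List ℤ) : State where
  reg := fun _ => 0
  mem := fun i => if 0 ≤ i then w.getD i.toNat 0 else 0

end RAM

/-! ### Instances as machine inputs -/

/-- A tile as four memory cells. -/
def encodeTile {s : ℕ} (t : Tile (Fin s)) : List ℤ :=
  [(t.north.val : ℤ), (t.east.val : ℤ), (t.south.val : ℤ), (t.west.val : ℤ)]

/-- A placed tile as six memory cells: its coordinates and its glues. -/
def encodeCell {s : ℕ} (c : (ℤ × ℤ) × Tile (Fin s)) : List ℤ :=
  [c.1.1, c.1.2] ++ encodeTile c.2

/-- The input word of an instance whose glues are `0, …, s - 1`. It consists of the number of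
glues, the number of tile types and the number of placed tiles; the tile types; the placed tiles
of the target; and the strength function as an array of `s` rows: first the addresses at which
the rows begin, then the rows. -/
def encode {s : ℕ} (str : Fin s → Fin s → ℕ) (tiles : List (Tile (Fin s)))
    (placed : List ((ℤ × ℤ) × Tile (Fin s))) : List ℤ :=
  [(s : ℤ), (tiles.length : ℤ), (placed.length : ℤ)]
    ++ tiles.flatMap encodeTile
    ++ placed.flatMap encodeCell
    ++ (List.finRange s).map (fun g =>
        (3 + 4 * tiles.length + 6 * placed.length + s + g.val * s : ℤ))
    ++ (List.finRange s).flatMap (fun g => (List.finRange s).map (fun h => (str g h : ℤ)))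

/-- `w` is an input word for the system `Γ` and the assembly `A`: the tile types of `Γ`, and the
placed tiles of some configuration of `A`, are listed without repetition in any order. -/
def IsInput {s : ℕ} (Γ : System (Fin s)) (A : Assembly (Fin s)) (w : List ℤ) : Prop :=
  ∃ (tiles : List (Tile (Fin s))) (a : Config (Fin s))
    (placed : List ((ℤ × ℤ) × Tile (Fin s))),
    tiles.Nodup ∧ (∀ t, t ∈ tiles ↔ t ∈ Γ.tiles) ∧
    a.assembly = A ∧ placed.Nodup ∧ (∀ c, c ∈ placed ↔ c ∈ a.cells) ∧
    w = encode Γ.str tiles placed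

end TwoHAM

/-! At temperature two, unique production of a finite nonempty tree-bonded `A` is equivalent to
finitely many local conditions, collected in `Verified`, and these can be checked by nested searches
over the tiles of `A`.

Every edge of a tree is a bridge, hence an edge cut. If `A` is producible, each of its bonds
therefore has strength at least two, and every connected part of `A` can be grown tile by tile
(`Strong.producible`). Two conditions then exclude producible assemblies outside `A`. For `grows`,
let a tile type `t` bind strongly to the tile at `y`, on the position `x` next to it. The largest
connected part of `A` that contains `y` and misses `x`, with `t` attached at `x`, must again occur
in `A`. For `blocks`, if two bonds can form between a path of `A` and a shifted path of `A`, then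
the two paths must overlap.

Necessity: the assemblies named in these conditions are themselves producible, so they occur in `A`.
Two disjoint paths joined by two bonds would put a cycle into `A`. Sufficiency
(`Verified.producible_emb`): by induction, each producible assembly is connected by strong bonds and
occurs in `A`. When two of them combine, there is either a bond of strength at least two between
them, and then the second is absorbed one tile at a time using `grows`, or there are two weaker
bonds, which `blocks` forbids. The equivalence is `uniquelyProduces_iff`.

For the algorithm, each condition is a first-order formula over the input with quantifiers bounded
by the number of tile types or of placed tiles. `Form.compile` turns such a formula into a program,
and the exponent `Form.deg` bounds its time. Two devices keep the exponent at five. A position that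
is determined by others is found by `lookup`, whose continuation runs after the search instead of
inside it. Membership in a path of the tree is a constant-time test on distances
(`IsAcyclic.between_iff_dist`), read from a table that `fillTable` computes beforehand in quartic
time. Finally, more tile types than placed tiles means rejection, since each type has to occur in
`A`; so all searches are bounded by `|A|`. -/

namespace TwoHAM.RAM

/-! ### Rules for running times and final states of programs. -/

open Function

/-- The program `P`, started in `σ`, halts within `C` steps in a state satisfying `Q`. -/
def Ends (P : Program) (σ : State) (C : ℕ) (Q : State → Prop) : Prop :=
  ∃ σ' c, Runs P σ σ' c ∧ c ≤ C ∧ Q σ'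

namespace Ends

theorem mono {P : Program} {σ : State} {C D : ℕ} {Q R : State → Prop} (h : Ends P σ C Q)
    (hCD : C ≤ D) (hQR : ∀ σ', Q σ' → R σ') : Ends P σ D R := by
  obtain ⟨σ', c, hr, hc, hq⟩ := h
  exact ⟨σ', c, hr, hc.trans hCD, hQR _ hq⟩

theorem skip {σ : State} {Q : State → Prop} (h : Q σ) : Ends .skip σ 1 Q :=
  ⟨σ, 1, .skip σ, le_rfl, h⟩

theorem assign {r : ℕ} {e : Expr} {σ : State} {Q : State → Prop}
    (h : Q ⟨update σ.reg r (e.eval σ), σ.mem⟩) : Ends (.assign r e) σ (e.cost + 1) Q :=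
  ⟨_, _, .assign r e σ, le_rfl, h⟩

theorem store {a e : Expr} {σ : State} {Q : State → Prop}
    (h : Q ⟨σ.reg, update σ.mem (a.eval σ) (e.eval σ)⟩) :
    Ends (.store a e) σ (a.cost + e.cost + 1) Q :=
  ⟨_, _, .store a e σ, le_rfl, h⟩

theorem seq {P P' : Program} {σ : State} {C D : ℕ} {Q R : State → Prop} (h : Ends P σ C Q)
    (h' : ∀ σ', Q σ' → Ends P' σ' D R) : Ends (.seq P P') σ (C + D) R := by
  obtain ⟨σ', c, hr, hc, hq⟩ := h
  obtain ⟨σ'', d, hr', hd, hq'⟩ := h' _ hq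
  exact ⟨σ'', c + d, .seq hr hr', by omega, hq'⟩

theorem cond {b : Test} {P P' : Program} {σ : State} {C : ℕ} {Q : State → Prop}
    (h : b.Holds σ → Ends P σ C Q) (h' : ¬ b.Holds σ → Ends P' σ C Q) :
    Ends (.cond b P P') σ (b.cost + C) Q := by
  by_cases hb : b.Holds σ
  · obtain ⟨σ', c, hr, hc, hq⟩ := h hb
    exact ⟨σ', _, .cond_true hb hr, by omega, hq⟩
  · obtain ⟨σ', c, hr, hc, hq⟩ := h' hb
    exact ⟨σ', _, .cond_false hb hr, by omega, hq⟩

end Ends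

/-- Runs `P` with the register `r` counting from `0` to the value of cell `2`. -/
def forLoop (r : ℕ) (P : Program) : Program :=
  .seq (.assign r (.const 0))
    (.loop (.le (.add (.reg r) (.const 1)) (.mem (.const 2)))
      (.seq P (.assign r (.add (.reg r) (.const 1)))))

/-- The usual rule with a loop invariant. Each pass adds six steps for the test and four for the
increment to the cost of the body; the initial assignment and the last test account for the
remaining eight. The invariant must not depend on the loop register, which is rewritten between
passes. -/
theorem Ends.forLoop {r : ℕ} {P : Program} {C N : ℕ} (I : ℕ → State → Prop)
    (hmem : ∀ i σ, I i σ → σ.mem 2 = N)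
    (hreg : ∀ i σ x, I i σ → I i ⟨update σ.reg r x, σ.mem⟩)
    (hP : ∀ i < N, ∀ σ, I i σ → σ.reg r = i →
      Ends P σ C (fun σ' => I (i + 1) σ' ∧ σ'.reg r = i))
    {σ : State} (h0 : I 0 σ) : Ends (forLoop r P) σ (N * (C + 10) + 8) (I N) := by
  have key : ∀ m i, i + m = N → ∀ σ, I i σ → σ.reg r = i →
      Ends (.loop (.le (.add (.reg r) (.const 1)) (.mem (.const 2)))
        (.seq P (.assign r (.add (.reg r) (.const 1))))) σ (m * (C + 10) + 6) (I N) := by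
    intro m
    induction m with
    | zero =>
      intro i hi σ hI hr
      obtain rfl : i = N := by omega
      refine ⟨σ, _, .loop_false ?_, ?_, hI⟩
      · simp [Test.Holds, Expr.eval, hr, hmem _ _ hI]
      · simp [Test.cost, Expr.cost]
    | succ m ih =>
      intro i hi σ hI hr
      have hb : (Test.le (.add (.reg r) (.const 1)) (.mem (.const 2))).Holds σ := by
        simp only [Test.Holds, Expr.eval, hr, hmem _ _ hI]
        omega
      obtain ⟨σ', c, hrun, hc, hI', hr'⟩ := hP i (by omega) σ hI hr
      obtain ⟨σ'', d, hrun', hd, hI''⟩ :=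
        ih (i + 1) (by omega) ⟨update σ'.reg r (σ'.reg r + 1), σ'.mem⟩
          (hreg _ _ _ hI') (by simp [hr'])
      refine ⟨σ'', _, .loop_true hb (.seq hrun (.assign r _ _)) hrun', ?_, hI''⟩
      simp only [Test.cost, Expr.cost]
      rw [add_mul]
      omega
  have := Ends.seq (P := .assign r (.const 0)) (σ := σ)
    (Q := fun σ => I 0 σ ∧ σ.reg r = (0 : ℕ))
    (Ends.assign (by simp [Expr.eval, hreg _ _ _ h0])) (fun σ' h => key N 0 (by omega) σ' h.1 h.2)
  exact this.mono (by simp [Expr.cost]; omega) fun _ h => h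

/-! ### Formulas with bounded search -/

/-- Formulas over the memory, with variables in the registers `1, 2, …`. At level `k` (that is,
when the first `k` variables are bound), `find b F G` binds the variable `k + 1` to the least
number below the value of cell `b` for which `F` holds, or to the value of cell `b` when there is
none, and then asserts `G`. -/
inductive Form
  | test (b : Test)
  | not (F : Form)
  | and (F G : Form)
  | find (b : ℤ) (F G : Form)

/-- The least `i < N` with `p i`, or `N`. -/
noncomputable def first (N : ℕ) (p : ℕ → Prop) : ℕ := sInf {i | N ≤ i ∨ p i}

theorem first_spec (N : ℕ) (p : ℕ → Prop) : N ≤ first N p ∨ p (first N p) :=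
  Nat.sInf_mem (s := {i | N ≤ i ∨ p i}) ⟨N, Or.inl le_rfl⟩

theorem first_lt_iff {N : ℕ} {p : ℕ → Prop} : first N p < N ↔ ∃ i < N, p i := by
  constructor
  · intro h
    exact ⟨_, h, (first_spec N p).resolve_left (by omega)⟩
  · rintro ⟨i, hi, hp⟩
    exact lt_of_le_of_lt (Nat.sInf_le (Or.inr hp)) hi

theorem first_eq {N : ℕ} {p : ℕ → Prop} {i : ℕ} (h : N ≤ i ∨ p i)
    (h' : ∀ j < i, j < N ∧ ¬ p j) : first N p = i := by
  refine le_antisymm (Nat.sInf_le h) ?_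
  by_contra hlt
  have := h' _ (not_le.1 hlt)
  rcases first_spec N p with h1 | h1
  · omega
  · exact this.2 h1

namespace Form

/-- The truth of a formula at level `k`. -/
def Holds (m : ℤ → ℤ) : ℕ → Form → (ℕ → ℤ) → Prop
  | _, test b, ρ => b.Holds ⟨ρ, m⟩
  | k, not F, ρ => ¬ F.Holds m k ρ
  | k, and F G, ρ => F.Holds m k ρ ∧ G.Holds m k ρ
  | k, find b F G, ρ => G.Holds m (k + 1) (update ρ (k + 1)
      (first (m b).toNat fun i => F.Holds m (k + 1) (update ρ (k + 1) i)))

end Form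

/-- The expression only reads the registers `1, …, k`. -/
def Expr.Scoped (k : ℕ) : Expr → Bool
  | .const _ => true
  | .reg r => decide (1 ≤ r ∧ r ≤ k)
  | .mem a => a.Scoped k
  | .add e f => e.Scoped k && f.Scoped k
  | .sub e f => e.Scoped k && f.Scoped k

/-- The test only reads the registers `1, …, k`. -/
def Test.Scoped (k : ℕ) : Test → Bool
  | .eq e f => e.Scoped k && f.Scoped k
  | .le e f => e.Scoped k && f.Scoped k

namespace Form

/-- At level `k`, the formula reads only bound variables, and its searches are bounded by the
cells `1` and `2`. -/
def Scoped : ℕ → Form → Bool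
  | k, test b => b.Scoped k
  | k, not F => F.Scoped k
  | k, and F G => F.Scoped k && G.Scoped k
  | k, find b F G => decide (b = 1 ∨ b = 2) && F.Scoped (k + 1) && G.Scoped (k + 1)

end Form

theorem Expr.eval_congr {k : ℕ} {e : Expr} (he : e.Scoped k = true) {ρ ρ' : ℕ → ℤ} {m : ℤ → ℤ}
    (h : ∀ r, 1 ≤ r → r ≤ k → ρ r = ρ' r) : e.eval ⟨ρ, m⟩ = e.eval ⟨ρ', m⟩ := by
  induction e with
  | const => rfl
  | reg r =>
    simp only [Scoped, decide_eq_true_eq] at he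
    exact h r he.1 he.2
  | mem a ih => simp only [eval, ih he]
  | add e f ihe ihf =>
    simp only [Scoped, Bool.and_eq_true] at he
    simp only [eval, ihe he.1, ihf he.2]
  | sub e f ihe ihf =>
    simp only [Scoped, Bool.and_eq_true] at he
    simp only [eval, ihe he.1, ihf he.2]

theorem Test.holds_congr {k : ℕ} {b : Test} (hb : b.Scoped k = true) {ρ ρ' : ℕ → ℤ} {m : ℤ → ℤ}
    (h : ∀ r, 1 ≤ r → r ≤ k → ρ r = ρ' r) : b.Holds ⟨ρ, m⟩ ↔ b.Holds ⟨ρ', m⟩ := by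
  cases b <;>
  · simp only [Scoped, Bool.and_eq_true] at hb
    simp only [Holds, Expr.eval_congr hb.1 h, Expr.eval_congr hb.2 h]

/-- The compiled programs overwrite register `0` and the registers above the current level, so truth
must depend on the bound variables only. -/
theorem Form.holds_congr {m : ℤ → ℤ} {F : Form} : ∀ {k : ℕ}, F.Scoped k = true →
    ∀ {ρ ρ' : ℕ → ℤ}, (∀ r, 1 ≤ r → r ≤ k → ρ r = ρ' r) → (F.Holds m k ρ ↔ F.Holds m k ρ') := by
  induction F with
  | test b => intro k hF ρ ρ' h; exact Test.holds_congr hF h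
  | not F ih => intro k hF ρ ρ' h; exact not_congr (ih hF h)
  | and F G ihF ihG =>
    intro k hF ρ ρ' h
    simp only [Scoped, Bool.and_eq_true] at hF
    exact and_congr (ihF hF.1 h) (ihG hF.2 h)
  | find b F G ihF ihG =>
    intro k hF ρ ρ' h
    simp only [Scoped, Bool.and_eq_true] at hF
    have hu : ∀ x : ℤ, ∀ r, 1 ≤ r → r ≤ k + 1 → update ρ (k + 1) x r = update ρ' (k + 1) x r := by
      intro x r h1 h2
      by_cases hr : r = k + 1
      · subst hr; simp
      · simp [hr, h r h1 (by omega)]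
    simp only [Holds]
    rw [funext fun i : ℕ => propext (ihF hF.1.2 (hu i))]
    exact ihG hF.2 (hu _)

/-- Sets the register `v` to the least number below the value of cell `b` for which `P` leaves a
nonzero number in the register `0`. -/
def search (v : ℕ) (b : ℤ) (P : Program) : Program :=
  .seq (.assign v (.const (-1))) (.seq (.assign 0 (.const 0))
    (.loop (.eq (.reg 0) (.const 0)) (.seq (.assign v (.add (.reg v) (.const 1)))
      (.cond (.le (.mem (.const b)) (.reg v)) (.assign 0 (.const 1)) P))))

/-- The program that evaluates a formula, with its truth value in the register `0`. -/
def Form.compile : ℕ → Form → Program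
  | _, .test b => .cond b (.assign 0 (.const 1)) (.assign 0 (.const 0))
  | k, .not F => .seq (F.compile k) (.assign 0 (.sub (.const 1) (.reg 0)))
  | k, .and F G => .seq (F.compile k) (.cond (.eq (.reg 0) (.const 0)) .skip (G.compile k))
  | k, .find b F G => .seq (search (k + 1) b (F.compile (k + 1))) (G.compile (k + 1))

/-- A bound on the time of evaluating a formula when its searches are bounded by `N`. -/
def Form.time (N : ℕ) : Form → ℕ
  | .test b => b.cost + 2
  | .not F => F.time N + 4
  | .and F G => F.time N + (G.time N + 4)
  | .find _ F G => (N + 1) * (F.time N + 13) + 7 + G.time N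

/-- The exponent of `N` in `Form.time`. -/
def Form.deg : Form → ℕ
  | .test _ => 0
  | .not F => F.deg
  | .and F G => max F.deg G.deg
  | .find _ F G => max (F.deg + 1) G.deg

/-- The constant depends on the formula alone. In a `find`, only the formula being searched for is
multiplied by the range; the continuation is added, which is why `Form.deg` takes a maximum there.
-/
theorem Form.time_le (F : Form) : ∃ K, ∀ N, 1 ≤ N → F.time N ≤ K * N ^ F.deg := by
  have up : ∀ {K N d e t : ℕ}, 1 ≤ N → d ≤ e → t ≤ K * N ^ d → t ≤ K * N ^ e := by
    intro K N d e t hN hde ht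
    exact ht.trans (Nat.mul_le_mul_left _ (Nat.pow_le_pow_right hN hde))
  induction F with
  | test b => exact ⟨b.cost + 2, fun N _ => by simp [time, deg]⟩
  | not F ih =>
    obtain ⟨K, hK⟩ := ih
    refine ⟨K + 4, fun N hN => ?_⟩
    have := hK N hN
    have h1 : 1 ≤ N ^ F.deg := Nat.one_le_pow _ _ hN
    simp only [time, deg]
    nlinarith
  | and F G ihF ihG =>
    obtain ⟨K, hK⟩ := ihF
    obtain ⟨L, hL⟩ := ihG
    refine ⟨K + L + 4, fun N hN => ?_⟩
    have h1 : 1 ≤ N ^ max F.deg G.deg := Nat.one_le_pow _ _ hN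
    have h2 := up hN (le_max_left F.deg G.deg) (hK N hN)
    have h3 := up hN (le_max_right F.deg G.deg) (hL N hN)
    simp only [time, deg]
    nlinarith
  | find b F G ihF ihG =>
    obtain ⟨K, hK⟩ := ihF
    obtain ⟨L, hL⟩ := ihG
    refine ⟨2 * (K + 13) + 7 + L, fun N hN => ?_⟩
    have h1 : 1 ≤ N ^ max (F.deg + 1) G.deg := Nat.one_le_pow _ _ hN
    have h2 : (N + 1) * (F.time N + 13) ≤ 2 * (K + 13) * N ^ max (F.deg + 1) G.deg := by
      refine up hN (le_max_left _ _) ?_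
      have h3 := hK N hN
      have h4 : 1 ≤ N ^ F.deg := Nat.one_le_pow _ _ hN
      calc (N + 1) * (F.time N + 13) ≤ (2 * N) * ((K + 13) * N ^ F.deg) :=
            Nat.mul_le_mul (by omega) (by nlinarith)
        _ = _ := by ring
    have h3 := up hN (le_max_right (F.deg + 1) G.deg) (hL N hN)
    simp only [time, deg]
    nlinarith

/-- The state `σ'` has the memory and the first `k` variables of `σ`. -/
def Keeps (k : ℕ) (σ σ' : State) : Prop :=
  σ'.mem = σ.mem ∧ ∀ r, 1 ≤ r → r ≤ k → σ'.reg r = σ.reg r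

theorem Keeps.trans {k : ℕ} {σ₁ σ₂ σ₃ : State} (h : Keeps k σ₁ σ₂) (h' : Keeps k σ₂ σ₃) :
    Keeps k σ₁ σ₃ :=
  ⟨h'.1.trans h.1, fun r h1 h2 => (h'.2 r h1 h2).trans (h.2 r h1 h2)⟩

theorem Keeps.mono {k l : ℕ} {σ σ' : State} (h : Keeps l σ σ') (hkl : k ≤ l) : Keeps k σ σ' :=
  ⟨h.1, fun r h1 h2 => h.2 r h1 (h2.trans hkl)⟩

theorem keeps_update (k : ℕ) (σ : State) {r : ℕ} (hr : r = 0 ∨ k < r) (x : ℤ) :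
    Keeps k σ ⟨update σ.reg r x, σ.mem⟩ :=
  ⟨rfl, fun r' h1 h2 => update_of_ne (by omega) _ _⟩

-- The counter starts at `-1` because it is incremented before it is tested, so at most one more
-- pass than the bound is made. The last pass, on reaching the bound, leaves the bound itself in the
-- variable, in agreement with `first`.
open Classical in
theorem ends_search {k : ℕ} {b : ℤ} {P : Program} {N C : ℕ} {σ : State} (p : ℕ → Prop)
    (hN : (σ.mem b).toNat ≤ N)
    (hP : ∀ σ' (i : ℕ), Keeps k σ σ' → σ'.reg (k + 1) = i →
      Ends P σ' C fun σ'' => Keeps (k + 1) σ' σ'' ∧ σ''.reg 0 = if p i then 1 else 0) :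
    Ends (search (k + 1) b P) σ ((N + 1) * (C + 13) + 7) fun σ' =>
      Keeps k σ σ' ∧ σ'.reg (k + 1) = first (σ.mem b).toNat p := by
  set M := (σ.mem b).toNat with hM
  have key : ∀ l i, i + l = M → (∀ j < i, ¬ p j) → ∀ σ', Keeps k σ σ' →
      σ'.reg (k + 1) = (i : ℤ) - 1 → σ'.reg 0 = 0 →
      Ends (.loop (.eq (.reg 0) (.const 0)) (.seq (.assign (k + 1) (.add (.reg (k + 1)) (.const 1)))
        (.cond (.le (.mem (.const b)) (.reg (k + 1))) (.assign 0 (.const 1)) P))) σ'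
        ((l + 1) * (C + 13) + 3) fun σ' => Keeps k σ σ' ∧ σ'.reg (k + 1) = first M p := by
    -- Here `l` is the number of candidates left; all candidates below `i` have failed.
    intro l
    induction l with
    | zero =>
      intro i hi hp σ' hk hr h0
      have hb : (Test.eq (.reg 0) (.const 0)).Holds σ' := h0
      refine ⟨_, _, .loop_true hb (.seq (.assign _ _ _) (.cond_true ?_ (.assign _ _ _)))
        (.loop_false ?_), ?_, ?_, ?_⟩
      · simp only [Test.Holds, Expr.eval, hk.1, hr, update_self]
        omega
      · simp [Test.Holds, Expr.eval]
      · simp only [Test.cost, Expr.cost]; omega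
      · exact (hk.trans (keeps_update k _ (Or.inr (by omega)) _)).trans
          (keeps_update k _ (Or.inl rfl) _)
      · have : first M p = i := first_eq (Or.inl (by omega)) fun j hj => ⟨by omega, hp j hj⟩
        simp [Expr.eval, hr, this]
    | succ l ih =>
      intro i hi hp σ' hk hr h0
      have hb : (Test.eq (.reg 0) (.const 0)).Holds σ' := h0
      set σ₁ : State := ⟨update σ'.reg (k + 1) (σ'.reg (k + 1) + 1), σ'.mem⟩ with hσ₁
      have hk₁ : Keeps k σ σ₁ := hk.trans (keeps_update k _ (Or.inr (by omega)) _)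
      have hr₁ : σ₁.reg (k + 1) = i := by simp [hσ₁, hr]
      obtain ⟨σ₂, c, hrun, hc, hk₂, h0₂⟩ := hP σ₁ i hk₁ hr₁
      have hr₂ : σ₂.reg (k + 1) = i := by rw [hk₂.2 (k + 1) (by omega) le_rfl, hr₁]
      have hcond : ¬ (Test.le (.mem (.const b)) (.reg (k + 1))).Holds σ₁ := by
        simp only [Test.Holds, Expr.eval, hk₁.1, hr₁]
        omega
      have hkk := hk₁.trans (hk₂.mono (Nat.le_succ k))
      by_cases hpi : p i
      · refine ⟨σ₂, _, .loop_true hb (.seq (.assign _ _ _) (.cond_false hcond hrun))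
          (.loop_false ?_), ?_, hkk, ?_⟩
        · simp [Test.Holds, Expr.eval, h0₂, hpi]
        · simp only [Test.cost, Expr.cost, add_mul]; omega
        · rw [hr₂, first_eq (Or.inr hpi) fun j hj => ⟨by omega, hp j hj⟩]
      · obtain ⟨σ₃, d, hrun', hd, hq⟩ := ih (i + 1) (by omega)
          (fun j hj => by
            rcases Nat.lt_succ_iff_lt_or_eq.1 hj with h | rfl
            · exact hp j h
            · exact hpi) σ₂ hkk (by rw [hr₂]; push_cast; ring) (by rw [h0₂, if_neg hpi])
        refine ⟨σ₃, _, .loop_true hb (.seq (.assign _ _ _) (.cond_false hcond hrun)) hrun', ?_, hq⟩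
        simp only [Test.cost, Expr.cost]
        rw [add_mul (l + 1)]
        omega
  have hk : Keeps k σ ⟨update (update σ.reg (k + 1) (-1)) 0 0, σ.mem⟩ :=
    (keeps_update k _ (Or.inr (by omega)) _).trans
      (keeps_update k ⟨update σ.reg (k + 1) (-1), σ.mem⟩ (Or.inl rfl) _)
  obtain ⟨σ', c, hrun, hc, hq⟩ := key M 0 (by omega) (by simp) _ hk (by simp) (by simp)
  refine ⟨σ', _, .seq (.assign _ _ _) (.seq (.assign _ _ _) hrun), ?_, hq⟩
  have : (M + 1) * (C + 13) ≤ (N + 1) * (C + 13) := Nat.mul_le_mul_right _ (by omega)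
  simp only [Expr.cost]
  omega

open Classical in
theorem ends_search_compile {k : ℕ} {b : ℤ} {F : Form} {N C : ℕ} {σ : State}
    (hF : F.Scoped (k + 1) = true) (hN : (σ.mem b).toNat ≤ N)
    (h : ∀ σ' : State, σ'.mem = σ.mem → Ends (F.compile (k + 1)) σ' C fun σ'' =>
      Keeps (k + 1) σ' σ'' ∧ σ''.reg 0 = if F.Holds σ.mem (k + 1) σ'.reg then 1 else 0) :
    Ends (search (k + 1) b (F.compile (k + 1))) σ ((N + 1) * (C + 13) + 7) fun σ' =>
      Keeps k σ σ' ∧ σ'.reg (k + 1) = first (σ.mem b).toNat fun i =>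
        F.Holds σ.mem (k + 1) (update σ.reg (k + 1) (i : ℕ)) := by
  refine ends_search (fun i : ℕ => F.Holds σ.mem (k + 1) (update σ.reg (k + 1) i)) hN ?_
  intro σ' i hk hr
  refine (h σ' hk.1).mono le_rfl fun σ'' h => ⟨h.1, ?_⟩
  have hc : F.Holds σ.mem (k + 1) σ'.reg ↔ F.Holds σ.mem (k + 1) (update σ.reg (k + 1) i) := by
    refine Form.holds_congr hF fun r hr1 hr2 => ?_
    by_cases hrk : r = k + 1
    · subst hrk; simp [hr]
    · simp [hrk, hk.2 r hr1 (by omega)]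
  rw [h.2]
  exact if_congr hc rfl rfl

-- Evaluation never writes to the memory and preserves the registers `1, …, k`, so an inner search
-- cannot disturb the variables of the outer ones. This makes the induction on the formula work.
open Classical in
theorem Form.ends_compile {N : ℕ} {m : ℤ → ℤ} (h1 : (m 1).toNat ≤ N) (h2 : (m 2).toNat ≤ N)
    (F : Form) : ∀ {k : ℕ}, F.Scoped k = true → ∀ σ : State, σ.mem = m →
      Ends (F.compile k) σ (F.time N) fun σ' =>
        Keeps k σ σ' ∧ σ'.reg 0 = if F.Holds m k σ.reg then 1 else 0 := by
  induction F with
  | test b =>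
    rintro k hF σ rfl
    refine Ends.cond (fun h => Ends.assign ⟨keeps_update k _ (Or.inl rfl) _, ?_⟩)
      (fun h => Ends.assign ⟨keeps_update k _ (Or.inl rfl) _, ?_⟩)
    · simp [Expr.eval, Holds, h]
    · simp [Expr.eval, Holds, h]
  | not F ih =>
    rintro k hF σ rfl
    refine Ends.seq (ih hF σ rfl) fun σ' h =>
      Ends.assign ⟨h.1.trans (keeps_update k _ (Or.inl rfl) _), ?_⟩
    simp only [Expr.eval, Holds, h.2, update_self]
    split_ifs <;> simp_all
  | and F G ihF ihG =>
    rintro k hF σ rfl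
    simp only [Scoped, Bool.and_eq_true] at hF
    refine (Ends.seq (ihF hF.1 σ rfl) fun σ' h => Ends.cond (b := .eq (.reg 0) (.const 0))
      (P' := G.compile k) (C := G.time N + 1) (fun hb => ?_) fun hb => ?_).mono ?_ fun _ h => h
    -- When the first conjunct fails, register `0` already holds the value of the conjunction.
    · refine (Ends.skip ⟨h.1, ?_⟩).mono (by omega) fun _ h => h
      have hb : σ'.reg 0 = 0 := hb
      have : ¬ F.Holds σ.mem k σ.reg := by
        intro hF
        rw [h.2, if_pos hF] at hb
        exact one_ne_zero hb
      rw [hb, if_neg fun h => this h.1]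
    · have hb : ¬ σ'.reg 0 = 0 := hb
      have : F.Holds σ.mem k σ.reg := by
        by_contra hF
        rw [h.2, if_neg hF] at hb
        exact hb rfl
      refine (ihG hF.2 σ' h.1.1).mono (by omega) fun σ'' h' => ⟨h.1.trans h'.1, ?_⟩
      rw [h'.2, Form.holds_congr hF.2 h.1.2]
      simp [Holds, this]
    · simp only [time, Test.cost, Expr.cost]; omega
  | find b F G ihF ihG =>
    rintro k hF σ rfl
    simp only [Scoped, Bool.and_eq_true, decide_eq_true_eq] at hF
    have hb : (σ.mem b).toNat ≤ N := by rcases hF.1.1 with rfl | rfl <;> assumption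
    refine Ends.seq (ends_search_compile hF.1.2 hb fun σ' hm => ihF hF.1.2 σ' hm) ?_
    rintro σ' ⟨hk, hr⟩
    refine (ihG hF.2 σ' hk.1).mono le_rfl fun σ'' h =>
      ⟨hk.trans (h.1.mono (Nat.le_succ k)), ?_⟩
    have hc : G.Holds σ.mem (k + 1) σ'.reg ↔ (find b F G).Holds σ.mem k σ.reg := by
      refine Form.holds_congr hF.2 fun r hr1 hr2 => ?_
      by_cases hrk : r = k + 1
      · subst hrk; simp [hr]
      · simp [hrk, hk.2 r hr1 (by omega)]
    rw [h.2]
    exact if_congr hc rfl rfl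

/-! ### Derived connectives -/

namespace Form

/-- Disjunction. -/
def or (F G : Form) : Form := .not (.and (.not F) (.not G))

/-- The variable `k + 1`, bound by a search at level `k`, is within the bound of the search. -/
def found (k : ℕ) (b : ℤ) : Form := .test (.le (.add (.reg (k + 1)) (.const 1)) (.mem (.const b)))

/-- Bounded existential quantification at level `k`. -/
def ex (k : ℕ) (b : ℤ) (F : Form) : Form := .find b F (found k b)

/-- Bounded universal quantification at level `k`. -/
def all (k : ℕ) (b : ℤ) (F : Form) : Form := .not (ex k b (.not F))

/-- `G` holds for the first number for which `F` holds. -/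
def lookup (k : ℕ) (b : ℤ) (F G : Form) : Form := .find b F (.and (found k b) G)

variable {m : ℤ → ℤ} {k : ℕ} {ρ : ℕ → ℤ} {F G : Form}

theorem holds_or : (or F G).Holds m k ρ ↔ F.Holds m k ρ ∨ G.Holds m k ρ := by
  simp only [or, Holds]; tauto

theorem holds_ex {b : ℤ} {N : ℕ} (hb : m b = N) : (ex k b F).Holds m k ρ ↔
    ∃ i < N, F.Holds m (k + 1) (update ρ (k + 1) (i : ℕ)) := by
  rw [← first_lt_iff]
  simp only [ex, found, Holds, Test.Holds, Expr.eval, hb, update_self, Int.toNat_natCast]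
  omega

/-- The search stops at the first witness of `F` without consulting `G`. Uniqueness of the witness
makes this the same as a joint existential, at the sum of the two costs rather than a product. -/
theorem holds_lookup {b : ℤ} {N : ℕ} (hb : m b = N)
    (huniq : ∀ i < N, ∀ j < N, F.Holds m (k + 1) (update ρ (k + 1) (i : ℕ)) →
      F.Holds m (k + 1) (update ρ (k + 1) (j : ℕ)) → i = j) :
    (lookup k b F G).Holds m k ρ ↔
      ∃ i < N, F.Holds m (k + 1) (update ρ (k + 1) (i : ℕ)) ∧
        G.Holds m (k + 1) (update ρ (k + 1) (i : ℕ)) := by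
  simp only [lookup, found, Holds, Test.Holds, Expr.eval, hb, update_self, Int.toNat_natCast]
  set p : ℕ → Prop := fun i => F.Holds m (k + 1) (update ρ (k + 1) (i : ℕ)) with hp
  constructor
  · rintro ⟨h1, h2⟩
    have hlt : first N p < N := by omega
    exact ⟨first N p, hlt, (first_spec N p).resolve_left (by omega), h2⟩
  · rintro ⟨i, hi, h1, h2⟩
    have hlt : first N p < N := first_lt_iff.2 ⟨i, hi, h1⟩
    have : first N p = i := huniq _ hlt _ hi ((first_spec N p).resolve_left (by omega)) h1
    rw [this]
    exact ⟨by omega, h2⟩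

end Form

end TwoHAM.RAM

namespace TwoHAM

open Function Relation

/-! ### Directions -/

/-- The unit steps to the north, east, south and west. -/
def vec : Fin 4 → ℤ × ℤ := ![(0, 1), (1, 0), (0, -1), (-1, 0)]

/-- The glues of a tile, by direction. -/
def Tile.side {G : Type} (t : Tile G) : Fin 4 → G := ![t.north, t.east, t.south, t.west]

/-! ### Configurations up to translation, and embeddings. -/

namespace Config

variable {G : Type}

/-- The configuration `a` with the tile `t` placed at `x`. -/
def place (a : Config G) (x : ℤ × ℤ) (t : Tile G) : Config G :=
  fun p => if p = x then some t else a p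

open Classical in
/-- The part of `a` inside `S`. -/
noncomputable def restrict (a : Config G) (S : Set (ℤ × ℤ)) : Config G :=
  fun p => if p ∈ S then a p else none

/-- The configuration whose only tile is `t`, at `x`. -/
def singleAt (x : ℤ × ℤ) (t : Tile G) : Config G := (single t).translate (-x)

/-- `b + (-u)` is contained in `a`. -/
def Emb (b a : Config G) (u : ℤ × ℤ) : Prop := ∀ p t, b p = some t → a (p + u) = some t

theorem ext' {a b : Config G} (h : ∀ p t, a p = some t ↔ b p = some t) : a = b :=
  funext fun p => Option.ext fun t => h p t

theorem assembly_eq {a b : Config G} : a.assembly = b.assembly ↔ ∃ u, b = a.translate u :=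
  Quotient.eq (r := translationSetoid G)

theorem sub_iff {a b : Config G} : b.assembly.Sub a.assembly ↔ ∃ u, Emb b a u := by
  constructor
  · rintro ⟨b', a', hb, ha, h⟩
    obtain ⟨u, rfl⟩ := assembly_eq.1 hb
    obtain ⟨v, rfl⟩ := assembly_eq.1 ha.symm
    refine ⟨u + v, fun p t hp => ?_⟩
    have h1 : ((p + u, t) : (ℤ × ℤ) × Tile G) ∈ b'.cells := hp
    exact (add_assoc p u v) ▸ h h1
  · rintro ⟨u, h⟩
    refine ⟨b, a.translate u, rfl, (assembly_eq.2 ⟨u, rfl⟩).symm, ?_⟩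
    rintro ⟨p, t⟩ hp
    exact h p t hp

theorem place_apply (a : Config G) (x : ℤ × ℤ) (t : Tile G) (p : ℤ × ℤ) :
    a.place x t p = if p = x then some t else a p := rfl

theorem restrict_eq_some {a : Config G} {S : Set (ℤ × ℤ)} {p : ℤ × ℤ} {t : Tile G} :
    a.restrict S p = some t ↔ p ∈ S ∧ a p = some t := by
  unfold restrict
  split_ifs with h <;> simp [h]

theorem singleAt_eq_some {x p : ℤ × ℤ} {s t : Tile G} :
    singleAt x t p = some s ↔ p = x ∧ t = s := by
  unfold singleAt translate single
  have h0 : p + -x = 0 ↔ p = x := by rw [← sub_eq_add_neg, sub_eq_zero]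
  split_ifs with h
  · simp [h0.1 h]
  · simp [mt h0.2 h]

theorem singleAt_assembly (x : ℤ × ℤ) (t : Tile G) :
    (singleAt x t).assembly = (single t).assembly :=
  (assembly_eq.2 ⟨_, rfl⟩).symm

theorem translate_assembly (a : Config G) (u : ℤ × ℤ) : (a.translate u).assembly = a.assembly :=
  (assembly_eq.2 ⟨_, rfl⟩).symm

theorem Emb.maps_dom {a b : Config G} {u : ℤ × ℤ} (h : Emb b a u) :
    Set.MapsTo (· + u) b.dom a.dom := by
  rintro p ⟨t, ht⟩
  exact ⟨t, h p t ht⟩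

theorem Emb.finite {a b : Config G} {u : ℤ × ℤ} (h : Emb b a u) (ha : a.dom.Finite) :
    b.dom.Finite :=
  Set.Finite.of_injOn h.maps_dom (add_left_injective u).injOn ha

theorem Emb.ncard_le {a b : Config G} {u : ℤ × ℤ} (h : Emb b a u) (ha : a.dom.Finite) :
    b.dom.ncard ≤ a.dom.ncard :=
  Set.ncard_le_ncard_of_injOn _ h.maps_dom (add_left_injective u).injOn ha

end Config

/-! ### Bonds by direction. -/

namespace System

open Config

variable {G : Type} (Γ : System G)

/-- The strength of the bond of the tile `s` with the tile `t` next to it in the direction `d`. -/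
def bond (s : Tile G) (d : Fin 4) (t : Tile G) : ℕ := Γ.str (s.side d) (t.side (d + 2))

/-- The directions are listed in cyclic order, so `d + 2` in `Fin 4` is opposite to `d`. -/
theorem tileBond_vec (p : ℤ × ℤ) (s : Tile G) (d : Fin 4) (t : Tile G) :
    Γ.tileBond p s (p + vec d) t = Γ.bond s d t := by
  obtain ⟨x, y⟩ := p
  fin_cases d <;> simp [tileBond, vec, bond, Tile.side]

theorem exists_vec {p q : ℤ × ℤ} {s t : Tile G} (h : 0 < Γ.tileBond p s q t) :
    ∃ d, q = p + vec d := by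
  unfold tileBond at h
  split_ifs at h with h1 h2 h3 h4
  · exact ⟨1, h1⟩
  · exact ⟨3, by subst h2; ext <;> simp [vec]⟩
  · exact ⟨0, h3⟩
  · exact ⟨2, by subst h4; ext <;> simp [vec]⟩
  · exact absurd h (lt_irrefl 0)

theorem vec_injective : Injective vec := by
  intro d e
  fin_cases d <;> fin_cases e <;> simp [vec]

theorem vec_ne_zero (d : Fin 4) : vec d ≠ 0 := by
  fin_cases d <;> simp [vec]

theorem tileBond_add (p q u : ℤ × ℤ) (s t : Tile G) :
    Γ.tileBond (p + u) s (q + u) t = Γ.tileBond p s q t := by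
  have h : ∀ a b c : ℤ × ℤ, (a + u = b + u + c) = (a = b + c) := by
    intro a b c
    rw [add_right_comm, add_left_inj]
  simp only [tileBond, h]

theorem weight_eq {a : Config G} {p q : ℤ × ℤ} {s t : Tile G} (hp : a p = some s)
    (hq : a q = some t) : Γ.weight a p q = Γ.tileBond p s q t := by
  simp [weight, hp, hq]

theorem exists_of_weight_pos {a : Config G} {p q : ℤ × ℤ} (h : 0 < Γ.weight a p q) :
    ∃ s t d, a p = some s ∧ a q = some t ∧ q = p + vec d ∧ Γ.weight a p q = Γ.bond s d t := by
  unfold weight at h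
  split at h
  · rename_i s t hp hq
    obtain ⟨d, rfl⟩ := Γ.exists_vec h
    exact ⟨s, t, d, hp, hq, rfl, by rw [Γ.weight_eq hp hq, tileBond_vec]⟩
  · exact absurd h (lt_irrefl 0)

theorem weight_vec {a : Config G} {p : ℤ × ℤ} {d : Fin 4} {s t : Tile G} (hp : a p = some s)
    (hq : a (p + vec d) = some t) : Γ.weight a p (p + vec d) = Γ.bond s d t := by
  rw [Γ.weight_eq hp hq, tileBond_vec]

theorem weight_emb {a b : Config G} {u p q : ℤ × ℤ} (h : Emb b a u) (hp : p ∈ b.dom)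
    (hq : q ∈ b.dom) : Γ.weight a (p + u) (q + u) = Γ.weight b p q := by
  obtain ⟨s, hs⟩ := hp
  obtain ⟨t, ht⟩ := hq
  rw [Γ.weight_eq hs ht, Γ.weight_eq (h _ _ hs) (h _ _ ht), tileBond_add]

theorem mem_dom_of_weight {a : Config G} {p q : ℤ × ℤ} (h : 0 < Γ.weight a p q) :
    p ∈ a.dom ∧ q ∈ a.dom := by
  obtain ⟨s, t, d, hp, hq, -⟩ := Γ.exists_of_weight_pos h
  exact ⟨⟨s, hp⟩, ⟨t, hq⟩⟩

theorem weight_translate (a : Config G) (u p q : ℤ × ℤ) :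
    Γ.weight (a.translate u) p q = Γ.weight a (p + u) (q + u) := by
  unfold weight
  change (match a (p + u), a (q + u) with
    | some s, some t => Γ.tileBond p s q t
    | _, _ => 0) = _
  split <;> simp_all [tileBond_add]

theorem weight_mono {a b : Config G} (h : b.cells ⊆ a.cells) (p q : ℤ × ℤ) :
    Γ.weight b p q ≤ Γ.weight a p q := by
  rcases Nat.eq_zero_or_pos (Γ.weight b p q) with h0 | h0
  · omega
  · obtain ⟨s, t, d, hp, hq, -⟩ := Γ.exists_of_weight_pos h0
    rw [Γ.weight_eq hp hq, Γ.weight_eq (h (a := (p, s)) hp) (h (a := (q, t)) hq)]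

/-! ### Configurations connected by strong bonds -/

/-- The domain of `a` is nonempty and connected by bonds of strength at least two. -/
def Strong (a : Config G) : Prop :=
  a.dom.Nonempty ∧ ∀ p ∈ a.dom, ∀ q ∈ a.dom, ReflTransGen (fun p q => 2 ≤ Γ.weight a p q) p q

variable {Γ}

theorem strong_symm {a : Config G} {p q : ℤ × ℤ}
    (h : ReflTransGen (fun p q => 2 ≤ Γ.weight a p q) p q) :
    ReflTransGen (fun p q => 2 ≤ Γ.weight a p q) q p := by
  induction h with
  | refl => exact .refl
  | tail _ h ih => exact .head (by rwa [Γ.weight_comm]) ih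

theorem strong_mono {a b : Config G} (hba : b.cells ⊆ a.cells) {p q : ℤ × ℤ}
    (h : ReflTransGen (fun p q => 2 ≤ Γ.weight b p q) p q) :
    ReflTransGen (fun p q => 2 ≤ Γ.weight a p q) p q :=
  ReflTransGen.mono (r := fun p q => 2 ≤ Γ.weight b p q)
    (fun p q h => le_trans h (Γ.weight_mono hba p q)) _ _ h

theorem exists_crossing {α : Type*} {r : α → α → Prop} {p q : α} (h : ReflTransGen r p q)
    {P : α → Prop} (hp : P p) (hq : ¬ P q) : ∃ x y, r x y ∧ P x ∧ ¬ P y := by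
  induction h with
  | refl => exact absurd hp hq
  | @tail b c _ hbc ih =>
    by_cases hb : P b
    · exact ⟨b, c, hbc, hb, hq⟩
    · exact ih hb

theorem Strong.of_center {a : Config G} {p : ℤ × ℤ} (hp : p ∈ a.dom)
    (h : ∀ q ∈ a.dom, ReflTransGen (fun p q => 2 ≤ Γ.weight a p q) p q) : Γ.Strong a :=
  ⟨⟨p, hp⟩, fun q hq r hr => (strong_symm (h q hq)).trans (h r hr)⟩

theorem strong_singleAt (x : ℤ × ℤ) (t : Tile G) : Γ.Strong (singleAt x t) := by
  refine Strong.of_center (p := x) ⟨t, singleAt_eq_some.2 ⟨rfl, rfl⟩⟩ ?_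
  rintro q ⟨s, hs⟩
  rw [(singleAt_eq_some.1 hs).1]

theorem Strong.translate {a : Config G} (h : Γ.Strong a) (u : ℤ × ℤ) :
    Γ.Strong (a.translate u) := by
  obtain ⟨⟨p, t, hp⟩, h⟩ := h
  refine ⟨⟨p - u, t, by simpa [Config.translate] using hp⟩, fun q hq r hr => ?_⟩
  have := ReflTransGen.lift (p := fun p q => 2 ≤ Γ.weight (a.translate u) p q) (· - u)
    (fun x y hxy => by simpa [onFun, weight_translate] using hxy) _ _ (h (q + u) hq (r + u) hr)
  simpa [onFun] using this

theorem Strong.place {a : Config G} (h : Γ.Strong a) {x y : ℤ × ℤ} {t : Tile G}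
    (hy : y ∈ a.dom) (hx : a x = none) (hw : 2 ≤ Γ.weight (a.place x t) y x) :
    Γ.Strong (a.place x t) := by
  have hsub : a.cells ⊆ (a.place x t).cells := by
    rintro ⟨p, s⟩ hp
    have hp : a p = some s := hp
    change a.place x t p = some s
    rw [place_apply, if_neg, hp]
    rintro rfl
    simp [hx] at hp
  have hdom : ∀ p ∈ a.dom, p ∈ (a.place x t).dom := fun p ⟨s, hs⟩ => ⟨s, hsub (a := (p, s)) hs⟩
  refine Strong.of_center (hdom y hy) ?_
  rintro q ⟨s, hs⟩
  rw [place_apply] at hs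
  split_ifs at hs with hqx
  · subst hqx; exact .single hw
  · exact strong_mono hsub (h.2 y hy q ⟨s, hs⟩)

theorem Strong.union {a b c : Config G} (ha : Γ.Strong a) (hb : Γ.Strong b)
    (hc : a.cells ∪ b.cells = c.cells) {p q : ℤ × ℤ} (hp : p ∈ a.dom) (hq : q ∈ b.dom)
    (hw : 2 ≤ Γ.weight c p q) : Γ.Strong c := by
  have hac : a.cells ⊆ c.cells := hc ▸ Set.subset_union_left
  have hbc : b.cells ⊆ c.cells := hc ▸ Set.subset_union_right
  obtain ⟨s, hs⟩ := hp
  refine Strong.of_center (p := p) ⟨s, hac (a := (p, s)) hs⟩ ?_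
  rintro r ⟨t, ht⟩
  have : (r, t) ∈ a.cells ∪ b.cells := hc ▸ ht
  rcases this with h | h
  · exact strong_mono hac (ha.2 p ⟨s, hs⟩ r ⟨t, h⟩)
  · exact ReflTransGen.head hw (strong_mono hbc (hb.2 q hq r ⟨t, h⟩))

theorem reachable_of_strong {c : Config G} {p q : ℤ × ℤ}
    (h : ReflTransGen (fun p q => 2 ≤ Γ.weight c p q) p q) (hp : p ∈ c.dom) :
    ∃ hq : q ∈ c.dom, (Γ.bondGraph c).Reachable ⟨p, hp⟩ ⟨q, hq⟩ := by
  induction h with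
  | refl => exact ⟨hp, .refl _⟩
  | tail _ h ih =>
    obtain ⟨hb, hr⟩ := ih
    have h0 := lt_of_lt_of_le Nat.zero_lt_two h
    refine ⟨(Γ.mem_dom_of_weight h0).2, hr.trans (SimpleGraph.Adj.reachable ?_)⟩
    exact h0

/-- A strongly connected part of `c` that is divided by a cut makes the cut heavy. -/
theorem cut_of_strong (hT : Γ.temp = 2) {a c : Config G} (ha : Γ.Strong a)
    (hac : a.cells ⊆ c.cells) {S : Set c.dom} {p q : c.dom} (hp : p ∈ S) (hq : q ∉ S)
    (hpa : p.1 ∈ a.dom) (hqa : q.1 ∈ a.dom) :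
    ∃ E : Finset (c.dom × c.dom), (∀ e ∈ E, e.1 ∈ S ∧ e.2 ∉ S) ∧
      Γ.temp ≤ ∑ e ∈ E, Γ.weight c e.1 e.2 := by
  obtain ⟨x, y, hxy, ⟨hx, hxS⟩, hy⟩ := exists_crossing (P := fun x => ∃ hx, (⟨x, hx⟩ : c.dom) ∈ S)
    (strong_mono hac (ha.2 p.1 hpa q.1 hqa)) ⟨p.2, hp⟩ (fun ⟨_, h⟩ => hq h)
  have hyc := (Γ.mem_dom_of_weight (lt_of_lt_of_le Nat.zero_lt_two hxy)).2
  -- A chain of strong bonds that crosses the cut has a single bond crossing it, which is heavy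
  -- enough alone.
  refine ⟨{(⟨x, hx⟩, ⟨y, hyc⟩)}, ?_, ?_⟩
  · simp only [Finset.mem_singleton]
    rintro e rfl
    exact ⟨hxS, fun h => hy ⟨hyc, h⟩⟩
  · simpa [hT] using hxy

theorem Strong.stable (hT : Γ.temp = 2) {a : Config G} (h : Γ.Strong a) : Γ.Stable a := by
  have hne : Nonempty a.dom := h.1.to_subtype
  refine ⟨⟨fun p q => ?_⟩, ?_⟩
  · exact (reachable_of_strong (h.2 p.1 p.2 q.1 q.2) p.2).2
  · rintro S ⟨p, hp⟩ ⟨q, hq⟩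
    exact cut_of_strong hT h subset_rfl hp hq p.2 q.2

/-- Two strongly connected configurations form a stable union if there are two bonds between
them. -/
theorem stable_union (hT : Γ.temp = 2) {a b c : Config G} (ha : Γ.Strong a) (hb : Γ.Strong b)
    (hc : a.cells ∪ b.cells = c.cells) {p q p' q' : ℤ × ℤ} (hp : p ∈ a.dom) (hp' : p' ∈ a.dom)
    (hq : q ∈ b.dom) (hq' : q' ∈ b.dom) (hne : (p, q) ≠ (p', q')) (hw : 0 < Γ.weight c p q)
    (hw' : 0 < Γ.weight c p' q') : Γ.Stable c := by
  have hac : a.cells ⊆ c.cells := hc ▸ Set.subset_union_left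
  have hbc : b.cells ⊆ c.cells := hc ▸ Set.subset_union_right
  have hda : ∀ x ∈ a.dom, x ∈ c.dom := fun x ⟨s, hs⟩ => ⟨s, hac (a := (x, s)) hs⟩
  have hdb : ∀ x ∈ b.dom, x ∈ c.dom := fun x ⟨s, hs⟩ => ⟨s, hbc (a := (x, s)) hs⟩
  have hd : ∀ x ∈ c.dom, x ∈ a.dom ∨ x ∈ b.dom := by
    rintro x ⟨s, hs⟩
    have : (x, s) ∈ a.cells ∪ b.cells := hc ▸ hs
    exact this.imp (fun h => ⟨s, h⟩) fun h => ⟨s, h⟩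
  have hadj : (Γ.bondGraph c).Adj ⟨p, hda p hp⟩ ⟨q, hdb q hq⟩ := hw
  have hra : ∀ x (hx : x ∈ a.dom), (Γ.bondGraph c).Reachable ⟨p, hda p hp⟩ ⟨x, hda x hx⟩ :=
    fun x hx => (reachable_of_strong (strong_mono hac (ha.2 p hp x hx)) _).2
  have hrb : ∀ x (hx : x ∈ b.dom), (Γ.bondGraph c).Reachable ⟨q, hdb q hq⟩ ⟨x, hdb x hx⟩ :=
    fun x hx => (reachable_of_strong (strong_mono hbc (hb.2 q hq x hx)) _).2
  have hr : ∀ x : c.dom, (Γ.bondGraph c).Reachable ⟨p, hda p hp⟩ x := by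
    rintro ⟨x, hx⟩
    rcases hd x hx with h | h
    · exact hra x h
    · exact hadj.reachable.trans (hrb x h)
  have hnec : Nonempty c.dom := ⟨⟨p, hda p hp⟩⟩
  refine ⟨⟨fun x y => (hr x).symm.trans (hr y)⟩, ?_⟩
  rintro S hS hS'
  by_cases hsa : ∃ x y : c.dom, x ∈ S ∧ y ∉ S ∧ x.1 ∈ a.dom ∧ y.1 ∈ a.dom
  · obtain ⟨x, y, hx, hy, hxa, hya⟩ := hsa
    exact cut_of_strong hT ha hac hx hy hxa hya
  by_cases hsb : ∃ x y : c.dom, x ∈ S ∧ y ∉ S ∧ x.1 ∈ b.dom ∧ y.1 ∈ b.dom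
  · obtain ⟨x, y, hx, hy, hxb, hyb⟩ := hsb
    exact cut_of_strong hT hb hbc hx hy hxb hyb
  -- From here on the cut splits neither part, so it can only separate the two parts from each
  -- other, and then both bonds cross it.
  push Not at hsa hsb
  set P : c.dom := ⟨p, hda p hp⟩
  set P' : c.dom := ⟨p', hda p' hp'⟩
  set Q : c.dom := ⟨q, hdb q hq⟩
  set Q' : c.dom := ⟨q', hdb q' hq'⟩
  -- The bonds are distinct in both orientations, so that each is counted once in the sum over the
  -- pair.
  have hne1 : (P, Q) ≠ (P', Q') := by
    intro h
    simp only [P, P', Q, Q', Prod.mk.injEq, Subtype.mk.injEq] at h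
    exact hne (Prod.ext h.1 h.2)
  have hne2 : (Q, P) ≠ (Q', P') := by
    intro h
    simp only [P, P', Q, Q', Prod.mk.injEq, Subtype.mk.injEq] at h
    exact hne (Prod.ext h.2 h.1)
  have hPP : P ∈ S ↔ P' ∈ S := by
    constructor <;> intro h <;> by_contra h'
    · exact hsa _ _ h h' hp hp'
    · exact hsa _ _ h h' hp' hp
  have hQQ : Q ∈ S ↔ Q' ∈ S := by
    constructor <;> intro h <;> by_contra h'
    · exact hsb _ _ h h' hq hq'
    · exact hsb _ _ h h' hq' hq
  classical
  by_cases hP : P ∈ S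
  · by_cases hQ : Q ∈ S
    · obtain ⟨⟨x, hx⟩, hxS⟩ := hS'
      rcases hd x hx with h | h
      · exact absurd h (hsa _ ⟨x, hx⟩ hP hxS hp)
      · exact absurd h (hsb _ ⟨x, hx⟩ hQ hxS hq)
    · refine ⟨{(P, Q), (P', Q')}, ?_, ?_⟩
      · simp only [Finset.mem_insert, Finset.mem_singleton]
        rintro e (rfl | rfl)
        · exact ⟨hP, hQ⟩
        · exact ⟨hPP.1 hP, fun h => hQ (hQQ.2 h)⟩
      · rw [Finset.sum_pair hne1, hT]
        exact Nat.add_le_add hw hw'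
  · by_cases hQ : Q ∈ S
    · refine ⟨{(Q, P), (Q', P')}, ?_, ?_⟩
      · simp only [Finset.mem_insert, Finset.mem_singleton]
        rintro e (rfl | rfl)
        · exact ⟨hQ, hP⟩
        · exact ⟨hQQ.1 hQ, fun h => hP (hPP.2 h)⟩
      · rw [Finset.sum_pair hne2, hT, Γ.weight_comm _ Q.1, Γ.weight_comm _ Q'.1]
        exact Nat.add_le_add hw hw'
    · obtain ⟨⟨x, hx⟩, hxS⟩ := hS
      rcases hd x hx with h | h
      · exact absurd hp (hsa ⟨x, hx⟩ _ hxS hP h)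
      · exact absurd hq (hsb ⟨x, hx⟩ _ hxS hQ h)

/-- A strongly connected configuration has a bond leaving each of its proper parts. -/
theorem Strong.exists_boundary {b c : Config G} (hc : Γ.Strong c) (hb : b.dom.Nonempty)
    (hbc : b.cells ⊆ c.cells) (hne : b ≠ c) :
    ∃ y x t, y ∈ b.dom ∧ c x = some t ∧ b x = none ∧ 2 ≤ Γ.weight c y x := by
  have hz : ∃ z ∈ c.dom, z ∉ b.dom := by
    by_contra h
    push Not at h
    refine hne (ext' fun p t => ⟨fun hp => hbc (a := (p, t)) hp, fun hp => ?_⟩)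
    obtain ⟨s, hs⟩ := h p ⟨t, hp⟩
    have : c p = some s := hbc (a := (p, s)) hs
    rw [hs, ← this, hp]
  obtain ⟨z, hzc, hzb⟩ := hz
  obtain ⟨y, hy⟩ := hb
  have hyc : y ∈ c.dom := by
    obtain ⟨s, hs⟩ := hy
    exact ⟨s, hbc (a := (y, s)) hs⟩
  obtain ⟨y', x, hxy, hy', hx⟩ := exists_crossing (P := (· ∈ b.dom)) (hc.2 y hyc z hzc) hy hzb
  obtain ⟨t, ht⟩ := (Γ.mem_dom_of_weight (lt_of_lt_of_le Nat.zero_lt_two hxy)).2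
  refine ⟨y', x, t, hy', ht, ?_, hxy⟩
  rcases h : b x with _ | s
  · rfl
  · exact absurd ⟨s, h⟩ hx

theorem place_cells_subset {b c : Config G} (hbc : b.cells ⊆ c.cells) {x : ℤ × ℤ} {t : Tile G}
    (ht : c x = some t) : (b.place x t).cells ⊆ c.cells := by
  rintro ⟨p, s⟩ hp
  have hp : b.place x t p = some s := hp
  rw [place_apply] at hp
  split_ifs at hp with h
  · subst h
    change c p = some s
    rw [ht]
    assumption
  · exact hbc (a := (p, s)) hp

theorem weight_of_cells_subset {b c : Config G} (hbc : b.cells ⊆ c.cells) {p q : ℤ × ℤ}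
    (hp : p ∈ b.dom) (hq : q ∈ b.dom) : Γ.weight b p q = Γ.weight c p q := by
  have : Emb b c 0 := fun p t h => by
    rw [add_zero]; exact hbc (a := (p, t)) h
  have := Γ.weight_emb this hp hq
  simp only [add_zero] at this
  exact this.symm

theorem mem_dom_place {b : Config G} {x p : ℤ × ℤ} {t : Tile G} :
    p ∈ (b.place x t).dom ↔ p = x ∨ p ∈ b.dom := by
  simp only [dom, Set.mem_ofPred_eq, place_apply]
  split_ifs with h <;> simp [h]

/-- A strongly connected configuration grows from each of its strongly connected parts, by one
tile at a time. -/
theorem Strong.grow_induction {c : Config G} (hc : Γ.Strong c) (hfin : c.dom.Finite)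
    (Q : Config G → Prop)
    (step : ∀ b : Config G, b.cells ⊆ c.cells → Γ.Strong b → Q b → ∀ y x t, y ∈ b.dom →
      c x = some t → b x = none → 2 ≤ Γ.weight c y x → Γ.Strong (b.place x t) → Q (b.place x t)) :
    ∀ b : Config G, b.cells ⊆ c.cells → Γ.Strong b → Q b → Q c := by
  suffices h : ∀ n, ∀ b : Config G, (c.dom \ b.dom).ncard = n → b.cells ⊆ c.cells → Γ.Strong b →
      Q b → Q c from fun b => h _ b rfl
  intro n
  induction n using Nat.strong_induction_on with
  | _ n ih =>
    intro b hn hbc hb hQ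
    by_cases hne : b = c
    · rwa [← hne]
    obtain ⟨y, x, t, hy, hx, hxb, hw⟩ := hc.exists_boundary hb.1 hbc hne
    have hsub := place_cells_subset hbc hx
    have hS : Γ.Strong (b.place x t) := hb.place hy hxb (by
      rwa [weight_of_cells_subset hsub (mem_dom_place.2 (Or.inr hy))
        (mem_dom_place.2 (Or.inl rfl))])
    refine ih _ ?_ (b.place x t) rfl hsub hS (step b hbc hb hQ y x t hy hx hxb hw hS)
    rw [← hn]
    refine Set.ncard_lt_ncard ?_ (hfin.subset Set.sdiff_subset)
    constructor
    · rintro p ⟨hp, hp'⟩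
      exact ⟨hp, fun h => hp' (mem_dom_place.2 (Or.inr h))⟩
    · intro h
      have hxm : x ∈ c.dom \ b.dom := ⟨⟨t, hx⟩, fun ⟨s, hs⟩ => by simp [hxb] at hs⟩
      exact (h hxm).2 (mem_dom_place.2 (Or.inl rfl))

theorem combinable_place (hT : Γ.temp = 2) {b : Config G} {x : ℤ × ℤ} {t : Tile G}
    (hx : b x = none) (hS : Γ.Strong (b.place x t)) :
    Γ.Combinable b.assembly (single t).assembly (b.place x t).assembly := by
  refine ⟨b, singleAt x t, b.place x t, rfl, singleAt_assembly x t, rfl, ?_, ?_, hS.stable hT⟩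
  · ext ⟨p, s⟩
    change b p = some s ∨ singleAt x t p = some s ↔ b.place x t p = some s
    rw [singleAt_eq_some, place_apply]
    split_ifs with h
    · subst h; simp [hx]
    · simp [h]
  · ext ⟨p, s⟩
    simp only [Set.mem_inter_iff, Set.mem_empty_iff_false, iff_false, not_and]
    intro (h : b p = some s) (h' : singleAt x t p = some s)
    rw [(singleAt_eq_some.1 h').1, hx] at h
    simp at h

/-- A strongly connected finite configuration is producible. -/
theorem Strong.producible (hT : Γ.temp = 2) {c : Config G} (hc : Γ.Strong c)
    (hfin : c.dom.Finite) (htiles : ∀ p t, c p = some t → t ∈ Γ.tiles) :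
    Γ.Producible c.assembly := by
  obtain ⟨p, t, hp⟩ := hc.1
  refine hc.grow_induction hfin (fun b => Γ.Producible b.assembly) ?_ (singleAt p t) ?_
    (strong_singleAt p t) ?_
  · intro b _ _ hQ y x t _ hx hxb _ hS
    exact .combine _ _ _ hQ (.tile t (htiles x t hx)) (combinable_place hT hxb hS)
  · rintro ⟨q, s⟩ hq
    obtain ⟨rfl, rfl⟩ := singleAt_eq_some.1 hq
    exact hp
  · rw [singleAt_assembly]
    exact .tile t (htiles p t hp)

end System

end TwoHAM

/-! ### Walks in the bond graph and the criterion for unique production. -/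

/-- Every walk from `u` to `v` passes through `x`. -/
def SimpleGraph.Between {V : Type*} (G : SimpleGraph V) (u x v : V) : Prop :=
  ∀ w : G.Walk u v, x ∈ w.support

namespace TwoHAM.System

open Function Relation Config SimpleGraph

variable {G : Type} (Γ : System G)

/-- The bond graph of `a`, with all positions of the grid as vertices. -/
def grid (a : Config G) : SimpleGraph (ℤ × ℤ) where
  Adj p q := 0 < Γ.weight a p q
  symm := ⟨fun p q h => by rw [Γ.weight_comm]; exact h⟩
  loopless := ⟨fun p h => by rw [Γ.weight_self] at h; exact lt_irrefl 0 h⟩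

variable {Γ}

theorem grid_adj {a : Config G} {p q : ℤ × ℤ} : (Γ.grid a).Adj p q ↔ 0 < Γ.weight a p q := Iff.rfl

theorem mem_dom_of_walk {a : Config G} {p q : ℤ × ℤ} (hp : p ∈ a.dom) (w : (Γ.grid a).Walk p q) :
    ∀ x ∈ w.support, x ∈ a.dom := by
  induction w with
  | nil => simpa using hp
  | cons h w ih =>
    intro x hx
    rcases List.mem_cons.1 (by simpa using hx) with rfl | hx
    · exact hp
    · exact ih (Γ.mem_dom_of_weight h).2 x hx

theorem grid_isAcyclic {a : Config G} (h : (Γ.bondGraph a).IsAcyclic) : (Γ.grid a).IsAcyclic := by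
  intro p w hw
  have hp : p ∈ a.dom := by
    cases w with
    | nil => exact absurd rfl hw.ne_nil
    | cons h _ => exact (Γ.mem_dom_of_weight h).1
  have hd := mem_dom_of_walk hp w
  -- The bond graph is definitionally the subgraph of the grid graph induced on the domain, and a
  -- cycle never leaves the domain.
  have h' : ((Γ.grid a).induce a.dom).IsAcyclic := h
  refine h' (w.induce a.dom hd) ?_
  rw [← Walk.isCycle_map_iff_of_injective (f := (Embedding.induce a.dom).toHom)
    Subtype.val_injective, Walk.map_induce]
  exact hw

/-- A walk whose vertices are in `S` is a chain of strong bonds inside `S`. -/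
theorem strong_of_walk {a : Config G} (h1 : ∀ p q, Γ.weight a p q ≠ 1) {S : Set (ℤ × ℤ)}
    {p q : ℤ × ℤ} (w : (Γ.grid a).Walk p q) (hw : ∀ x ∈ w.support, x ∈ S) :
    ReflTransGen (fun p q => 2 ≤ Γ.weight (a.restrict S) p q) p q := by
  induction w with
  | nil => exact .refl
  | @cons u v _ h w ih =>
    have hu : u ∈ S := hw u (by simp)
    have hv : v ∈ S := hw v (by simp)
    refine .head ?_ (ih fun x hx => hw x (by simp [hx]))
    obtain ⟨s, t, d, hs, ht, rfl, hd⟩ := Γ.exists_of_weight_pos h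
    rw [Γ.weight_vec (restrict_eq_some.2 ⟨hu, hs⟩) (restrict_eq_some.2 ⟨hv, ht⟩), ← hd]
    have := h1 u (u + vec d)
    have : 0 < Γ.weight a u (u + vec d) := h
    omega

/-- A strongly connected part of `a` contains a walk between any two of its positions. -/
theorem Strong.exists_walk {a b : Config G} (hb : Γ.Strong b) {u : ℤ × ℤ} (h : Emb b a u)
    {p q : ℤ × ℤ} (hp : p ∈ b.dom) (hq : q ∈ b.dom) :
    ∃ w : (Γ.grid a).Walk (p + u) (q + u), ∀ x ∈ w.support, x - u ∈ b.dom := by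
  have := hb.2 p hp q hq
  clear hq
  induction this with
  | refl => exact ⟨.nil, by simpa using hp⟩
  | @tail y z _ hyz ih =>
    obtain ⟨w, hw⟩ := ih
    obtain ⟨hy, hz⟩ := Γ.mem_dom_of_weight (lt_of_lt_of_le Nat.zero_lt_two hyz)
    have hadj : (Γ.grid a).Adj (y + u) (z + u) := by
      rw [grid_adj, Γ.weight_emb h hy hz]
      omega
    refine ⟨w.concat hadj, fun x hx => ?_⟩
    rw [Walk.support_concat] at hx
    rcases List.mem_append.1 hx with hx | hx
    · exact hw x hx
    · rw [List.mem_singleton.1 hx]; simpa using hz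

theorem Strong.mem_of_between {a b : Config G} (hb : Γ.Strong b) {u : ℤ × ℤ} (h : Emb b a u)
    {p q x : ℤ × ℤ} (hp : p ∈ b.dom) (hq : q ∈ b.dom)
    (hx : (Γ.grid a).Between (p + u) x (q + u)) : x - u ∈ b.dom := by
  obtain ⟨w, hw⟩ := hb.exists_walk h hp hq
  exact hw x (hx w)

theorem restrict_dom {a : Config G} {S : Set (ℤ × ℤ)} {p : ℤ × ℤ} :
    p ∈ (a.restrict S).dom ↔ p ∈ S ∧ p ∈ a.dom := by
  simp only [dom, Set.mem_ofPred_eq, restrict_eq_some, exists_and_left]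

theorem restrict_cells_subset (a : Config G) (S : Set (ℤ × ℤ)) :
    (a.restrict S).cells ⊆ a.cells := by
  rintro ⟨p, t⟩ h
  exact (restrict_eq_some.1 h).2

/-- The conditions under which `Γ` uniquely produces the finite tree-bonded configuration `a`. -/
structure Verified (Γ : System G) (a : Config G) : Prop where
  weight_ne_one : ∀ p q, Γ.weight a p q ≠ 1
  reachable : ∀ p ∈ a.dom, ∀ q ∈ a.dom, (Γ.grid a).Reachable p q
  tiles : ∀ p t, a p = some t → t ∈ Γ.tiles
  occurs : ∀ t ∈ Γ.tiles, ∃ p, a p = some t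
  -- The positions not separated from `y` by `y + vec d` form the largest connected part containing
  -- `y` and missing `y + vec d`. Any smaller connected part with `t` attached is then covered too.
  grows : ∀ y s d, a y = some s → ∀ t ∈ Γ.tiles, 2 ≤ Γ.bond s d t → y + vec d ∈ a.dom ∧
    ∃ u, (∀ p ∈ a.dom, ¬ (Γ.grid a).Between p (y + vec d) y → a (p + u) = a p) ∧
      a (y + vec d + u) = some t
  -- The shift that brings `q` next to `p` also brings `q'` next to `p'`. Any connected parts
  -- realizing both bonds contain the two paths, so it suffices to test paths.
  blocks : ∀ p s q t p' s' q' t', ∀ d d' : Fin 4, a p = some s → a q = some t → a p' = some s' →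
    a q' = some t' → ¬ (p = p' ∧ d = d') → 0 < Γ.bond s d t → 0 < Γ.bond s' d' t' →
    p + vec d - q = p' + vec d' - q' →
    ∃ x, (Γ.grid a).Between p x p' ∧ (Γ.grid a).Between q (x - (p + vec d - q)) q'

theorem Verified.strong {a : Config G} (h : Γ.Verified a) (hne : a.dom.Nonempty) : Γ.Strong a := by
  refine ⟨hne, fun p hp q hq => ?_⟩
  obtain ⟨w⟩ := h.reachable p hp q hq
  have := strong_of_walk h.weight_ne_one w (S := Set.univ) (by simp)
  exact strong_mono (restrict_cells_subset a _) this

theorem eq_some_of_union {a b c : Config G} (h : a.cells ∪ b.cells = c.cells) {p : ℤ × ℤ}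
    {t : Tile G} : c p = some t ↔ a p = some t ∨ b p = some t := by
  change (p, t) ∈ c.cells ↔ _
  rw [← h]
  rfl

/-! ### Sufficiency -/

/-- The strong bond makes the union strongly connected, so it grows out of `a₁` one tile at a time.
At each step `grows` supplies a new embedding of the part built so far together with the next tile;
the embedding may have to move. -/
theorem Verified.emb_of_crossing {a a₁ a₂ c : Config G} (h : Γ.Verified a) (ha : a.dom.Finite)
    (h₁ : Γ.Strong a₁) (h₂ : Γ.Strong a₂) {u₁ u₂ : ℤ × ℤ} (he₁ : Emb a₁ a u₁) (he₂ : Emb a₂ a u₂)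
    (hc : a₁.cells ∪ a₂.cells = c.cells) {p q : ℤ × ℤ} (hp : p ∈ a₁.dom) (hq : q ∈ a₂.dom)
    (hw : 2 ≤ Γ.weight c p q) : Γ.Strong c ∧ ∃ u, Emb c a u := by
  have hS : Γ.Strong c := h₁.union h₂ hc hp hq hw
  have hfin : c.dom.Finite := by
    refine ((he₁.finite ha).union (he₂.finite ha)).subset ?_
    rintro x ⟨s, hs⟩
    have : (x, s) ∈ a₁.cells ∪ a₂.cells := hc ▸ hs
    exact this.imp (fun h => ⟨s, h⟩) fun h => ⟨s, h⟩
  refine ⟨hS, hS.grow_induction hfin (fun b => ∃ u, Emb b a u) ?_ a₁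
    (hc ▸ Set.subset_union_left) h₁ ⟨u₁, he₁⟩⟩
  rintro b hbc hb ⟨u, hu⟩ y x t ⟨s, hy⟩ hx hxb hw hS
  have hcy : c y = some s := hbc (a := (y, s)) hy
  have ht : t ∈ Γ.tiles := by
    have : (x, t) ∈ a₁.cells ∪ a₂.cells := hc ▸ hx
    rcases this with h' | h'
    · exact h.tiles _ _ (he₁ x t h')
    · exact h.tiles _ _ (he₂ x t h')
  obtain ⟨s', t', d, hs', ht', rfl, hd⟩ := Γ.exists_of_weight_pos (lt_of_lt_of_le Nat.zero_lt_two hw)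
  obtain rfl : s = s' := Option.some.inj (hcy.symm.trans hs')
  obtain rfl : t = t' := Option.some.inj (hx.symm.trans ht')
  obtain ⟨-, v, hv, hvx⟩ := h.grows (y + u) s d (hu y s hy) t ht (hd ▸ hw)
  refine ⟨u + v, fun p r hp => ?_⟩
  rw [place_apply] at hp
  split_ifs at hp with hpx
  · subst hpx
    rw [← hp, ← hvx]
    congr 1
    abel
  · rw [← add_assoc, hv (p + u) ⟨r, hu p r hp⟩, hu p r hp]
    -- A separated position cannot belong to `b`: a walk inside `b` would pass through the place of
    -- the new tile, which is still empty.
    intro hbt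
    have := hb.mem_of_between hu ⟨r, hp⟩ ⟨s, hy⟩ hbt
    obtain ⟨r', hr'⟩ := this
    rw [show y + u + vec d - u = y + vec d by abel, hxb] at hr'
    simp at hr'

/-- Strong connectivity is carried along in the induction because it forces each part to contain the
paths of `a` between its positions. A combination held together only by bonds of strength one, which
would destroy this invariant, is impossible by `blocks`. -/
theorem Verified.producible_emb (hT : Γ.temp = 2) {a : Config G} (h : Γ.Verified a)
    (ha : a.dom.Finite) {B : Assembly G} (hB : Γ.Producible B) :
    ∀ b : Config G, b.assembly = B → Γ.Strong b ∧ ∃ u, Emb b a u := by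
  induction hB with
  | tile t ht =>
    rintro b hb
    obtain ⟨u, rfl⟩ := assembly_eq.1 hb.symm
    obtain ⟨p, hp⟩ := h.occurs t ht
    have : (single t).translate u = singleAt (-u) t := by simp [singleAt]
    rw [this]
    refine ⟨strong_singleAt _ t, p + u, fun q s hq => ?_⟩
    obtain ⟨rfl, rfl⟩ := singleAt_eq_some.1 hq
    simpa using hp
  | combine A₁ A₂ C _ _ hC ih₁ ih₂ =>
    obtain ⟨a₁, a₂, c, h₁, h₂, hc, hU, hI, hS⟩ := hC
    obtain ⟨hs₁, u₁, he₁⟩ := ih₁ a₁ h₁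
    obtain ⟨hs₂, u₂, he₂⟩ := ih₂ a₂ h₂
    suffices hmain : Γ.Strong c ∧ ∃ u, Emb c a u by
      rintro b hb
      obtain ⟨u, rfl⟩ := assembly_eq.1 (hc.trans hb.symm)
      obtain ⟨hsc, v, hv⟩ := hmain
      exact ⟨hsc.translate u, u + v, fun p t hp => by
        rw [← add_assoc]; exact hv (p + u) t hp⟩
    have hac : a₁.cells ⊆ c.cells := hU ▸ Set.subset_union_left
    have hbc : a₂.cells ⊆ c.cells := hU ▸ Set.subset_union_right
    have hdisj : ∀ x, x ∈ a₁.dom → x ∉ a₂.dom := by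
      rintro x ⟨s, hs⟩ ⟨t, ht⟩
      have h1 : c x = some s := hac (a := (x, s)) hs
      have h2 : c x = some t := hbc (a := (x, t)) ht
      obtain rfl : s = t := Option.some.inj (h1.symm.trans h2)
      have : (x, s) ∈ a₁.cells ∩ a₂.cells := ⟨hs, ht⟩
      rw [hI] at this
      exact this
    have hcd : ∀ x ∈ c.dom, x ∉ a₁.dom → x ∈ a₂.dom := by
      rintro x ⟨s, hs⟩ hx
      have : (x, s) ∈ a₁.cells ∪ a₂.cells := hU ▸ hs
      exact ⟨s, this.resolve_left fun h => hx ⟨s, h⟩⟩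
    obtain ⟨p₁, s₁, hp₁⟩ := hs₁.1
    obtain ⟨p₂, s₂, hp₂⟩ := hs₂.1
    -- Stability is applied to the cut between the two halves.
    obtain ⟨E, hE, hsum⟩ := hS.2 {x | x.1 ∈ a₁.dom} ⟨⟨p₁, s₁, hac (a := (p₁, s₁)) hp₁⟩, s₁, hp₁⟩
      ⟨⟨p₂, s₂, hbc (a := (p₂, s₂)) hp₂⟩, fun h => hdisj _ h ⟨s₂, hp₂⟩⟩
    have hE1 : ∀ e ∈ E, e.1.1 ∈ a₁.dom := fun e he => (hE e he).1
    have hE2 : ∀ e ∈ E, e.2.1 ∈ a₂.dom := fun e he => hcd _ e.2.2 (hE e he).2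
    by_cases hstrong : ∃ e ∈ E, 2 ≤ Γ.weight c e.1 e.2
    · obtain ⟨e, he, hw⟩ := hstrong
      exact h.emb_of_crossing ha hs₁ hs₂ he₁ he₂ hU (hE1 e he) (hE2 e he) hw
    · exfalso
      push Not at hstrong
      -- Without a bond of strength two, a total of two needs two different bonds across the cut.
      obtain ⟨e, he, he0⟩ : ∃ e ∈ E, 0 < Γ.weight c e.1 e.2 := by
        by_contra hno
        push Not at hno
        have := Finset.sum_eq_zero fun e he => Nat.le_zero.1 (hno e he)
        omega
      obtain ⟨f, hf, hfe, hf0⟩ : ∃ f ∈ E, f ≠ e ∧ 0 < Γ.weight c f.1 f.2 := by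
        by_contra hno
        push Not at hno
        have := Finset.sum_eq_single_of_mem e he fun f hf hfe => Nat.le_zero.1 (hno f hf hfe)
        have := hstrong e he
        omega
      obtain ⟨s, t, d, hs, ht, hd, hb⟩ := Γ.exists_of_weight_pos he0
      obtain ⟨s', t', d', hs', ht', hd', hb'⟩ := Γ.exists_of_weight_pos hf0
      have lift₁ : ∀ (x : ℤ × ℤ) r, x ∈ a₁.dom → c x = some r → a (x + u₁) = some r := by
        rintro x r ⟨r', hr'⟩ hx
        have : c x = some r' := hac (a := (x, r')) hr'
        rw [← hx, this]
        exact he₁ _ _ hr'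
      have lift₂ : ∀ (x : ℤ × ℤ) r, x ∈ a₂.dom → c x = some r → a (x + u₂) = some r := by
        rintro x r ⟨r', hr'⟩ hx
        have : c x = some r' := hbc (a := (x, r')) hr'
        rw [← hx, this]
        exact he₂ _ _ hr'
      obtain ⟨x, hx₁, hx₂⟩ := h.blocks (e.1.1 + u₁) s (e.2.1 + u₂) t (f.1.1 + u₁) s' (f.2.1 + u₂) t'
        d d' (lift₁ _ _ (hE1 e he) hs) (lift₂ _ _ (hE2 e he) ht) (lift₁ _ _ (hE1 f hf) hs')
        (lift₂ _ _ (hE2 f hf) ht') (by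
          rintro ⟨h1, rfl⟩
          have h1 := add_right_cancel h1
          refine hfe (Prod.ext (Subtype.ext h1.symm) (Subtype.ext ?_))
          rw [hd, hd', h1]) (hb ▸ he0) (hb' ▸ hf0) (by rw [hd, hd']; abel)
      -- Each half contains the path between its two contact positions, so the overlap of the paths
      -- is an overlap of the halves.
      have h1 := hs₁.mem_of_between he₁ (hE1 e he) (hE1 f hf) hx₁
      have h2 := hs₂.mem_of_between he₂ (hE2 e he) (hE2 f hf) hx₂
      rw [show x - (e.1.1 + u₁ + vec d - (e.2.1 + u₂)) - u₂ = x - u₁ by rw [hd]; abel] at h2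
      exact hdisj _ h1 h2

/-- A producible assembly other than that of `a` sits properly inside `a`, so a tile of `a` can
still be attached to it and it is not terminal. The assembly of `a` is terminal because anything
larger would embed in `a`, against the number of tiles. -/
theorem Verified.uniquelyProduces (hT : Γ.temp = 2) {a : Config G} (h : Γ.Verified a)
    (ha : a.dom.Finite) (hne : a.dom.Nonempty) : Γ.UniquelyProduces a.assembly := by
  have hS := h.strong hne
  have hA : Γ.Producible a.assembly := hS.producible hT ha h.tiles
  have hsub : ∀ b : Config G, Γ.Producible b.assembly → Γ.Strong b ∧ ∃ u, Emb b a u :=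
    fun b hb => h.producible_emb hT ha hb b rfl
  have hlift : ∀ B : Assembly G, ∃ b : Config G, b.assembly = B := fun B => Quotient.exists_rep B
  refine ⟨?_, fun B hB => ?_⟩
  · ext B
    rw [Set.mem_singleton_iff]
    constructor
    · rintro ⟨hB, hterm⟩
      obtain ⟨b, rfl⟩ := hlift B
      obtain ⟨hbS, u, hu⟩ := hsub b hB
      have hba : (b.translate (-u)).cells ⊆ a.cells := by
        rintro ⟨p, t⟩ hp
        have : a (p + -u + u) = some t := hu (p + -u) t hp
        rwa [neg_add_cancel_right] at this
      by_contra hneq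
      obtain ⟨y, x, t, hy, hx, hxb, hw⟩ := hS.exists_boundary (hbS.translate (-u)).1 hba (by
        intro heq
        exact hneq ((translate_assembly b (-u)).symm.trans (by rw [heq])))
      have hsub' := place_cells_subset hba hx
      have hpl := (hbS.translate (-u)).place hy hxb (t := t) (by
        rwa [weight_of_cells_subset hsub' (mem_dom_place.2 (Or.inr hy))
          (mem_dom_place.2 (Or.inl rfl))])
      have := combinable_place hT hxb hpl
      rw [translate_assembly] at this
      exact hterm _ _ (.tile t (h.tiles x t hx)) this
    · rintro rfl
      refine ⟨hA, fun B C hB hC => ?_⟩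
      have hCp : Γ.Producible C := .combine _ _ _ hA hB hC
      obtain ⟨a', b', c', ha', rfl, rfl, hU, hI, -⟩ := hC
      obtain ⟨u, rfl⟩ := assembly_eq.1 ha'.symm
      obtain ⟨-, v, hv⟩ := hsub c' hCp
      obtain ⟨q, t, hq⟩ := (hsub b' hB).1.1
      have h1 := hv.ncard_le ha
      have hcf := hv.finite ha
      have h2 : (a.translate u).dom ⊂ c'.dom := by
        constructor
        · rintro x ⟨s, hs⟩
          exact ⟨s, (eq_some_of_union hU).2 (Or.inl hs)⟩
        · intro hle
          have hqc : c' q = some t := (eq_some_of_union hU).2 (Or.inr hq)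
          obtain ⟨s, hs⟩ := hle ⟨t, hqc⟩
          have hqs : c' q = some s := (eq_some_of_union hU).2 (Or.inl hs)
          obtain rfl : s = t := Option.some.inj (hqs.symm.trans hqc)
          have : (q, s) ∈ (a.translate u).cells ∩ b'.cells := ⟨hs, hq⟩
          rw [hI] at this
          exact this
      have h3 := Set.ncard_lt_ncard h2 hcf
      rw [translate_dom_ncard] at h3
      omega
  · obtain ⟨b, rfl⟩ := hlift B
    exact sub_iff.2 (hsub b hB).2

end TwoHAM.System

namespace TwoHAM.System

open Function Relation Config SimpleGraph

variable {G : Type} {Γ : System G}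

/-! ### Necessity -/

/-- A walk in a forest shortens to the unique path, so it visits everything on that path. -/
theorem between_iff_of_isPath {V : Type*} {G : SimpleGraph V} (hG : G.IsAcyclic) {u v x : V}
    {w : G.Walk u v} (hw : w.IsPath) : G.Between u x v ↔ x ∈ w.support := by
  classical
  refine ⟨fun h => h w, fun h w' => ?_⟩
  have : w'.toPath = ⟨w, hw⟩ := (hG.subsingleton_path u v).elim _ _
  have h2 : w'.bypass = w := congrArg Subtype.val this
  exact w'.support_bypass_subset_support (h2 ▸ h)

theorem dom_nonempty_of_producible {B : Assembly G} (hB : Γ.Producible B) :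
    ∀ b : Config G, b.assembly = B → b.dom.Nonempty ∧ ∀ p t, b p = some t → t ∈ Γ.tiles := by
  induction hB with
  | tile t ht =>
    rintro b hb
    obtain ⟨u, rfl⟩ := assembly_eq.1 hb.symm
    have : (single t).translate u = singleAt (-u) t := by simp [singleAt]
    rw [this]
    refine ⟨⟨-u, t, singleAt_eq_some.2 ⟨rfl, rfl⟩⟩, fun p s hp => ?_⟩
    rwa [← (singleAt_eq_some.1 hp).2]
  | combine A₁ A₂ C _ _ hC ih₁ ih₂ =>
    rintro b hb
    obtain ⟨a₁, a₂, c, h₁, h₂, hc, hU, -, -⟩ := hC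
    obtain ⟨u, rfl⟩ := assembly_eq.1 (hc.trans hb.symm)
    obtain ⟨⟨p, t, hp⟩, ht₁⟩ := ih₁ a₁ h₁
    have hp : c p = some t := (eq_some_of_union hU).2 (Or.inl hp)
    refine ⟨⟨p - u, t, by simpa [Config.translate] using hp⟩, fun q s hq => ?_⟩
    have : (q + u, s) ∈ a₁.cells ∪ a₂.cells := hU ▸ hq
    rcases this with h | h
    · exact ht₁ _ _ h
    · exact (ih₂ a₂ h₂).2 _ _ h

/-- An edge of a forest is a bridge. The cut around one of its sides consists of that edge alone, so
the edge carries the whole weight. -/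
theorem cut_bound {V : Type*} {w : V → V → ℕ} {G : SimpleGraph V}
    (hG : ∀ p q, G.Adj p q ↔ 0 < w p q) (hac : G.IsAcyclic) {τ : ℕ} (hτ : 0 < τ)
    (hcut : ∀ S : Set V, S.Nonempty → Sᶜ.Nonempty →
      ∃ E : Finset (V × V), (∀ e ∈ E, e.1 ∈ S ∧ e.2 ∉ S) ∧ τ ≤ ∑ e ∈ E, w e.1 e.2)
    {p q : V} (h : G.Adj p q) : τ ≤ w p q := by
  have hb := isAcyclic_iff_forall_adj_isBridge.1 hac h
  obtain ⟨E, hE, hsum⟩ := hcut {x | (G.deleteEdges {s(p, q)}).Reachable p x} ⟨p, .refl _⟩ ⟨q, hb⟩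
  have hz : ∀ e ∈ E, e ≠ (p, q) → w e.1 e.2 = 0 := by
    rintro ⟨x, y⟩ he hne
    obtain ⟨hx, hy⟩ := hE _ he
    by_contra h0
    have hadj : G.Adj x y := (hG x y).2 (Nat.pos_of_ne_zero h0)
    refine hy (Reachable.trans hx (Adj.reachable ?_))
    rw [deleteEdges_adj]
    refine ⟨hadj, ?_⟩
    rw [Set.mem_singleton_iff, Sym2.eq_iff]
    rintro (⟨rfl, rfl⟩ | ⟨rfl, rfl⟩)
    · exact hne rfl
    · exact hb hx
  by_cases hm : (p, q) ∈ E
  · rwa [Finset.sum_eq_single_of_mem _ hm hz] at hsum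
  · rw [Finset.sum_eq_zero fun e he => hz e he (by rintro rfl; exact hm he)] at hsum
    omega

/-- A single tile has no bonds at all; every other producible assembly is stable by definition, and
`cut_bound` applies. -/
theorem bonds_of_producible (hT : Γ.temp = 2) {a : Config G} (hA : Γ.Producible a.assembly)
    (htree : Γ.TreeBonded a.assembly) :
    (∀ p q, Γ.weight a p q ≠ 1) ∧ ∀ p ∈ a.dom, ∀ q ∈ a.dom, (Γ.grid a).Reachable p q := by
  generalize hB : a.assembly = B at hA
  cases hA with
  | tile t ht =>
    obtain ⟨u, rfl⟩ := assembly_eq.1 hB.symm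
    have : (single t).translate u = singleAt (-u) t := by simp [singleAt]
    rw [this]
    constructor
    · intro p q h
      obtain ⟨⟨s, hs⟩, ⟨r, hr⟩⟩ := Γ.mem_dom_of_weight (h.symm ▸ Nat.one_pos)
      rw [(singleAt_eq_some.1 hs).1, (singleAt_eq_some.1 hr).1, weight_self] at h
      omega
    · rintro p ⟨s, hs⟩ q ⟨r, hr⟩
      rw [(singleAt_eq_some.1 hs).1, (singleAt_eq_some.1 hr).1]
  | combine A₁ A₂ C _ _ hC =>
    obtain ⟨-, -, c, -, -, hc, -, -, hS⟩ := hC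
    have hac := htree c (hc.trans hB.symm)
    obtain ⟨u, rfl⟩ := assembly_eq.1 (hc.trans hB.symm)
    have h2 : ∀ p q, 0 < Γ.weight c p q → 2 ≤ Γ.weight c p q := by
      intro p q h
      obtain ⟨hp, hq⟩ := Γ.mem_dom_of_weight h
      rw [← hT]
      exact cut_bound (V := c.dom) (G := Γ.bondGraph c) (w := fun p q => Γ.weight c p q) (p := ⟨p, hp⟩)
        (q := ⟨q, hq⟩) (fun _ _ => Iff.rfl) hac Γ.temp_pos hS.2 h
    constructor
    · intro p q h
      rw [weight_translate] at h
      have := h2 _ _ (h.symm ▸ Nat.one_pos)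
      omega
    · intro p hp q hq
      have hr := hS.1.preconnected ⟨p + u, hp⟩ ⟨q + u, hq⟩
      let f : Γ.bondGraph c →g Γ.grid (c.translate u) :=
        { toFun := fun x => x.1 - u
          map_rel' := fun {x y} h => by
            rw [grid_adj, weight_translate, sub_add_cancel, sub_add_cancel]
            exact h }
      have := hr.map f
      simpa [f] using this

theorem strong_restrict_between {a : Config G} (h1 : ∀ p q, Γ.weight a p q ≠ 1)
    (hac : (Γ.grid a).IsAcyclic) {p q : ℤ × ℤ} (hp : p ∈ a.dom)
    (hr : (Γ.grid a).Reachable p q) :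
    Γ.Strong (a.restrict {x | (Γ.grid a).Between p x q}) := by
  classical
  obtain ⟨w, hw⟩ := hr.exists_isPath
  refine Strong.of_center (p := p) (restrict_dom.2 ⟨fun w => w.start_mem_support, hp⟩) ?_
  intro x hx
  have hx : x ∈ w.support := (restrict_dom.1 hx).1 w
  refine strong_of_walk h1 (w.takeUntil x hx) fun y hy => ?_
  exact (between_iff_of_isPath hac hw).2 (w.support_takeUntil_subset_support hx hy)

/-- Each vertex of a walk to `y` that avoids `x` starts such a walk itself, so the walk stays in the
set. -/
theorem strong_restrict_not_between {a : Config G} (h1 : ∀ p q, Γ.weight a p q ≠ 1)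
    {x y : ℤ × ℤ} (hy : y ∈ a.dom) (hxy : x ≠ y) :
    Γ.Strong (a.restrict {p | ¬ (Γ.grid a).Between p x y}) := by
  classical
  refine Strong.of_center (p := y) (restrict_dom.2 ⟨fun h => ?_, hy⟩) ?_
  · have := h .nil
    simp [hxy] at this
  · intro p hp
    obtain ⟨w, hw⟩ := not_forall.1 (restrict_dom.1 hp).1
    refine strong_symm (strong_of_walk h1 w fun z hz hb => hw ?_)
    exact w.support_dropUntil_subset_support hz (hb (w.dropUntil z hz))

/-- The branch `D` at `y` with `t` attached is strongly connected, hence producible, hence contained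
in the target; the containment is the required shift. -/
theorem grows_of_uniquelyProduces (hT : Γ.temp = 2) {a : Config G} (ha : a.dom.Finite)
    (htiles : ∀ p t, a p = some t → t ∈ Γ.tiles)
    (hsub : ∀ B, Γ.Producible B → B.Sub a.assembly) (h1 : ∀ p q, Γ.weight a p q ≠ 1)
    (hconn : ∀ p ∈ a.dom, ∀ q ∈ a.dom, (Γ.grid a).Reachable p q) {y : ℤ × ℤ} {s : Tile G}
    {d : Fin 4} (hy : a y = some s) {t : Tile G} (ht : t ∈ Γ.tiles) (hb : 2 ≤ Γ.bond s d t) :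
    y + vec d ∈ a.dom ∧
    ∃ u, (∀ p ∈ a.dom, ¬ (Γ.grid a).Between p (y + vec d) y → a (p + u) = a p) ∧
      a (y + vec d + u) = some t := by
  set x := y + vec d with hx
  have hxy : x ≠ y := by simp [hx, vec_ne_zero]
  set D := a.restrict {p | ¬ (Γ.grid a).Between p x y} with hD
  have hDS : Γ.Strong D := strong_restrict_not_between h1 ⟨s, hy⟩ hxy
  have hDx : D x = none := by
    rcases h : D x with _ | r
    · rfl
    · exact absurd (fun w => w.start_mem_support) (restrict_eq_some.1 h).1
  have hyD : D y = some s := by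
    refine restrict_eq_some.2 ⟨fun h => ?_, hy⟩
    have := h .nil
    simp [hxy] at this
  have hw : 2 ≤ Γ.weight (D.place x t) y x := by
    rw [hx, Γ.weight_vec (s := s) (t := t)]
    · exact hb
    · rw [place_apply, if_neg hxy.symm, hyD]
    · rw [place_apply, if_pos rfl]
  have hS := hDS.place ⟨s, hyD⟩ hDx hw
  have hdom : (D.place x t).dom ⊆ insert x a.dom := by
    intro p hp
    rcases mem_dom_place.1 hp with rfl | hp
    · exact Set.mem_insert _ _
    · exact Set.mem_insert_of_mem _ (restrict_dom.1 hp).2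
  have hfin : (D.place x t).dom.Finite := (ha.insert x).subset hdom
  have hP : Γ.Producible (D.place x t).assembly := by
    refine hS.producible hT hfin fun p r hp => ?_
    rw [place_apply] at hp
    split_ifs at hp
    · rwa [← Option.some.inj hp]
    · exact htiles p r (restrict_eq_some.1 hp).2
  obtain ⟨u, hu⟩ := sub_iff.1 (hsub _ hP)
  refine ⟨?_, u, ?_, hu x t (by rw [place_apply, if_pos rfl])⟩
  -- An unoccupied `x` separates nothing, so `D` would be all of `a`, and one more tile could not
  -- fit into `a`.
  · by_contra hxa
    have hsubset : insert x a.dom ⊆ (D.place x t).dom := by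
      intro p hp
      rcases hp with rfl | hp
      · exact mem_dom_place.2 (Or.inl rfl)
      · refine mem_dom_place.2 (Or.inr (restrict_dom.2 ⟨fun h => ?_, hp⟩))
        obtain ⟨w⟩ := hconn p hp y ⟨s, hy⟩
        exact hxa (mem_dom_of_walk hp w x (h w))
    have h2 := Set.ncard_le_ncard hsubset hfin
    rw [Set.ncard_insert_of_notMem hxa ha] at h2
    have := hu.ncard_le ha
    omega
  · rintro p ⟨r, hp⟩ hpb
    rw [hp]
    refine hu p r ?_
    rw [place_apply, if_neg, restrict_eq_some]
    · exact ⟨hpb, hp⟩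
    · rintro rfl
      exact hpb fun w => w.start_mem_support

/-- If the paths were disjoint after the shift, they would be two producible assemblies combinable
through their two bonds. The result would embed in `a` and close a cycle there. -/
theorem blocks_of_uniquelyProduces (hT : Γ.temp = 2) {a : Config G} (ha : a.dom.Finite)
    (htiles : ∀ p t, a p = some t → t ∈ Γ.tiles)
    (hsub : ∀ B, Γ.Producible B → B.Sub a.assembly) (h1 : ∀ p q, Γ.weight a p q ≠ 1)
    (hconn : ∀ p ∈ a.dom, ∀ q ∈ a.dom, (Γ.grid a).Reachable p q) (hac : (Γ.grid a).IsAcyclic)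
    {p s q t p' s' q' t'} {d d' : Fin 4} (hp : a p = some s) (hq : a q = some t)
    (hp' : a p' = some s') (hq' : a q' = some t') (hne : ¬ (p = p' ∧ d = d'))
    (hb : 0 < Γ.bond s d t) (hb' : 0 < Γ.bond s' d' t')
    (hpq : p + vec d - q = p' + vec d' - q') :
    ∃ x, (Γ.grid a).Between p x p' ∧ (Γ.grid a).Between q (x - (p + vec d - q)) q' := by
  by_contra hno
  push Not at hno
  set u := p + vec d - q with hu
  set b₁ := a.restrict {x | (Γ.grid a).Between p x p'} with hb₁
  set b₂ := (a.restrict {x | (Γ.grid a).Between q x q'}).translate (-u) with hb₂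
  have hs₁ : Γ.Strong b₁ :=
    strong_restrict_between h1 hac ⟨s, hp⟩ (hconn p ⟨s, hp⟩ p' ⟨s', hp'⟩)
  have hs₂ : Γ.Strong b₂ :=
    (strong_restrict_between h1 hac ⟨t, hq⟩ (hconn q ⟨t, hq⟩ q' ⟨t', hq'⟩)).translate (-u)
  have h₁ : ∀ x r, b₁ x = some r ↔ (Γ.grid a).Between p x p' ∧ a x = some r :=
    fun x r => restrict_eq_some
  have h₂ : ∀ x r, b₂ x = some r ↔ (Γ.grid a).Between q (x - u) q' ∧ a (x - u) = some r := by
    intro x r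
    rw [sub_eq_add_neg]
    exact restrict_eq_some
  have hdisj : ∀ x, x ∈ b₁.dom → x ∉ b₂.dom := by
    rintro x ⟨r, hr⟩ ⟨r', hr'⟩
    exact hno x ((h₁ x r).1 hr).1 ((h₂ x r').1 hr').1
  have hpb : b₁ p = some s := (h₁ _ _).2 ⟨fun w => w.start_mem_support, hp⟩
  have hpb' : b₁ p' = some s' := (h₁ _ _).2 ⟨fun w => w.end_mem_support, hp'⟩
  have hqb : b₂ (p + vec d) = some t := by
    rw [h₂, show p + vec d - u = q by rw [hu]; abel]
    exact ⟨fun w => w.start_mem_support, hq⟩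
  have hqb' : b₂ (p' + vec d') = some t' := by
    rw [h₂, show p' + vec d' - u = q' by rw [hpq]; abel]
    exact ⟨fun w => w.end_mem_support, hq'⟩
  let c : Config G := fun x => (b₁ x).or (b₂ x)
  have hc : ∀ x r, c x = some r ↔ b₁ x = some r ∨ b₂ x = some r := by
    intro x r
    change (b₁ x).or (b₂ x) = some r ↔ _
    rcases e1 : b₁ x with _ | r1
    · simp
    · rcases e2 : b₂ x with _ | r2
      · simp
      · exact absurd ⟨r2, e2⟩ (hdisj x ⟨r1, e1⟩)
  have hU : b₁.cells ∪ b₂.cells = c.cells := by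
    ext ⟨x, r⟩
    exact (hc x r).symm
  have hI : b₁.cells ∩ b₂.cells = ∅ := by
    ext ⟨x, r⟩
    simp only [Set.mem_inter_iff, Set.mem_empty_iff_false, iff_false, not_and]
    exact fun h h' => hdisj x ⟨r, h⟩ ⟨r, h'⟩
  have hw : Γ.weight c p (p + vec d) = Γ.bond s d t :=
    Γ.weight_vec ((hc _ _).2 (Or.inl hpb)) ((hc _ _).2 (Or.inr hqb))
  have hw' : Γ.weight c p' (p' + vec d') = Γ.bond s' d' t' :=
    Γ.weight_vec ((hc _ _).2 (Or.inl hpb')) ((hc _ _).2 (Or.inr hqb'))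
  have hne2 : (p, p + vec d) ≠ (p', p' + vec d') := by
    intro h
    simp only [Prod.mk.injEq] at h
    obtain ⟨rfl, h⟩ := h
    exact hne ⟨rfl, vec_injective (add_left_cancel h)⟩
  have hstable : Γ.Stable c := stable_union hT hs₁ hs₂ hU ⟨s, hpb⟩ ⟨s', hpb'⟩ ⟨t, hqb⟩ ⟨t', hqb'⟩
    hne2 (hw ▸ hb) (hw' ▸ hb')
  have hd₁ : b₁.dom ⊆ a.dom := fun x ⟨r, hr⟩ => ⟨r, ((h₁ x r).1 hr).2⟩
  have he₂ : Emb b₂ a (-u) := fun x r hr => by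
    rw [← sub_eq_add_neg]
    exact ((h₂ x r).1 hr).2
  have hP₁ : Γ.Producible b₁.assembly :=
    hs₁.producible hT (ha.subset hd₁) fun x r hr => htiles x r ((h₁ x r).1 hr).2
  have hP₂ : Γ.Producible b₂.assembly :=
    hs₂.producible hT (he₂.finite ha) fun x r hr => htiles _ r ((h₂ x r).1 hr).2
  obtain ⟨v, hv⟩ := sub_iff.1 (hsub _ (.combine _ _ _ hP₁ hP₂ ⟨_, _, c, rfl, rfl, rfl, hU, hI, hstable⟩))
  have hv₁ : Emb b₁ a v := fun x r hr => hv x r ((hc x r).2 (Or.inl hr))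
  have hv₂ : Emb b₂ a v := fun x r hr => hv x r ((hc x r).2 (Or.inr hr))
  have hcd : ∀ x r, c x = some r → x ∈ c.dom := fun x r h => ⟨r, h⟩
  have hadj : (Γ.grid a).Adj (p + v) (p + vec d + v) := by
    rw [grid_adj, Γ.weight_emb hv (hcd _ s ((hc _ _).2 (Or.inl hpb)))
      (hcd _ t ((hc _ _).2 (Or.inr hqb))), hw]
    exact hb
  have hadj' : (Γ.grid a).Adj (p' + v) (p' + vec d' + v) := by
    rw [grid_adj, Γ.weight_emb hv (hcd _ s' ((hc _ _).2 (Or.inl hpb')))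
      (hcd _ t' ((hc _ _).2 (Or.inr hqb'))), hw']
    exact hb'
  obtain ⟨w₁, hw₁⟩ := hs₁.exists_walk hv₁ ⟨s, hpb⟩ ⟨s', hpb'⟩
  obtain ⟨w₂, hw₂⟩ := hs₂.exists_walk hv₂ ⟨t', hqb'⟩ ⟨t, hqb⟩
  -- The first path, the second bond and the reversed second path connect the ends of the first
  -- bond. As a bridge this bond must occur among their edges, and disjointness rules out each
  -- place.
  have hmem := isBridge_iff_forall_walk_mem_edges.1
    (isAcyclic_iff_forall_adj_isBridge.1 hac hadj) (w₁.append (.cons hadj' w₂))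
  rw [Walk.edges_append, Walk.edges_cons, List.mem_append, List.mem_cons] at hmem
  rcases hmem with h | h | h
  · have := hw₁ _ (Walk.snd_mem_support_of_mem_edges _ h)
    rw [add_sub_cancel_right] at this
    exact hdisj _ this ⟨t, hqb⟩
  · rw [Sym2.eq_iff] at h
    rcases h with ⟨h, h'⟩ | ⟨h, h'⟩
    · exact hne2 (Prod.ext (add_right_cancel h) (add_right_cancel h'))
    · exact hdisj p ⟨s, hpb⟩ (add_right_cancel h ▸ ⟨t', hqb'⟩)
  · have := hw₂ _ (Walk.fst_mem_support_of_mem_edges _ h)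
    rw [add_sub_cancel_right] at this
    exact hdisj _ ⟨s, hpb⟩ this

theorem UniquelyProduces.verified (hT : Γ.temp = 2) {a : Config G} (ha : a.dom.Finite)
    (htree : Γ.TreeBonded a.assembly) (h : Γ.UniquelyProduces a.assembly) : Γ.Verified a := by
  have hA : Γ.Producible a.assembly := (h.1.ge rfl).1
  obtain ⟨h1, hconn⟩ := bonds_of_producible hT hA htree
  have htiles := (dom_nonempty_of_producible hA a rfl).2
  refine ⟨h1, hconn, htiles, fun t ht => ?_, fun y s d hy t ht hb => ?_, ?_⟩
  · obtain ⟨u, hu⟩ := sub_iff.1 (h.2 _ (.tile t ht))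
    exact ⟨_, hu 0 t (by simp [single])⟩
  · exact grows_of_uniquelyProduces hT ha htiles h.2 h1 hconn hy ht hb
  · intro p s q t p' s' q' t' d d' hp hq hp' hq' hne hb hb' hpq
    exact blocks_of_uniquelyProduces hT ha htiles h.2 h1 hconn (grid_isAcyclic (htree a rfl))
      hp hq hp' hq' hne hb hb' hpq

theorem uniquelyProduces_iff (hT : Γ.temp = 2) {a : Config G} (ha : a.dom.Finite)
    (hne : a.dom.Nonempty) (htree : Γ.TreeBonded a.assembly) :
    Γ.UniquelyProduces a.assembly ↔ Γ.Verified a :=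
  ⟨fun h => h.verified hT ha htree, fun h => h.uniquelyProduces hT ha hne⟩

end TwoHAM.System

namespace TwoHAM

/-! ### Reading the input word -/

theorem getD_flatMap {α β : Type*} (f : α → List β) (x : β) (c : ℕ)
    (hf : ∀ a, (f a).length = c) (l : List α) {i j : ℕ} (hi : i < l.length) (hj : j < c) :
    (l.flatMap f).getD (c * i + j) x = (f l[i]).getD j x := by
  induction l generalizing i with
  | nil => simp at hi
  | cons a l ih =>
    rw [List.flatMap_cons]
    cases i with
    | zero => rw [List.getD_append _ _ _ _ (by rw [hf]; omega)]; simp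
    | succ i =>
      rw [List.getD_append_right _ _ _ _ (by rw [hf, Nat.mul_succ]; omega), hf]
      have : c * (i + 1) + j - c = c * i + j := by rw [Nat.mul_succ]; omega
      rw [this, ih (by simpa using hi)]
      simp

theorem length_flatMap {α β : Type*} (f : α → List β) (c : ℕ) (hf : ∀ a, (f a).length = c)
    (l : List α) : (l.flatMap f).length = c * l.length := by
  induction l with
  | nil => simp
  | cons a l ih => rw [List.flatMap_cons, List.length_append, hf, ih, List.length_cons]; ring

theorem getD_append_add {α : Type*} (l l' : List α) (x : α) (n : ℕ) :
    (l ++ l').getD (l.length + n) x = l'.getD n x := by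
  rw [List.getD_append_right _ _ _ _ (by omega), Nat.add_sub_cancel_left]

/-- The memory `m` holds the tile types, the placed tiles and the strengths of an instance. -/
structure Loaded {s : ℕ} (Γ : System (Fin s)) (tiles : List (Tile (Fin s)))
    (placed : List ((ℤ × ℤ) × Tile (Fin s))) (m : ℤ → ℤ) : Prop where
  num_tiles : m 1 = tiles.length
  num_placed : m 2 = placed.length
  tile : ∀ (i : ℕ) (h : i < tiles.length) (d : Fin 4),
    m (3 + d.val + 4 * i) = (tiles[i].side d).val
  pos_fst : ∀ (i : ℕ) (h : i < placed.length),
    m (3 + 4 * tiles.length + 6 * i) = placed[i].1.1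
  pos_snd : ∀ (i : ℕ) (h : i < placed.length),
    m (4 + 4 * tiles.length + 6 * i) = placed[i].1.2
  glue : ∀ (i : ℕ) (h : i < placed.length) (d : Fin 4),
    m (5 + d.val + 4 * tiles.length + 6 * i) = (placed[i].2.side d).val
  -- Strengths are read through an indirect address. Its sign is recorded so that writes at negative
  -- addresses cannot affect them, as `Loaded.congr` needs.
  row_nonneg : ∀ g : Fin s, 0 ≤ m (3 + 4 * tiles.length + 6 * placed.length + g.val)
  str : ∀ g h : Fin s,
    m (m (3 + 4 * tiles.length + 6 * placed.length + g.val) + h.val) = Γ.str g h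

theorem loaded_start {s : ℕ} (Γ : System (Fin s)) (tiles : List (Tile (Fin s)))
    (placed : List ((ℤ × ℤ) × Tile (Fin s))) :
    Loaded Γ tiles placed (RAM.start (encode Γ.str tiles placed)).mem := by
  set w := encode Γ.str tiles placed with hw
  have hmem : ∀ k : ℕ, (RAM.start w).mem (k : ℤ) = w.getD k 0 := by
    intro k
    simp [RAM.start]
  have hmem' : ∀ (z : ℤ) (k : ℕ), z = k → (RAM.start w).mem z = w.getD k 0 := by
    rintro z k rfl
    exact hmem k
  set L₁ : List ℤ := [(s : ℤ), (tiles.length : ℤ), (placed.length : ℤ)] with hL₁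
  set L₂ := tiles.flatMap encodeTile with hL₂
  set L₃ := placed.flatMap encodeCell with hL₃
  set L₄ := (List.finRange s).map (fun g =>
        (3 + 4 * tiles.length + 6 * placed.length + s + g.val * s : ℤ)) with hL₄
  set L₅ := (List.finRange s).flatMap (fun g => (List.finRange s).map (fun h => (Γ.str g h : ℤ)))
    with hL₅
  -- Nested to the right, so that `getD_append_add` strips one section at a time.
  have hw' : w = L₁ ++ (L₂ ++ (L₃ ++ (L₄ ++ L₅))) := by
    rw [hw, encode]
    simp only [List.append_assoc, L₁, L₂, L₃, L₄, L₅]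
  have l₁ : L₁.length = 3 := rfl
  have l₂ : L₂.length = 4 * tiles.length := length_flatMap _ 4 (fun _ => rfl) _
  have l₃ : L₃.length = 6 * placed.length := length_flatMap _ 6 (fun _ => rfl) _
  have l₄ : L₄.length = s := by simp [hL₄]
  have hT : ∀ i (h : i < tiles.length) j, j < 4 →
      w.getD (3 + (4 * i + j)) 0 = (encodeTile tiles[i]).getD j 0 := by
    intro i h j hj
    rw [hw', ← l₁, getD_append_add, List.getD_append _ _ _ _ (by rw [l₂]; omega), hL₂,
      getD_flatMap _ _ 4 (fun _ => rfl) _ h hj]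
  have hC : ∀ i (h : i < placed.length) j, j < 6 →
      w.getD (3 + (4 * tiles.length + (6 * i + j))) 0 = (encodeCell placed[i]).getD j 0 := by
    intro i h j hj
    rw [hw', ← l₁, getD_append_add, ← l₂, getD_append_add,
      List.getD_append _ _ _ _ (by rw [l₃]; omega), hL₃,
      getD_flatMap _ _ 6 (fun _ => rfl) _ h hj]
  have hrow : ∀ g : Fin s,
      (RAM.start w).mem (3 + 4 * tiles.length + 6 * placed.length + g.val) =
        (3 + 4 * tiles.length + 6 * placed.length + s + g.val * s : ℤ) := by
    intro g
    have hg : (List.finRange s)[g.val]'(by simp) = g := by simp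
    rw [hmem' _ (3 + (4 * tiles.length + (6 * placed.length + g.val))) (by push_cast; ring), hw',
      ← l₁, getD_append_add, ← l₂, getD_append_add, ← l₃, getD_append_add,
      List.getD_append _ _ _ _ (by rw [l₄]; exact g.2), hL₄,
      List.getD_eq_getElem _ _ (by simp), List.getElem_map, hg]
  refine ⟨?_, ?_, ?_, ?_, ?_, ?_, fun g => by rw [hrow]; positivity, ?_⟩
  · rw [hmem' 1 1 rfl, hw']; rfl
  · rw [hmem' 2 2 rfl, hw']; rfl
  · intro i h d
    rw [hmem' _ (3 + (4 * i + d.val)) (by push_cast; ring), hT i h _ d.2]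
    fin_cases d <;> rfl
  · intro i h
    rw [hmem' _ (3 + (4 * tiles.length + (6 * i + 0))) (by push_cast; ring), hC i h 0 (by omega)]
    rfl
  · intro i h
    rw [hmem' _ (3 + (4 * tiles.length + (6 * i + 1))) (by push_cast; ring), hC i h 1 (by omega)]
    rfl
  · intro i h d
    rw [hmem' _ (3 + (4 * tiles.length + (6 * i + (2 + d.val)))) (by push_cast; ring),
      hC i h _ (by omega)]
    fin_cases d <;> rfl
  · intro g h
    have hg : (List.finRange s)[g.val]'(by simp) = g := by simp
    have hh : (List.finRange s)[h.val]'(by simp) = h := by simp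
    rw [hrow g, hmem' _ (3 + (4 * tiles.length + (6 * placed.length + (s + (s * g.val + h.val)))))
      (by push_cast; ring), hw', ← l₁, getD_append_add, ← l₂, getD_append_add, ← l₃,
      getD_append_add]
    conv_lhs => arg 2; arg 1; rw [← l₄]
    rw [getD_append_add, hL₅, getD_flatMap _ _ s (fun _ => by simp) _ (by simp) h.2,
      List.getD_eq_getElem _ _ (by simp), List.getElem_map]
    simp only [hg, hh]

/-- Only the nonnegative addresses matter for the input. -/
theorem Loaded.congr {s : ℕ} {Γ : System (Fin s)} {tiles : List (Tile (Fin s))}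
    {placed : List ((ℤ × ℤ) × Tile (Fin s))} {m m' : ℤ → ℤ} (h : Loaded Γ tiles placed m)
    (hm : ∀ z, 0 ≤ z → m' z = m z) : Loaded Γ tiles placed m' where
  num_tiles := by rw [hm _ (by omega), h.num_tiles]
  num_placed := by rw [hm _ (by omega), h.num_placed]
  tile i hi d := by rw [hm _ (by omega), h.tile i hi d]
  pos_fst i hi := by rw [hm _ (by omega), h.pos_fst i hi]
  pos_snd i hi := by rw [hm _ (by omega), h.pos_snd i hi]
  glue i hi d := by rw [hm _ (by omega), h.glue i hi d]
  row_nonneg g := by rw [hm _ (by omega)]; exact h.row_nonneg g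
  str g g' := by
    rw [hm (3 + 4 * tiles.length + 6 * placed.length + g.val) (by omega),
      hm _ (by have := h.row_nonneg g; omega), h.str g g']

end TwoHAM

namespace TwoHAM

open Function (update update_self update_of_ne)

theorem Tile.ext_side {G : Type} {s t : Tile G} : s = t ↔ ∀ d, s.side d = t.side d := by
  refine ⟨fun h d => by rw [h], fun h => ?_⟩
  exact Tile.ext (h 0) (h 1) (h 2) (h 3)

namespace RAM

/-! ### Expressions over the input -/

namespace Expr

/-- Four times `e`. -/
def four (e : Expr) : Expr := .add (.add e e) (.add e e)

/-- Six times `e`. -/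
def six (e : Expr) : Expr := .add (four e) (.add e e)

/-- The entry `k - 3` of the record of the placed tile with the number in register `r`. -/
def cell (r : ℕ) (k : ℤ) : Expr :=
  .mem (.add (.add (.const k) (four (.mem (.const 1)))) (six (.reg r)))

/-- A glue of the placed tile with the number in register `r`. -/
def cellSide (r : ℕ) (d : Fin 4) : Expr := cell r (5 + d.val)

/-- A glue of the tile type with the number in register `r`. -/
def tileSide (r : ℕ) (d : Fin 4) : Expr := .mem (.add (.const (3 + d.val)) (four (.reg r)))

/-- The strength of a pair of glues. -/
def strength (g h : Expr) : Expr :=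
  .mem (.add (.mem (.add (.add (.add (.const 3) (four (.mem (.const 1)))) (six (.mem (.const 2))))
    g)) h)

/-- The bond between placed tiles when the second is next to the first in the direction `d`. -/
def cellBond (r : ℕ) (d : Fin 4) (r' : ℕ) : Expr := strength (cellSide r d) (cellSide r' (d + 2))

/-- The bond between a placed tile and a tile type next to it in the direction `d`. -/
def tileBond (r : ℕ) (d : Fin 4) (r' : ℕ) : Expr := strength (cellSide r d) (tileSide r' (d + 2))

/-- The address of the entry of the distance table for a pair of placed tiles. -/
def distAddr (r r' : ℕ) : Expr :=
  .sub (.sub (.const (-2)) (.mem (.sub (.const (-2)) (.reg r)))) (.reg r')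

/-- The entry of the distance table for a pair of placed tiles. -/
def dist (r r' : ℕ) : Expr := .mem (distAddr r r')

/-- The position of a placed tile. -/
def pos (r : ℕ) : Expr × Expr := (cell r 3, cell r 4)

/-- The value of a pair of expressions. -/
def evalPair (σ : State) (P : Expr × Expr) : ℤ × ℤ := (P.1.eval σ, P.2.eval σ)

/-- The sum of two pairs. -/
def addPair (P Q : Expr × Expr) : Expr × Expr := (.add P.1 Q.1, .add P.2 Q.2)

/-- The difference of two pairs. -/
def subPair (P Q : Expr × Expr) : Expr × Expr := (.sub P.1 Q.1, .sub P.2 Q.2)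

/-- The pair `P + vec d`. -/
def step (P : Expr × Expr) (d : Fin 4) : Expr × Expr :=
  addPair P (.const (vec d).1, .const (vec d).2)

variable {σ : State} {P Q : Expr × Expr}

theorem evalPair_add : evalPair σ (addPair P Q) = evalPair σ P + evalPair σ Q := rfl

theorem evalPair_sub : evalPair σ (subPair P Q) = evalPair σ P - evalPair σ Q := rfl

theorem evalPair_step {d : Fin 4} : evalPair σ (step P d) = evalPair σ P + vec d := rfl

theorem eval_four {e : Expr} : (four e).eval σ = 4 * e.eval σ := by simp only [four, eval]; ring

theorem eval_six {e : Expr} : (six e).eval σ = 6 * e.eval σ := by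
  simp only [six, eval, eval_four]; ring

end Expr

/-- The register `r` holds the number of the entry `x` of the list `l`. -/
def IsAt {α : Type} (l : List α) (ρ : ℕ → ℤ) (r : ℕ) (x : α) : Prop :=
  ∃ (i : ℕ) (h : i < l.length), ρ r = i ∧ l[i] = x

theorem IsAt.mem {α : Type} {l : List α} {ρ : ℕ → ℤ} {r : ℕ} {x : α} (h : IsAt l ρ r x) :
    x ∈ l := by
  obtain ⟨i, hi, -, rfl⟩ := h
  exact List.getElem_mem hi

/-- Carries what is known about an outer variable under the next quantifier; for numeral registers
the side conditions are filled in automatically. -/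
theorem IsAt.keep {α : Type} {l : List α} {ρ ρ' : ℕ → ℤ} {k r : ℕ} {x : α} (h : IsAt l ρ r x)
    (hk : ∀ r, 1 ≤ r → r ≤ k → ρ' r = ρ r) (h1 : 1 ≤ r := by omega) (h2 : r ≤ k := by omega) :
    IsAt l ρ' r x := by
  obtain ⟨i, hi, hr, hx⟩ := h
  exact ⟨i, hi, (hk r h1 h2).trans hr, hx⟩

section Loaded

open RAM.Expr

variable {s : ℕ} {Γ : System (Fin s)} {tiles : List (Tile (Fin s))}
  {placed : List ((ℤ × ℤ) × Tile (Fin s))} {m : ℤ → ℤ} {ρ : ℕ → ℤ} {r r' : ℕ}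
  {c c' : (ℤ × ℤ) × Tile (Fin s)} {t : Tile (Fin s)}

theorem eval_cellSide (hL : Loaded Γ tiles placed m) (h : IsAt placed ρ r c) (d : Fin 4) :
    (cellSide r d).eval ⟨ρ, m⟩ = (c.2.side d).val := by
  obtain ⟨i, hi, hr, rfl⟩ := h
  simp only [cellSide, cell, eval, eval_four, eval_six, hr, hL.num_tiles, ← hL.glue i hi d]

theorem eval_tileSide (hL : Loaded Γ tiles placed m) (h : IsAt tiles ρ r t) (d : Fin 4) :
    (tileSide r d).eval ⟨ρ, m⟩ = (t.side d).val := by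
  obtain ⟨i, hi, hr, rfl⟩ := h
  simp only [tileSide, eval, eval_four, hr, ← hL.tile i hi d]

theorem evalPair_pos (hL : Loaded Γ tiles placed m) (h : IsAt placed ρ r c) :
    evalPair ⟨ρ, m⟩ (pos r) = c.1 := by
  obtain ⟨i, hi, hr, rfl⟩ := h
  have h1 := hL.pos_fst i hi
  have h2 := hL.pos_snd i hi
  simp only [evalPair, pos, cell, eval, eval_four, eval_six, hr, hL.num_tiles, h1, h2]

theorem eval_strength (hL : Loaded Γ tiles placed m) {g h : Fin s} {e f : Expr}
    (he : e.eval ⟨ρ, m⟩ = g.val) (hf : f.eval ⟨ρ, m⟩ = h.val) :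
    (strength e f).eval ⟨ρ, m⟩ = Γ.str g h := by
  simp only [strength, eval, eval_four, eval_six, he, hf, hL.num_tiles, hL.num_placed, hL.str g h]

theorem eval_cellBond (hL : Loaded Γ tiles placed m) (h : IsAt placed ρ r c)
    (h' : IsAt placed ρ r' c') (d : Fin 4) :
    (cellBond r d r').eval ⟨ρ, m⟩ = Γ.bond c.2 d c'.2 :=
  eval_strength hL (eval_cellSide hL h d) (eval_cellSide hL h' (d + 2))

theorem eval_tileBond (hL : Loaded Γ tiles placed m) (h : IsAt placed ρ r c)
    (h' : IsAt tiles ρ r' t) (d : Fin 4) :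
    (tileBond r d r').eval ⟨ρ, m⟩ = Γ.bond c.2 d t :=
  eval_strength hL (eval_cellSide hL h d) (eval_tileSide hL h' (d + 2))

end Loaded

/-! ### Formulas over the input -/

namespace Form

open RAM.Expr

/-- The assertion that two positions agree. -/
def eqPos (P Q : Expr × Expr) : Form := .and (.test (.eq P.1 Q.1)) (.test (.eq P.2 Q.2))

/-- Conjunction over the four directions. -/
def allDir (F : Fin 4 → Form) : Form := .and (F 0) (.and (F 1) (.and (F 2) (F 3)))

/-- Disjunction over the four directions. -/
def exDir (F : Fin 4 → Form) : Form := .not (allDir fun d => .not (F d))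

/-- Two placed tiles have the same type. -/
def sameCell (r r' : ℕ) : Form := allDir fun d => .test (.eq (cellSide r d) (cellSide r' d))

/-- A placed tile has a given tile type. -/
def sameTile (r r' : ℕ) : Form := allDir fun d => .test (.eq (cellSide r d) (tileSide r' d))

/-- Two placed tiles are joined by a bond. -/
def bonded (r r' : ℕ) : Form :=
  exDir fun d => .and (eqPos (pos r') (step (pos r) d)) (.test (.le (.const 1) (cellBond r d r')))

variable {m : ℤ → ℤ} {ρ : ℕ → ℤ} {k : ℕ}

theorem holds_eqPos {P Q : Expr × Expr} :
    (eqPos P Q).Holds m k ρ ↔ evalPair ⟨ρ, m⟩ P = evalPair ⟨ρ, m⟩ Q := by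
  rw [Prod.ext_iff]
  rfl

theorem holds_allDir {F : Fin 4 → Form} :
    (allDir F).Holds m k ρ ↔ ∀ d, (F d).Holds m k ρ := by
  simp only [allDir, Holds, Fin.forall_fin_succ, IsEmpty.forall_iff, and_true]
  rfl

theorem holds_exDir {F : Fin 4 → Form} :
    (exDir F).Holds m k ρ ↔ ∃ d, (F d).Holds m k ρ := by
  have := holds_allDir (m := m) (k := k) (ρ := ρ) (F := fun d => .not (F d))
  simp only [exDir, Holds] at this ⊢
  rw [this]
  push Not
  rfl

theorem holds_not {F : Form} : (Form.not F).Holds m k ρ ↔ ¬ F.Holds m k ρ := Iff.rfl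

theorem holds_and {F G : Form} :
    (Form.and F G).Holds m k ρ ↔ F.Holds m k ρ ∧ G.Holds m k ρ := Iff.rfl

section List

variable {α : Type} {l : List α} {b : ℤ} {F G : Form} {φ ψ : α → Prop}

theorem isAt_update {i : ℕ} (hi : i < l.length) : IsAt l (update ρ (k + 1) (i : ℤ)) (k + 1) l[i] :=
  ⟨i, hi, update_self .., rfl⟩

theorem update_agree (x : ℤ) : ∀ r, 1 ≤ r → r ≤ k → update ρ (k + 1) x r = ρ r :=
  fun r _ h2 => update_of_ne (by omega) _ _

/-- The hypothesis concerns arbitrary registers that agree with `ρ` up to `k`, not a particular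
`update`. Nested quantifiers can then be translated one by one without accumulating updates. -/
theorem holds_ex_list (hb : m b = l.length) (h : ∀ ρ' x, (∀ r, 1 ≤ r → r ≤ k → ρ' r = ρ r) →
    IsAt l ρ' (k + 1) x → (F.Holds m (k + 1) ρ' ↔ φ x)) :
    (ex k b F).Holds m k ρ ↔ ∃ x ∈ l, φ x := by
  rw [holds_ex hb]
  constructor
  · rintro ⟨i, hi, hF⟩
    exact ⟨l[i], List.getElem_mem hi, (h _ _ (update_agree _) (isAt_update hi)).1 hF⟩
  · rintro ⟨x, hx, hφ⟩
    obtain ⟨i, hi, rfl⟩ := List.getElem_of_mem hx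
    exact ⟨i, hi, (h _ _ (update_agree _) (isAt_update hi)).2 hφ⟩

theorem holds_all_list (hb : m b = l.length) (h : ∀ ρ' x, (∀ r, 1 ≤ r → r ≤ k → ρ' r = ρ r) →
    IsAt l ρ' (k + 1) x → (F.Holds m (k + 1) ρ' ↔ φ x)) :
    (all k b F).Holds m k ρ ↔ ∀ x ∈ l, φ x := by
  have := holds_ex_list (F := .not F) (φ := fun x => ¬ φ x) hb
    fun ρ' x h1 h2 => not_congr (h ρ' x h1 h2)
  simp only [all, Holds] at this ⊢
  rw [this]
  push Not
  rfl

theorem holds_lookup_list (hb : m b = l.length) (hl : l.Nodup)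
    (hF : ∀ ρ' x, (∀ r, 1 ≤ r → r ≤ k → ρ' r = ρ r) → IsAt l ρ' (k + 1) x →
      (F.Holds m (k + 1) ρ' ↔ φ x))
    (hG : ∀ ρ' x, (∀ r, 1 ≤ r → r ≤ k → ρ' r = ρ r) → IsAt l ρ' (k + 1) x → φ x →
      (G.Holds m (k + 1) ρ' ↔ ψ x))
    (huniq : ∀ x ∈ l, ∀ y ∈ l, φ x → φ y → x = y) :
    (lookup k b F G).Holds m k ρ ↔ ∃ x ∈ l, φ x ∧ ψ x := by
  rw [holds_lookup hb]
  · constructor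
    · rintro ⟨i, hi, h1, h2⟩
      have hφ := (hF _ _ (update_agree _) (isAt_update hi)).1 h1
      exact ⟨l[i], List.getElem_mem hi, hφ, (hG _ _ (update_agree _) (isAt_update hi) hφ).1 h2⟩
    · rintro ⟨x, hx, hφ, hψ⟩
      obtain ⟨i, hi, rfl⟩ := List.getElem_of_mem hx
      exact ⟨i, hi, (hF _ _ (update_agree _) (isAt_update hi)).2 hφ,
        (hG _ _ (update_agree _) (isAt_update hi) hφ).2 hψ⟩
  · intro i hi j hj h1 h2
    have e := huniq _ (List.getElem_mem hi) _ (List.getElem_mem hj)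
      ((hF _ _ (update_agree _) (isAt_update hi)).1 h1)
      ((hF _ _ (update_agree _) (isAt_update hj)).1 h2)
    exact (List.Nodup.getElem_inj_iff hl).1 e

end List

variable {s : ℕ} {Γ : System (Fin s)} {tiles : List (Tile (Fin s))}
  {placed : List ((ℤ × ℤ) × Tile (Fin s))} {r r' : ℕ}
  {c c' : (ℤ × ℤ) × Tile (Fin s)} {t : Tile (Fin s)}

theorem holds_sameCell (hL : Loaded Γ tiles placed m) (h : IsAt placed ρ r c)
    (h' : IsAt placed ρ r' c') : (sameCell r r').Holds m k ρ ↔ c.2 = c'.2 := by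
  rw [sameCell, holds_allDir, Tile.ext_side]
  refine forall_congr' fun d => ?_
  simp only [Holds, Test.Holds, eval_cellSide hL h, eval_cellSide hL h', Nat.cast_inj, Fin.val_inj]

theorem holds_sameTile (hL : Loaded Γ tiles placed m) (h : IsAt placed ρ r c)
    (h' : IsAt tiles ρ r' t) : (sameTile r r').Holds m k ρ ↔ c.2 = t := by
  rw [sameTile, holds_allDir, Tile.ext_side]
  refine forall_congr' fun d => ?_
  simp only [Holds, Test.Holds, eval_cellSide hL h, eval_tileSide hL h', Nat.cast_inj, Fin.val_inj]

theorem holds_bonded (hL : Loaded Γ tiles placed m) {a : Config (Fin s)}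
    (ha : ∀ c, c ∈ placed ↔ c ∈ a.cells) (h : IsAt placed ρ r c) (h' : IsAt placed ρ r' c') :
    (bonded r r').Holds m k ρ ↔ (Γ.grid a).Adj c.1 c'.1 := by
  have hc : a c.1 = some c.2 := (ha c).1 h.mem
  have hc' : a c'.1 = some c'.2 := (ha c').1 h'.mem
  rw [bonded, holds_exDir, System.grid_adj]
  simp only [holds_eqPos, evalPair_step, evalPair_pos hL h, evalPair_pos hL h', Holds,
    Test.Holds, eval_cellBond hL h h', eval]
  constructor
  · rintro ⟨d, hd, hb⟩
    rw [hd] at hc' ⊢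
    rw [Γ.weight_vec hc hc']
    omega
  · intro hw
    obtain ⟨s', t', d, hs, ht, hd, hw'⟩ := Γ.exists_of_weight_pos hw
    rw [Option.some.inj (hc.symm.trans hs), Option.some.inj (hc'.symm.trans ht)]
    exact ⟨d, hd, by omega⟩

end Form

end RAM

end TwoHAM

/-! ### Distances in a forest. -/

namespace SimpleGraph

variable {V : Type*} {G : SimpleGraph V}

theorem IsAcyclic.length_eq_dist (hG : G.IsAcyclic) {u v : V} {w : G.Walk u v} (hw : w.IsPath) :
    w.length = G.dist u v := by
  obtain ⟨p, hp, hl⟩ := w.reachable.exists_path_of_dist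
  have : (⟨w, hw⟩ : G.Path u v) = ⟨p, hp⟩ := (hG.subsingleton_path u v).elim _ _
  have h : w = p := congrArg Subtype.val this
  rw [h, hl]

/-- Equality in the triangle inequality says that two geodesics joined at `x` form a geodesic, which
is then the unique path. Conversely, cutting the path at `x` gives two paths, whose lengths are
distances. -/
theorem IsAcyclic.between_iff_dist (hG : G.IsAcyclic) {u x v : V} (hx : G.Reachable u x)
    (hv : G.Reachable u v) : G.Between u x v ↔ G.dist u x + G.dist x v = G.dist u v := by
  classical
  constructor
  · intro h
    obtain ⟨w, hw⟩ := hv.exists_isPath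
    have hxw := h w
    have h1 := hG.length_eq_dist (hw.takeUntil hxw)
    have h2 := hG.length_eq_dist (hw.dropUntil hxw)
    rw [← h1, ← h2, ← hG.length_eq_dist hw, ← Walk.length_append, Walk.take_spec]
  · intro h
    obtain ⟨w₁, h₁⟩ := hx.exists_walk_length_eq_dist
    obtain ⟨w₂, h₂⟩ := (hx.symm.trans hv).exists_walk_length_eq_dist
    have hp : (w₁.append w₂).IsPath :=
      Walk.isPath_of_length_eq_dist _ (by rw [Walk.length_append, h₁, h₂, h])
    refine (TwoHAM.System.between_iff_of_isPath hG hp).2 ?_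
    rw [Walk.mem_support_append_iff]
    exact Or.inl w₁.end_mem_support

end SimpleGraph

/-! ### The criterion as a formula over the memory. -/

namespace TwoHAM.RAM

open Function (update update_self update_of_ne)
open RAM.Expr

open Classical in
/-- The distance table of the memory is right for the graph `G`. -/
def Filled {α : Type} (G : SimpleGraph (ℤ × ℤ)) (placed : List ((ℤ × ℤ) × α)) (m : ℤ → ℤ) : Prop :=
  ∀ (i : ℕ) (hi : i < placed.length) (j : ℕ) (hj : j < placed.length),
    m (-2 - m (-2 - i) - j) =
      if G.Reachable placed[i].1 placed[j].1 then (G.dist placed[i].1 placed[j].1 : ℤ) + 1 else 0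

namespace Form

/-- The placed tile `x` is on the path between the placed tiles `u` and `v`. -/
def between (u x v : ℕ) : Form :=
  -- Table entries are distances plus one, hence the extra one on the right.
  .test (.eq (.add (Expr.dist u x) (Expr.dist x v)) (.add (Expr.dist u v) (.const 1)))

/-- No bond has strength one. -/
def noWeakBond : Form :=
  all 0 2 (all 1 2 (allDir fun d => .not (.and (eqPos (pos 2) (step (pos 1) d))
    (.test (.eq (cellBond 1 d 2) (.const 1))))))

/-- The bond graph is connected. -/
def isConnected : Form := all 0 2 (all 1 2 (.not (.test (.eq (Expr.dist 1 2) (.const 0)))))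

/-- Each placed tile is of one of the tile types. -/
def usesTiles : Form := all 0 2 (ex 1 1 (sameTile 1 2))

/-- Each tile type is placed somewhere. -/
def allOccur : Form := all 0 1 (ex 1 2 (sameTile 2 1))

/-- Wherever a tile can be attached in a place of the target, the result is contained in the
target. -/
def grows : Form :=
  all 0 2 (all 1 1 (allDir fun d => or (.not (.test (.le (.const 2) (tileBond 1 d 2))))
    -- Registers: `1` for `y`, `2` for the type `t`, `3` for the position to be covered, `4` for the
    -- image of `y`, which encodes the shift. In the first conjunct, `5` runs through the branch and
    -- `6` is the image of `5`; in the second, `5` is the image of `3`.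
    (lookup 2 2 (eqPos (pos 3) (step (pos 1) d)) (ex 3 2 (.and
      (all 4 2 (or (between 5 3 1)
        (lookup 5 2 (eqPos (pos 6) (addPair (pos 5) (subPair (pos 4) (pos 1)))) (sameCell 6 5))))
      (lookup 4 2 (eqPos (pos 5) (addPair (pos 3) (subPair (pos 4) (pos 1)))) (sameTile 5 2)))))))

/-- The position of the tile with the number in register `2` has to be shifted by this vector to be
next to the tile with the number in register `1`, in the direction `d`. -/
def shift (d : Fin 4) : Expr × Expr := subPair (step (pos 1) d) (pos 2)

/-- Two bonds between two paths of the target imply that the paths overlap. -/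
def blocks : Form :=
  all 0 2 (all 1 2 (allDir fun d => or (.not (.test (.le (.const 1) (cellBond 1 d 2))))
    (all 2 2 (allDir fun d' => or
      -- Different directions already make the bonds different, so the escape clause is then the
      -- false formula.
      (if d = d' then eqPos (pos 1) (pos 3) else .test (.eq (.const 0) (.const 1)))
      -- The fourth tile is determined by the other three and the directions. Quantifying over it
      -- instead would raise the exponent to six.
      (.not (lookup 3 2 (eqPos (pos 4) (subPair (step (pos 3) d') (shift d)))
        (.and (.test (.le (.const 1) (cellBond 3 d' 4)))
          (.not (ex 4 2 (.and (between 1 5 3)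
            (lookup 5 2 (eqPos (pos 6) (subPair (pos 5) (shift d))) (between 2 6 4))))))))))))

/-- The conditions for unique production. -/
def verified : Form :=
  .and noWeakBond (.and isConnected (.and usesTiles (.and allOccur (.and grows blocks))))

theorem verified_scoped : verified.Scoped 0 = true := by decide

/-- The deepest nestings are `y`, `t`, the image of `y`, a branch tile and the lookup of its image
in `grows`; and `p`, `q`, `p'`, a path tile and the lookup of its shifted partner in `blocks`. -/
theorem verified_deg : verified.deg = 5 := by decide

variable {s : ℕ} {Γ : System (Fin s)} {tiles : List (Tile (Fin s))}
  {placed : List ((ℤ × ℤ) × Tile (Fin s))} {m : ℤ → ℤ} {ρ : ℕ → ℤ} {k r r' : ℕ}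
  {c c' : (ℤ × ℤ) × Tile (Fin s)} {a : Config (Fin s)}

open Classical in
theorem eval_dist {G : SimpleGraph (ℤ × ℤ)} (hF : Filled G placed m) (h : IsAt placed ρ r c)
    (h' : IsAt placed ρ r' c') : (Expr.dist r r').eval ⟨ρ, m⟩ =
      if G.Reachable c.1 c'.1 then (G.dist c.1 c'.1 : ℤ) + 1 else 0 := by
  obtain ⟨i, hi, hr, rfl⟩ := h
  obtain ⟨j, hj, hr', rfl⟩ := h'
  rw [← hF i hi j hj]
  simp only [Expr.dist, distAddr, eval, hr, hr']

theorem holds_between {G : SimpleGraph (ℤ × ℤ)} (hF : Filled G placed m) (hG : G.IsAcyclic)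
    (hconn : ∀ c ∈ placed, ∀ c' ∈ placed, G.Reachable c.1 c'.1) {u x v : ℕ}
    {cu cx cv : (ℤ × ℤ) × Tile (Fin s)} (hu : IsAt placed ρ u cu) (hx : IsAt placed ρ x cx)
    (hv : IsAt placed ρ v cv) : (between u x v).Holds m k ρ ↔ G.Between cu.1 cx.1 cv.1 := by
  have h1 := hconn _ hu.mem _ hx.mem
  have h2 := hconn _ hx.mem _ hv.mem
  have h3 := hconn _ hu.mem _ hv.mem
  rw [hG.between_iff_dist h1 h3]
  simp only [between, Holds, Test.Holds, eval, eval_dist hF hu hx, eval_dist hF hx hv,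
    eval_dist hF hu hv, if_pos h1, if_pos h2, if_pos h3]
  omega

theorem holds_noWeakBond (hL : Loaded Γ tiles placed m) (ha : ∀ c, c ∈ placed ↔ c ∈ a.cells) :
    noWeakBond.Holds m 0 ρ ↔ ∀ p q, Γ.weight a p q ≠ 1 := by
  have key : noWeakBond.Holds m 0 ρ ↔ ∀ c ∈ placed, ∀ c' ∈ placed, ∀ d,
      ¬ (c'.1 = c.1 + vec d ∧ Γ.bond c.2 d c'.2 = 1) := by
    refine holds_all_list hL.num_placed fun ρ₁ c _ h₁ => holds_all_list hL.num_placed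
      fun ρ₂ c' k₂ h₂ => holds_allDir.trans (forall_congr' fun d => not_congr ?_)
    replace h₁ := h₁.keep k₂
    rw [holds_and, holds_eqPos, evalPair_step, evalPair_pos hL h₁, evalPair_pos hL h₂]
    simp only [Holds, Test.Holds, eval, eval_cellBond hL h₁ h₂, Nat.cast_eq_one]
  rw [key]
  constructor
  · intro h p q hw
    obtain ⟨t, t', d, ht, ht', rfl, hb⟩ := Γ.exists_of_weight_pos (hw.symm ▸ Nat.one_pos)
    exact h (p, t) ((ha _).2 ht) (_, t') ((ha _).2 ht') d ⟨rfl, hb ▸ hw⟩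
  · rintro h c hc c' hc' d ⟨hd, hb⟩
    have hc : a c.1 = some c.2 := (ha c).1 hc
    have hc' : a c'.1 = some c'.2 := (ha c').1 hc'
    rw [hd] at hc'
    exact h _ _ ((Γ.weight_vec hc hc').trans hb)

theorem holds_isConnected (hL : Loaded Γ tiles placed m) {G : SimpleGraph (ℤ × ℤ)}
    (hF : Filled G placed m) :
    isConnected.Holds m 0 ρ ↔ ∀ c ∈ placed, ∀ c' ∈ placed, G.Reachable c.1 c'.1 := by
  refine holds_all_list hL.num_placed fun ρ₁ c _ h₁ => holds_all_list hL.num_placed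
    fun ρ₂ c' k₂ h₂ => ?_
  replace h₁ := h₁.keep k₂
  simp only [Holds, Test.Holds, eval, eval_dist hF h₁ h₂]
  split_ifs with h
  · simp only [h, iff_true]; omega
  · simp [h]

theorem holds_usesTiles (hL : Loaded Γ tiles placed m) :
    usesTiles.Holds m 0 ρ ↔ ∀ c ∈ placed, ∃ t ∈ tiles, c.2 = t :=
  holds_all_list hL.num_placed fun _ _ _ h₁ => holds_ex_list hL.num_tiles
    fun _ _ k₂ h₂ => holds_sameTile hL (h₁.keep k₂) h₂

theorem holds_allOccur (hL : Loaded Γ tiles placed m) :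
    allOccur.Holds m 0 ρ ↔ ∀ t ∈ tiles, ∃ c ∈ placed, c.2 = t :=
  holds_all_list hL.num_tiles fun _ _ _ h₁ => holds_ex_list hL.num_placed
    fun _ _ k₂ h₂ => holds_sameTile hL h₂ (h₁.keep k₂)

theorem eq_of_pos_eq (ha : ∀ c, c ∈ placed ↔ c ∈ a.cells) (hc : c ∈ placed) (hc' : c' ∈ placed)
    (h : c.1 = c'.1) : c = c' := by
  have h1 : a c.1 = some c.2 := (ha c).1 hc
  have h2 : a c'.1 = some c'.2 := (ha c').1 hc'
  rw [h, h2] at h1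
  exact Prod.ext h (Option.some.inj h1).symm

theorem holds_grows (hL : Loaded Γ tiles placed m) (hnd : placed.Nodup)
    (ha : ∀ c, c ∈ placed ↔ c ∈ a.cells) (hF : Filled (Γ.grid a) placed m)
    (hG : (Γ.grid a).IsAcyclic)
    (hconn : ∀ c ∈ placed, ∀ c' ∈ placed, (Γ.grid a).Reachable c.1 c'.1) :
    grows.Holds m 0 ρ ↔ ∀ y ∈ placed, ∀ t ∈ tiles, ∀ d, ¬ 2 ≤ Γ.bond y.2 d t ∨
      ∃ x ∈ placed, x.1 = y.1 + vec d ∧ ∃ z ∈ placed,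
        (∀ v ∈ placed, (Γ.grid a).Between v.1 x.1 y.1 ∨
          ∃ w ∈ placed, w.1 = v.1 + (z.1 - y.1) ∧ w.2 = v.2) ∧
        ∃ w ∈ placed, w.1 = x.1 + (z.1 - y.1) ∧ w.2 = t := by
  have huniq : ∀ {Q : ℤ × ℤ}, ∀ x ∈ placed, ∀ y ∈ placed, x.1 = Q → y.1 = Q → x = y :=
    fun x hx y hy h1 h2 => eq_of_pos_eq ha hx hy (h1.trans h2.symm)
  refine holds_all_list hL.num_placed fun ρ₁ y _ h₁ => holds_all_list hL.num_tiles
    fun ρ₂ t k₂ h₂ => holds_allDir.trans (forall_congr' fun d => ?_)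
  replace h₁ := h₁.keep k₂
  refine holds_or.trans (or_congr (not_congr ?_) ?_)
  · simp only [Holds, Test.Holds, eval, eval_tileBond hL h₁ h₂]
    omega
  refine holds_lookup_list hL.num_placed hnd (fun ρ₃ x k₃ h₃ => ?_) (fun ρ₃ x k₃ h₃ _ => ?_) huniq
  · rw [holds_eqPos, evalPair_step, evalPair_pos hL h₃, evalPair_pos hL (h₁.keep k₃)]
  replace h₁ := h₁.keep k₃
  replace h₂ := h₂.keep k₃
  refine holds_ex_list hL.num_placed fun ρ₄ z k₄ h₄ => and_congr ?_ ?_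
  all_goals
    replace h₁ := h₁.keep k₄
    replace h₂ := h₂.keep k₄
    replace h₃ := h₃.keep k₄
  · refine holds_all_list hL.num_placed fun ρ₅ v k₅ h₅ => holds_or.trans (or_congr ?_ ?_)
    all_goals
      replace h₁ := h₁.keep k₅
      replace h₃ := h₃.keep k₅
      replace h₄ := h₄.keep k₅
    · exact holds_between hF hG hconn h₅ h₃ h₁
    · refine holds_lookup_list hL.num_placed hnd (fun ρ₆ w k₆ h₆ => ?_) (fun ρ₆ w k₆ h₆ _ => ?_)
        huniq
      · rw [holds_eqPos, evalPair_add, evalPair_sub, evalPair_pos hL h₆,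
          evalPair_pos hL (h₅.keep k₆), evalPair_pos hL (h₄.keep k₆), evalPair_pos hL (h₁.keep k₆)]
      · exact holds_sameCell hL h₆ (h₅.keep k₆)
  · refine holds_lookup_list hL.num_placed hnd (fun ρ₅ w k₅ h₅ => ?_) (fun ρ₅ w k₅ h₅ _ => ?_)
      huniq
    · rw [holds_eqPos, evalPair_add, evalPair_sub, evalPair_pos hL h₅,
        evalPair_pos hL (h₃.keep k₅), evalPair_pos hL (h₄.keep k₅), evalPair_pos hL (h₁.keep k₅)]
    · exact holds_sameTile hL h₅ (h₂.keep k₅)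

theorem evalPair_shift (hL : Loaded Γ tiles placed m) (h : IsAt placed ρ 1 c)
    (h' : IsAt placed ρ 2 c') (d : Fin 4) :
    evalPair ⟨ρ, m⟩ (shift d) = c.1 + vec d - c'.1 := by
  rw [shift, evalPair_sub, evalPair_step, evalPair_pos hL h, evalPair_pos hL h']

theorem holds_blocks (hL : Loaded Γ tiles placed m) (hnd : placed.Nodup)
    (ha : ∀ c, c ∈ placed ↔ c ∈ a.cells) (hF : Filled (Γ.grid a) placed m)
    (hG : (Γ.grid a).IsAcyclic)
    (hconn : ∀ c ∈ placed, ∀ c' ∈ placed, (Γ.grid a).Reachable c.1 c'.1) :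
    blocks.Holds m 0 ρ ↔ ∀ p ∈ placed, ∀ q ∈ placed, ∀ d, ¬ 0 < Γ.bond p.2 d q.2 ∨
      ∀ p' ∈ placed, ∀ d', (d = d' ∧ p.1 = p'.1) ∨
        ¬ ∃ q' ∈ placed, q'.1 = p'.1 + vec d' - (p.1 + vec d - q.1) ∧ (0 < Γ.bond p'.2 d' q'.2 ∧
          ¬ ∃ x ∈ placed, (Γ.grid a).Between p.1 x.1 p'.1 ∧
            ∃ w ∈ placed, w.1 = x.1 - (p.1 + vec d - q.1) ∧
              (Γ.grid a).Between q.1 w.1 q'.1) := by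
  have huniq : ∀ {Q : ℤ × ℤ}, ∀ x ∈ placed, ∀ y ∈ placed, x.1 = Q → y.1 = Q → x = y :=
    fun x hx y hy h1 h2 => eq_of_pos_eq ha hx hy (h1.trans h2.symm)
  refine holds_all_list hL.num_placed fun ρ₁ p _ h₁ => holds_all_list hL.num_placed
    fun ρ₂ q k₂ h₂ => holds_allDir.trans (forall_congr' fun d => ?_)
  replace h₁ := h₁.keep k₂
  refine holds_or.trans (or_congr (not_congr ?_) ?_)
  · simp only [Holds, Test.Holds, eval, eval_cellBond hL h₁ h₂]
    omega
  refine holds_all_list hL.num_placed fun ρ₃ p' k₃ h₃ => holds_allDir.trans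
    (forall_congr' fun d' => holds_or.trans (or_congr ?_ (not_congr ?_)))
  all_goals
    replace h₁ := h₁.keep k₃
    replace h₂ := h₂.keep k₃
  · split_ifs with hd
    · rw [holds_eqPos, evalPair_pos hL h₁, evalPair_pos hL h₃]
      simp [hd]
    · simp [Holds, Test.Holds, eval, hd]
  refine holds_lookup_list hL.num_placed hnd (fun ρ₄ q' k₄ h₄ => ?_) (fun ρ₄ q' k₄ h₄ _ => ?_) huniq
  all_goals
    replace h₁ := h₁.keep k₄
    replace h₂ := h₂.keep k₄
    replace h₃ := h₃.keep k₄
  · rw [holds_eqPos, evalPair_sub, evalPair_step, evalPair_shift hL h₁ h₂, evalPair_pos hL h₃,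
      evalPair_pos hL h₄]
  refine and_congr ?_ (not_congr ?_)
  · simp only [Holds, Test.Holds, eval, eval_cellBond hL h₃ h₄]
    omega
  refine holds_ex_list hL.num_placed fun ρ₅ x k₅ h₅ => ?_
  replace h₁ := h₁.keep k₅
  replace h₂ := h₂.keep k₅
  replace h₃ := h₃.keep k₅
  replace h₄ := h₄.keep k₅
  refine and_congr (holds_between hF hG hconn h₁ h₅ h₃) ?_
  refine holds_lookup_list hL.num_placed hnd (fun ρ₆ w k₆ h₆ => ?_) (fun ρ₆ w k₆ h₆ _ => ?_) huniq
  · rw [holds_eqPos, evalPair_sub, evalPair_shift hL (h₁.keep k₆) (h₂.keep k₆), evalPair_pos hL h₆,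
      evalPair_pos hL (h₅.keep k₆)]
  · exact holds_between hF hG hconn (h₂.keep k₆) h₆ (h₄.keep k₆)

/-- The formulas for `grows` and `blocks` use the distance table as a test for paths, which
presupposes connectivity. It is available in both directions, as a conjunct of the formula or as a
field of `Verified`. -/
theorem holds_verified (hL : Loaded Γ tiles placed m) (htiles : ∀ t, t ∈ tiles ↔ t ∈ Γ.tiles)
    (hnd : placed.Nodup) (ha : ∀ c, c ∈ placed ↔ c ∈ a.cells) (hF : Filled (Γ.grid a) placed m)
    (hG : (Γ.grid a).IsAcyclic) : verified.Holds m 0 ρ ↔ Γ.Verified a := by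
  simp only [verified, holds_and, holds_noWeakBond hL ha, holds_isConnected hL hF,
    holds_usesTiles hL, holds_allOccur hL]
  have hcell : ∀ {p t}, a p = some t → (p, t) ∈ placed := fun h => (ha _).2 h
  have hcell' : ∀ {c}, c ∈ placed → a c.1 = some c.2 := fun {c} h => (ha c).1 h
  constructor
  · rintro ⟨h1, hconn, h2, h3, h4, h5⟩
    rw [holds_grows hL hnd ha hF hG hconn] at h4
    rw [holds_blocks hL hnd ha hF hG hconn] at h5
    refine ⟨h1, ?_, ?_, ?_, ?_, ?_⟩
    · rintro p ⟨t, ht⟩ q ⟨t', ht'⟩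
      exact hconn _ (hcell ht) _ (hcell ht')
    · intro p t ht
      obtain ⟨t', ht', rfl⟩ := h2 _ (hcell ht)
      exact (htiles _).1 ht'
    · intro t ht
      obtain ⟨c, hc, rfl⟩ := h3 t ((htiles t).2 ht)
      exact ⟨c.1, hcell' hc⟩
    · intro y s d hy t ht hb
      obtain ⟨x, hx, hxy, z, hz, hv, w, hw, hwx, rfl⟩ :=
        (h4 _ (hcell hy) t ((htiles t).2 ht) d).resolve_left (not_not.2 hb)
      rw [← hxy]
      refine ⟨⟨_, hcell' hx⟩, z.1 - y, ?_, ?_⟩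
      · rintro p ⟨t, ht⟩ hp
        obtain ⟨v, hv, hvp, hvt⟩ := (hv _ (hcell ht)).resolve_left hp
        have := hcell' hv
        rw [hvp] at this
        rw [this, ht, hvt]
      · have := hcell' hw
        rwa [hwx] at this
    · intro p s q t p' s' q' t' d d' hp hq hp' hq' hne hb hb' hpq
      have h6 := ((h5 _ (hcell hp) _ (hcell hq) d).resolve_left (not_not.2 hb) _ (hcell hp')
        d').resolve_left (fun h => hne h.symm)
      by_contra hno
      refine h6 ⟨_, hcell hq', ?_, hb', ?_⟩
      · rw [hpq]; abel
      · rintro ⟨x, -, hx, w, -, hwx, hw'⟩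
        rw [hwx] at hw'
        exact hno ⟨_, hx, hw'⟩
  · intro h
    have hconn : ∀ c ∈ placed, ∀ c' ∈ placed, (Γ.grid a).Reachable c.1 c'.1 :=
      fun c hc c' hc' => h.reachable _ ⟨_, hcell' hc⟩ _ ⟨_, hcell' hc'⟩
    rw [holds_grows hL hnd ha hF hG hconn, holds_blocks hL hnd ha hF hG hconn]
    refine ⟨h.weight_ne_one, hconn, fun c hc => ⟨c.2, ?_, rfl⟩, fun t ht => ?_, ?_, ?_⟩
    · exact (htiles _).2 (h.tiles _ _ (hcell' hc))
    · obtain ⟨p, hp⟩ := h.occurs t ((htiles t).1 ht)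
      exact ⟨_, hcell hp, rfl⟩
    · intro y hy t ht d
      by_cases hb : 2 ≤ Γ.bond y.2 d t
      · right
        obtain ⟨⟨r, hr⟩, u, hu, hut⟩ := h.grows y.1 y.2 d (hcell' hy) t ((htiles t).1 ht) hb
        -- `y` belongs to its own branch, so the shift takes it to a placed tile: only `|A|` shifts
        -- have to be tried.
        have hyu : a (y.1 + u) = some y.2 := by
          rw [hu y.1 ⟨_, hcell' hy⟩, hcell' hy]
          intro hbt
          have := hbt .nil
          simp [System.vec_ne_zero] at this
        refine ⟨_, hcell hr, rfl, _, hcell hyu, fun v hv => ?_, _, hcell hut, ?_, rfl⟩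
        · refine or_iff_not_imp_left.2 fun hbt => ?_
          have := hu v.1 ⟨_, hcell' hv⟩ hbt
          rw [hcell' hv] at this
          exact ⟨_, hcell this, by simp, rfl⟩
        · simp
      · exact Or.inl hb
    · intro p hp q hq d
      refine or_iff_not_imp_left.2 fun hb => ?_
      intro p' hp' d'
      refine or_iff_not_imp_left.2 fun hne => ?_
      rintro ⟨q', hq', hpos, hb', hno⟩
      obtain ⟨x, hx, hx'⟩ := h.blocks p.1 p.2 q.1 q.2 p'.1 p'.2 q'.1 q'.2 d d' (hcell' hp)
        (hcell' hq) (hcell' hp') (hcell' hq') (fun h => hne h.symm) (not_not.1 hb) hb'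
        (by rw [hpos]; abel)
      -- The overlap lies on walks between placed tiles, so both it and its shifted copy are placed.
      have hxd : x ∈ a.dom := by
        obtain ⟨w⟩ := hconn p hp p' hp'
        exact System.mem_dom_of_walk ⟨_, hcell' hp⟩ w x (hx w)
      have hxd' : x - (p.1 + vec d - q.1) ∈ a.dom := by
        obtain ⟨w⟩ := hconn q hq q' hq'
        exact System.mem_dom_of_walk ⟨_, hcell' hq⟩ w _ (hx' w)
      obtain ⟨r, hr⟩ := hxd
      obtain ⟨r', hr'⟩ := hxd'
      exact hno ⟨_, hcell hr, hx, _, hcell hr', rfl, hx'⟩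

end Form
end TwoHAM.RAM

namespace TwoHAM.RAM

open Function (update update_self update_of_ne)
open SimpleGraph RAM.Expr

/-! ### Exploring a forest -/

section Explore

variable {V : Type*} {G : SimpleGraph V} {pos : ℕ → V} {n : ℕ}

/-- The nonzero entries of `d` are the numbers of vertices of paths, through vertices with nonzero
entries. -/
def Sound (G : SimpleGraph V) (pos : ℕ → V) (n : ℕ) (d : ℕ → ℕ → ℤ) : Prop :=
  ∀ i < n, ∀ j < n, d i j ≠ 0 → ∃ w : G.Walk (pos i) (pos j), w.IsPath ∧ d i j = w.length + 1 ∧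
    ∀ x ∈ w.support, ∃ l < n, pos l = x ∧ d i l ≠ 0

/-- The ends of the paths of length at most `t` have nonzero entries, and so do those of length
`t + 1` before `(r, v)`. -/
def Explored (G : SimpleGraph V) (pos : ℕ → V) (n : ℕ) (d : ℕ → ℕ → ℤ) (t r v : ℕ) : Prop :=
  ∀ i < n, ∀ j < n, ∀ w : G.Walk (pos i) (pos j), w.IsPath →
    (w.length ≤ t ∨ w.length ≤ t + 1 ∧ (i < r ∨ i = r ∧ j < v)) → d i j ≠ 0

/-- The table `d` with the entry `(r, v)` set to `x`. -/
def setEntry (d : ℕ → ℕ → ℤ) (r v : ℕ) (x : ℤ) : ℕ → ℕ → ℤ :=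
  fun i j => if i = r ∧ j = v then x else d i j

/-- All vertices of the recorded path have nonzero entries, while the entry of the new vertex is
zero. So the new vertex is not on the path, and appending it gives a path again. -/
theorem Sound.setEntry {d : ℕ → ℕ → ℤ} (h : Sound G pos n d) (hinj : Set.InjOn pos (Set.Iio n))
    {r v p : ℕ} (hr : r < n) (hv : v < n) (hp : p < n) (h0 : d r v = 0) (hdp : d r p ≠ 0)
    (hadj : G.Adj (pos p) (pos v)) : Sound G pos n (setEntry d r v (d r p + 1)) := by
  have hnz : ∀ i < n, ∀ j < n, d i j ≠ 0 → RAM.setEntry d r v (d r p + 1) i j = d i j := by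
    intro i _ j _ hd
    unfold RAM.setEntry
    rw [if_neg]
    rintro ⟨rfl, rfl⟩
    exact hd h0
  intro i hi j hj hd
  by_cases hij : i = r ∧ j = v
  · obtain ⟨rfl, rfl⟩ := hij
    obtain ⟨w, hw, hl, hs⟩ := h i hi p hp hdp
    have hnot : pos j ∉ w.support := by
      intro hm
      obtain ⟨l, hl, hlj, hdl⟩ := hs _ hm
      rw [hinj hl hj hlj] at hdl
      exact hdl h0
    refine ⟨w.concat hadj, hw.concat hnot hadj, ?_, ?_⟩
    · rw [Walk.length_concat]
      simp only [RAM.setEntry, and_self, if_true, hl]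
      push_cast
      rfl
    · intro x hx
      rw [Walk.support_concat] at hx
      rcases List.mem_append.1 hx with hx | hx
      · obtain ⟨l, hl, hlx, hdl⟩ := hs x hx
        exact ⟨l, hl, hlx, by rwa [hnz i hi l hl hdl]⟩
      · rw [List.mem_singleton.1 hx]
        exact ⟨j, hj, rfl, hd⟩
  · have hd' : d i j ≠ 0 := by
      unfold RAM.setEntry at hd
      rwa [if_neg hij] at hd
    obtain ⟨w, hw, hl, hs⟩ := h i hi j hj hd'
    refine ⟨w, hw, by rw [hnz i hi j hj hd', hl], fun x hx => ?_⟩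
    obtain ⟨l, hl, hlx, hdl⟩ := hs x hx
    exact ⟨l, hl, hlx, by rwa [hnz i hi l hl hdl]⟩

theorem Explored.setEntry {d : ℕ → ℕ → ℤ} {t r v : ℕ} (h : Explored G pos n d t r v) {x : ℤ}
    (hx : x ≠ 0) : Explored G pos n (setEntry d r v x) t r (v + 1) := by
  intro i hi j hj w hw hl
  unfold RAM.setEntry
  split_ifs with hij
  · exact hx
  · refine h i hi j hj w hw (hl.imp_right (And.imp_right (Or.imp_right ?_)))
    rintro ⟨rfl, hjv⟩
    exact ⟨rfl, by omega⟩

theorem Explored.of_ne {d : ℕ → ℕ → ℤ} {t r v : ℕ} (h : Explored G pos n d t r v)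
    (hx : d r v ≠ 0) : Explored G pos n d t r (v + 1) := by
  intro i hi j hj w hw hl
  by_cases hij : i = r ∧ j = v
  · obtain ⟨rfl, rfl⟩ := hij
    exact hx
  · refine h i hi j hj w hw (hl.imp_right (And.imp_right (Or.imp_right ?_)))
    rintro ⟨rfl, hjv⟩
    exact ⟨rfl, by omega⟩

/-- A path of length `t + 1` would have a penultimate vertex at the end of a path of length `t`,
hence with a nonzero entry: a reached neighbour after all. -/
theorem Explored.of_none {d : ℕ → ℕ → ℤ} {t r v : ℕ} (h : Explored G pos n d t r v)
    (hrange : ∀ x y, G.Adj x y → ∃ l < n, pos l = x)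
    (hnone : ∀ p < n, d r p ≠ 0 → ¬ G.Adj (pos p) (pos v)) :
    Explored G pos n d t r (v + 1) := by
  intro i hi j hj w hw hl
  by_cases hij : i = r ∧ j = v
  · obtain ⟨rfl, rfl⟩ := hij
    by_cases hlt : w.length ≤ t
    · exact h i hi j hj w hw (Or.inl hlt)
    · exfalso
      have hnil : ¬ w.Nil := by
        intro hn
        rw [← Walk.length_eq_zero_iff] at hn
        omega
      have hadj := w.adj_penultimate hnil
      obtain ⟨p, hp, hpx⟩ := hrange _ _ hadj
      have hlen := congrArg Walk.length (w.concat_dropLast hadj)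
      rw [Walk.length_concat] at hlen
      have hpath : w.dropLast.IsPath := by
        have := w.concat_dropLast hadj
        rw [← this] at hw
        exact (Walk.concat_isPath_iff _).1 hw |>.1
      rw [← hpx] at hadj
      refine hnone p hp (h i hi p hp (w.dropLast.copy rfl hpx.symm) ?_ (Or.inl ?_)) hadj
      · rwa [Walk.isPath_copy]
      · rw [Walk.length_copy]
        omega
  · refine h i hi j hj w hw (hl.imp_right (And.imp_right (Or.imp_right ?_)))
    rintro ⟨rfl, hjv⟩
    exact ⟨rfl, by omega⟩

theorem Explored.next_row {d : ℕ → ℕ → ℤ} {t r : ℕ} (h : Explored G pos n d t r n) :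
    Explored G pos n d t (r + 1) 0 := by
  intro i hi j hj w hw hl
  refine h i hi j hj w hw (hl.imp_right (And.imp_right ?_))
  omega

theorem Explored.next_round {d : ℕ → ℕ → ℤ} {t : ℕ} (h : Explored G pos n d t n 0) :
    Explored G pos n d (t + 1) 0 0 := by
  intro i hi j hj w hw hl
  refine h i hi j hj w hw ?_
  omega

theorem sound_one : Sound G pos n fun i j => if i = j then 1 else 0 := by
  intro i hi j hj hd
  by_cases hij : i = j
  · subst hij
    refine ⟨.nil, .nil, by simp, fun x hx => ⟨i, hi, ?_, by simp⟩⟩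
    exact (List.mem_singleton.1 (by simpa using hx)).symm
  · simp [hij] at hd

theorem explored_one (hinj : Set.InjOn pos (Set.Iio n)) :
    Explored G pos n (fun i j => if i = j then 1 else 0) 0 0 0 := by
  intro i hi j hj w hw hl
  have hl : w.length = 0 := by omega
  have := hinj hi hj (Walk.eq_of_length_eq_zero hl)
  simp [this]

/-- The vertices of a path are distinct and numbered below `n`; therefore `n` rounds of exploration
suffice. -/
theorem length_lt_of_isPath (hrange : ∀ x y, G.Adj x y → ∃ l < n, pos l = x) {i j : ℕ} (hi : i < n)
    (w : G.Walk (pos i) (pos j)) (hw : w.IsPath) : w.length < n := by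
  have hmem : ∀ {u v : V} (w : G.Walk u v), (∃ l < n, pos l = u) →
      ∀ x ∈ w.support, ∃ l < n, pos l = x := by
    intro u v w
    induction w with
    | nil => intro h x hx; rw [Walk.support_nil, List.mem_singleton] at hx; rwa [hx]
    | cons h w ih =>
      intro hu x hx
      rw [Walk.support_cons, List.mem_cons] at hx
      rcases hx with rfl | hx
      · exact hu
      · exact ih (hrange _ _ h.symm) x hx
  have hsub : w.support ⊆ (List.range n).map pos := by
    intro x hx
    obtain ⟨l, hl, rfl⟩ := hmem w ⟨i, hi, rfl⟩ x hx
    exact List.mem_map.2 ⟨l, List.mem_range.2 hl, rfl⟩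
  have := (hw.support_nodup.subperm hsub).length_le
  rw [Walk.length_support, List.length_map, List.length_range] at this
  omega

-- `Sound` does not claim shortest paths: updates in place may record a long path early. In a forest
-- every path realizes the distance, so this does no harm.
open Classical in
theorem entry_eq (hG : G.IsAcyclic) (hrange : ∀ x y, G.Adj x y → ∃ l < n, pos l = x)
    {d : ℕ → ℕ → ℤ} (hs : Sound G pos n d) (he : Explored G pos n d n 0 0) {i j : ℕ} (hi : i < n)
    (hj : j < n) :
    d i j = if G.Reachable (pos i) (pos j) then (G.dist (pos i) (pos j) : ℤ) + 1 else 0 := by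
  split_ifs with hr
  · obtain ⟨w, hw⟩ := hr.exists_isPath
    have hd := he i hi j hj w hw (Or.inl (length_lt_of_isPath hrange hi w hw).le)
    obtain ⟨w', hw', hl, -⟩ := hs i hi j hj hd
    rw [hl, hG.length_eq_dist hw']
  · by_contra hd
    obtain ⟨w, -⟩ := hs i hi j hj hd
    exact hr w.reachable

end Explore

/-! ### The distance table -/

/-- The memory `m` agrees with `m₀` on the input, and holds the first `k` row offsets and the
table `d` of size `n`. -/
structure Table (n : ℕ) (m₀ m : ℤ → ℤ) (d : ℕ → ℕ → ℤ) (k : ℕ) : Prop where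
  input : ∀ z, -1 ≤ z → m z = m₀ z
  row : ∀ i < k, m (-2 - (i : ℕ)) = (i + 1) * n
  entry : ∀ i < n, ∀ j < n, m (-2 - (i + 1) * n - j) = d i j

theorem Table.setEntry {n : ℕ} {m₀ m : ℤ → ℤ} {d : ℕ → ℕ → ℤ} {k : ℕ} (h : Table n m₀ m d k)
    (hk : k ≤ n) {r v : ℕ} (hr : r < n) (hv : v < n) (x : ℤ) :
    Table n m₀ (update m (-2 - (r + 1) * n - v) x) (setEntry d r v x) k := by
  -- The row offsets occupy the cells from `-2` down to `-1 - n`; the entries all lie below them.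
  have h0 : (n : ℤ) ≤ (r + 1) * n := by nlinarith [Int.natCast_nonneg n, Int.natCast_nonneg r]
  refine ⟨fun z hz => ?_, fun i hi => ?_, fun i hi j hj => ?_⟩
  · rw [update_of_ne (by omega), h.input z hz]
  · rw [update_of_ne (by omega), h.row i hi]
  · by_cases hij : i = r ∧ j = v
    · obtain ⟨rfl, rfl⟩ := hij
      simp [RAM.setEntry]
    · rw [update_of_ne, h.entry i hi j hj, RAM.setEntry, if_neg hij]
      intro he
      apply hij
      have he : ((i : ℤ) + 1) * n + j = (r + 1) * n + v := by linarith
      have he : i * n + j = r * n + v := by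
        zify
        linarith
      -- Both columns are less than `n`, so division by `n` recovers the row.
      have h1 : i = r := by
        have h2 := congrArg (· / n) he
        beta_reduce at h2
        rwa [mul_comm i, mul_comm r, Nat.mul_add_div (by omega), Nat.mul_add_div (by omega),
          Nat.div_eq_of_lt hj, Nat.div_eq_of_lt hv, add_zero, add_zero] at h2
      subst h1
      exact ⟨rfl, by omega⟩

theorem Table.setRow {n : ℕ} {m₀ m : ℤ → ℤ} {d : ℕ → ℕ → ℤ} {k : ℕ} (h : Table n m₀ m d k)
    (hk : k < n) : Table n m₀ (update m (-2 - k) ((k + 1) * n)) d (k + 1) := by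
  refine ⟨fun z hz => ?_, fun i hi => ?_, fun i hi j hj => ?_⟩
  · rw [update_of_ne (by omega), h.input z hz]
  · by_cases hik : i = k
    · subst hik; simp
    · rw [update_of_ne (by omega), h.row i (by omega)]
  · have h0 : (n : ℤ) ≤ (i + 1) * n := by nlinarith [Int.natCast_nonneg n, Int.natCast_nonneg i]
    rw [update_of_ne (by omega), h.entry i hi j hj]

theorem eval_distAddr {n : ℕ} {m₀ m : ℤ → ℤ} {d : ℕ → ℕ → ℤ} {k : ℕ} (h : Table n m₀ m d k)
    {ρ : ℕ → ℤ} {r r' i j : ℕ} (hr : ρ r = i) (hr' : ρ r' = j) (hi : i < k) :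
    (distAddr r r').eval ⟨ρ, m⟩ = -2 - (i + 1) * n - j := by
  simp only [distAddr, eval, hr, hr', h.row i hi]

theorem eval_dist_table {n : ℕ} {m₀ m : ℤ → ℤ} {d : ℕ → ℕ → ℤ} {k : ℕ} (h : Table n m₀ m d k)
    {ρ : ℕ → ℤ} {r r' i j : ℕ} (hr : ρ r = i) (hr' : ρ r' = j) (hi : i < k) (hin : i < n)
    (hj : j < n) : (Expr.dist r r').eval ⟨ρ, m⟩ = d i j := by
  rw [Expr.dist, eval, eval_distAddr h hr hr' hi]
  exact h.entry i hin j hj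

/-- Computes the row offsets, and sets the diagonal of the table to one. -/
def initTable : Program :=
  forLoop 1 (.seq
    (.store (.sub (.const (-2)) (.reg 1))
      (.add (.mem (.sub (.const (-1)) (.reg 1))) (.mem (.const 2))))
    (.store (distAddr 1 1) (.const 1)))

/-- The machine cannot multiply, so each row offset is the previous one plus `n`. The untouched zero
in cell `-1` serves as the predecessor of the first. -/
theorem ends_initTable {n : ℕ} {σ : State} {m₀ : ℤ → ℤ} (hn : m₀ 2 = n) (h1 : m₀ (-1) = 0)
    (h : Table n m₀ σ.mem (fun _ _ => 0) 0) :
    Ends initTable σ (n * 32 + 8) fun σ' =>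
      Table n m₀ σ'.mem (fun i j => if i = j then 1 else 0) n := by
  refine (Ends.forLoop (C := 22) (N := n)
    (fun k σ' => Table n m₀ σ'.mem (fun i j => if i = j ∧ i < k then 1 else 0) k) ?_ ?_ ?_ ?_).mono
    le_rfl ?_
  · intro i σ' h
    rw [h.input 2 (by omega), hn]
  · intro i σ' x h
    exact h
  · intro k hk σ' h hr
    have hprev : σ'.mem (-1 - k) = k * n := by
      cases k with
      | zero => simp [h.input (-1) le_rfl, h1]
      | succ k =>
        have := h.row k (by omega)
        rw [show (-1 - ((k + 1 : ℕ) : ℤ)) = -2 - k by push_cast; ring, this]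
        push_cast
        rfl
    have hrow := h.setRow hk
    have hmain := Ends.seq (P := .store (.sub (.const (-2)) (.reg 1))
      (.add (.mem (.sub (.const (-1)) (.reg 1))) (.mem (.const 2)))) (σ := σ') (Q := fun σ'' =>
      Table n m₀ σ''.mem (fun i j => if i = j ∧ i < k then 1 else 0) (k + 1) ∧ σ''.reg 1 = k)
      (Ends.store ⟨by
        simp only [eval, hr, hprev, h.input 2 (by omega), hn]
        rwa [show ((k : ℤ) + 1) * n = k * n + n by ring] at hrow, hr⟩)
      fun σ'' h' => Ends.store (a := distAddr 1 1) (e := .const 1) (Q := fun σ' =>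
        Table n m₀ σ'.mem (fun i j => if i = j ∧ i < k + 1 then 1 else 0) (k + 1) ∧ σ'.reg 1 = k)
        ⟨by
          rw [eval_distAddr h'.1 h'.2 h'.2 (by omega)]
          have hset := h'.1.setEntry hk hk hk 1
          have hdiag : setEntry (fun i j => if i = j ∧ i < k then 1 else 0) k k 1 =
              fun i j => if i = j ∧ i < k + 1 then 1 else 0 := by
            funext i j
            simp only [setEntry]
            split_ifs <;> first | rfl | omega
          rwa [hdiag] at hset, h'.2⟩
    exact hmain.mono (by simp [Expr.cost, distAddr]) fun _ h => h
  · simpa using h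
  · intro σ' h
    refine ⟨h.input, h.row, fun i hi j hj => ?_⟩
    rw [h.entry i hi j hj]
    simp [hi]

/-- The placed tile with the number in register `4` is a neighbour of the one in register `3` that
has been reached from the one in register `2`. -/
def Form.reachedNeighbour : Form :=
  .and (.not (.test (.eq (Expr.dist 2 4) (.const 0)))) (bonded 4 3)

/-- Computes the entry of the table for the registers `2` and `3` from a neighbouring entry. -/
def extendEntry : Program :=
  .cond (.eq (Expr.dist 2 3) (.const 0))
    (.seq (search 4 2 (Form.reachedNeighbour.compile 4))
      (.cond (.le (.add (.reg 4) (.const 1)) (.mem (.const 2)))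
        (.store (distAddr 2 3) (.add (Expr.dist 2 4) (.const 1))) .skip))
    .skip

/-- Fills the distance table. -/
def fillTable : Program :=
  .seq initTable (forLoop 1 (forLoop 2 (forLoop 3 extendEntry)))

section Fill

variable {s : ℕ} {Γ : System (Fin s)} {tiles : List (Tile (Fin s))}
  {placed : List ((ℤ × ℤ) × Tile (Fin s))} {a : Config (Fin s)} {m₀ : ℤ → ℤ}

/-- The position of the placed tile with the number `i`. -/
def posOf (placed : List ((ℤ × ℤ) × Tile (Fin s))) (i : ℕ) : ℤ × ℤ :=
  (placed.map Prod.fst).getD i 0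

theorem posOf_eq {i : ℕ} (hi : i < placed.length) : posOf placed i = placed[i].1 := by
  rw [posOf, List.getD_eq_getElem _ _ (by simpa using hi), List.getElem_map]

theorem posOf_injOn (hnd : placed.Nodup) (ha : ∀ c, c ∈ placed ↔ c ∈ a.cells) :
    Set.InjOn (posOf placed) (Set.Iio placed.length) := by
  intro i hi j hj h
  rw [posOf_eq hi, posOf_eq hj] at h
  exact (List.Nodup.getElem_inj_iff hnd).1
    (Form.eq_of_pos_eq ha (List.getElem_mem hi) (List.getElem_mem hj) h)

theorem posOf_range (ha : ∀ c, c ∈ placed ↔ c ∈ a.cells) (x y : ℤ × ℤ) (h : (Γ.grid a).Adj x y) :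
    ∃ l < placed.length, posOf placed l = x := by
  obtain ⟨⟨t, ht⟩, -⟩ := Γ.mem_dom_of_weight h
  obtain ⟨l, hl, he⟩ := List.getElem_of_mem ((ha (x, t)).2 ht)
  exact ⟨l, hl, by rw [posOf_eq hl, he]⟩

/-- The memory holds a partially explored distance table. -/
def Progress (Γ : System (Fin s)) (placed : List ((ℤ × ℤ) × Tile (Fin s))) (a : Config (Fin s))
    (m₀ m : ℤ → ℤ) (t r v : ℕ) : Prop :=
  ∃ d, Table placed.length m₀ m d placed.length ∧
    Sound (Γ.grid a) (posOf placed) placed.length d ∧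
    Explored (Γ.grid a) (posOf placed) placed.length d t r v

theorem Progress.input {m : ℤ → ℤ} {t r v : ℕ} (h : Progress Γ placed a m₀ m t r v) {z : ℤ}
    (hz : -1 ≤ z) : m z = m₀ z := by
  obtain ⟨d, hd, -⟩ := h
  exact hd.input z hz

/-- The entry is either present already, or obtained from a reached neighbour, or no such neighbour
exists; these are the cases `Explored.of_ne`, `Explored.setEntry` and `Explored.of_none`. -/
theorem ends_extendEntry (hL : Loaded Γ tiles placed m₀) (hnd : placed.Nodup)
    (ha : ∀ c, c ∈ placed ↔ c ∈ a.cells) (hle : tiles.length ≤ placed.length) {K : ℕ}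
    (hK : Form.reachedNeighbour.time placed.length ≤ K) {σ : State} {t r v : ℕ}
    (hr : σ.reg 2 = r) (hv : σ.reg 3 = v) (hrn : r < placed.length) (hvn : v < placed.length)
    (h : Progress Γ placed a m₀ σ.mem t r v) :
    Ends extendEntry σ ((placed.length + 1) * (K + 13) + 50) fun σ' =>
      Progress Γ placed a m₀ σ'.mem t r (v + 1) ∧ ∀ i, 1 ≤ i → i ≤ 3 → σ'.reg i = σ.reg i := by
  obtain ⟨d, hT, hS, hE⟩ := h
  set n := placed.length with hn
  have hL' : Loaded Γ tiles placed σ.mem := hL.congr fun z hz => hT.input z (by omega)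
  have hinj := posOf_injOn hnd ha
  have hrange := posOf_range (Γ := Γ) ha
  have hdist : ∀ {ρ : ℕ → ℤ} {i r' j}, (∀ x, 1 ≤ x → x ≤ 3 → ρ x = σ.reg x) → i = r →
      ρ r' = (j : ℕ) → j < n → (Expr.dist 2 r').eval ⟨ρ, σ.mem⟩ = d i j := by
    rintro ρ i r' j hρ rfl hj hjn
    exact eval_dist_table hT ((hρ 2 (by omega) (by omega)).trans hr) hj hrn hrn hjn
  have hbound : (σ.mem 2).toNat = n := by rw [hL'.num_placed]; simp [hn]
  have hnbr : ∀ i < n, Form.reachedNeighbour.Holds σ.mem 4 (update σ.reg 4 (i : ℕ)) ↔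
      d r i ≠ 0 ∧ (Γ.grid a).Adj (posOf placed i) (posOf placed v) := by
    intro i hi
    rw [Form.reachedNeighbour, Form.holds_and, Form.holds_not, posOf_eq hi, posOf_eq hvn]
    refine and_congr (not_congr ?_) (Form.holds_bonded hL' ha (Form.isAt_update (k := 3) hi)
      ⟨v, hvn, by simp [hv], rfl⟩)
    have := hdist (ρ := update σ.reg 4 (i : ℕ)) (r' := 4) (j := i)
      (fun x h1 h2 => update_of_ne (by omega) _ _) rfl (update_self ..) hi
    simp only [Form.Holds, Test.Holds, this, eval]
  have hwhole := Ends.cond (b := .eq (Expr.dist 2 3) (.const 0))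
    (P := .seq (search 4 2 (Form.reachedNeighbour.compile 4))
      (.cond (.le (.add (.reg 4) (.const 1)) (.mem (.const 2)))
        (.store (distAddr 2 3) (.add (Expr.dist 2 4) (.const 1))) .skip)) (P' := .skip)
    (σ := σ) (C := (n + 1) * (K + 13) + 7 + 30) (Q := fun σ' =>
      Progress Γ placed a m₀ σ'.mem t r (v + 1) ∧ ∀ i, 1 ≤ i → i ≤ 3 → σ'.reg i = σ.reg i)
    (fun hb => ?_) (fun hb => ?_)
  · exact hwhole.mono (by simp [Test.cost, Expr.cost, Expr.dist, distAddr]; omega) fun _ h => h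
  · have h0 : d r v = 0 := by
      rw [← hdist (ρ := σ.reg) (r' := 3) (fun _ _ _ => rfl) rfl hv hvn]
      exact hb
    refine Ends.seq (ends_search_compile (k := 3) (b := 2) (C := K) (N := n) (by decide)
      hbound.le ?_) ?_
    · intro σ' hm
      exact (Form.ends_compile (N := n) (by rw [hL'.num_tiles]; simpa using hle) hbound.le
        Form.reachedNeighbour (by decide) σ' hm).mono hK fun _ h => h
    · rintro σ' ⟨⟨hmem, hkeep⟩, h4⟩
      rw [hbound] at h4
      set p := first n fun i => Form.reachedNeighbour.Holds σ.mem 4 (update σ.reg 4 (i : ℕ)) with hp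
      have hbd : σ'.mem 2 = n := by rw [hmem, hL'.num_placed]
      have hcond := Ends.cond (b := .le (.add (.reg 4) (.const 1)) (.mem (.const 2)))
        (P := .store (distAddr 2 3) (.add (Expr.dist 2 4) (.const 1))) (P' := .skip)
        (σ := σ') (C := 21) (Q := fun σ' =>
          Progress Γ placed a m₀ σ'.mem t r (v + 1) ∧ ∀ i, 1 ≤ i → i ≤ 3 → σ'.reg i = σ.reg i)
        (fun hb => ?_) (fun hb => ?_)
      · exact hcond.mono (by simp [Test.cost, Expr.cost]) fun _ h => h
      · have hpn : p < n := by
          simp only [Test.Holds, eval, h4, hbd] at hb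
          omega
        obtain ⟨hdp, hadj⟩ := (hnbr p hpn).1 ((first_spec n fun i =>
          Form.reachedNeighbour.Holds σ.mem 4 (update σ.reg 4 (i : ℕ))).resolve_left (not_le.2 hpn))
        -- A nonzero entry is a length plus one, hence positive.
        have hpos : d r p + 1 ≠ 0 := by
          obtain ⟨w, -, hl, -⟩ := hS r hrn p hpn hdp
          omega
        have haddr : (distAddr 2 3).eval σ' = -2 - ((r : ℤ) + 1) * n - v := by
          have := eval_distAddr hT (ρ := σ'.reg) (r := 2) (r' := 3)
            ((hkeep 2 (by omega) (by omega)).trans hr) ((hkeep 3 (by omega) (by omega)).trans hv) hrn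
          rwa [← hmem] at this
        have hval : (Expr.add (Expr.dist 2 4) (.const 1)).eval σ' = d r p + 1 := by
          have := hdist (ρ := σ'.reg) (r' := 4) hkeep rfl h4 hpn
          rw [← hmem] at this
          simp only [eval, this]
        refine (Ends.store (a := distAddr 2 3) (e := .add (Expr.dist 2 4) (.const 1)) ?_).mono
          (by simp [Expr.cost, Expr.dist, distAddr]) fun _ h => h
        refine ⟨⟨_, ?_, hS.setEntry hinj hrn hvn hpn h0 hdp hadj, hE.setEntry hpos⟩, hkeep⟩
        rw [haddr, hval, hmem]
        exact hT.setEntry le_rfl hrn hvn _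
      · refine (Ends.skip ?_).mono (by omega) fun _ h => h
        refine ⟨⟨d, by rwa [hmem], hS, hE.of_none hrange fun i hi hd hadj => hb ?_⟩, hkeep⟩
        have : p < n := first_lt_iff.2 ⟨i, hi, (hnbr i hi).2 ⟨hd, hadj⟩⟩
        simp only [Test.Holds, eval, h4, hbd]
        omega
  · have h0 : d r v ≠ 0 := by
      rw [← hdist (ρ := σ.reg) (r' := 3) (fun _ _ _ => rfl) rfl hv hvn]
      exact hb
    exact (Ends.skip ⟨⟨d, hT, hS, hE.of_ne h0⟩, fun _ _ _ => rfl⟩).mono (by omega) fun _ h => h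

/-- Rounds, rows, columns and the search for a neighbour give four nested ranges of size `n`, so the
table costs less than the evaluation of `verified`. -/
theorem ends_fillTable (hL : Loaded Γ tiles placed m₀) (hneg : ∀ z < 0, m₀ z = 0)
    (hnd : placed.Nodup) (ha : ∀ c, c ∈ placed ↔ c ∈ a.cells)
    (hle : tiles.length ≤ placed.length) (hG : (Γ.grid a).IsAcyclic) {K : ℕ}
    (hK : Form.reachedNeighbour.time placed.length ≤ K) {σ : State} (hσ : σ.mem = m₀) :
    Ends fillTable σ (placed.length * 32 + 8 + (placed.length * (placed.length * (placed.length *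
      ((placed.length + 1) * (K + 13) + 50 + 10) + 8 + 10) + 8 + 10) + 8)) fun σ' =>
      Loaded Γ tiles placed σ'.mem ∧ Filled (Γ.grid a) placed σ'.mem := by
  set n := placed.length with hn
  have hn0 : ∀ {m t r v}, Progress Γ placed a m₀ m t r v → m 2 = n := fun h => by
    rw [h.input (by omega), hL.num_placed]
  have hT0 : Table n m₀ σ.mem (fun _ _ => 0) 0 := by
    refine ⟨fun z _ => by rw [hσ], fun i hi => by omega, fun i _ j _ => ?_⟩
    rw [hσ, hneg]
    have : (0 : ℤ) ≤ ((i : ℤ) + 1) * n := by positivity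
    omega
  refine Ends.seq (ends_initTable hL.num_placed (hneg _ (by omega)) hT0) fun σ₁ h₁ => ?_
  refine (Ends.forLoop (N := n) (fun t σ => Progress Γ placed a m₀ σ.mem t 0 0)
    (fun _ _ h => hn0 h) (fun _ _ _ h => h) ?_
    ⟨_, h₁, sound_one, explored_one (posOf_injOn hnd ha)⟩).mono le_rfl ?_
  · intro t _ σ₂ h₂ ht
    refine (Ends.forLoop (N := n) (fun r σ => Progress Γ placed a m₀ σ.mem t r 0 ∧ σ.reg 1 = t)
      (fun _ _ h => hn0 h.1) (fun _ _ _ h => ⟨h.1, by simpa using h.2⟩) ?_ ⟨h₂, ht⟩).mono le_rfl ?_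
    · intro r hr σ₃ h₃ hr₃
      refine (Ends.forLoop (N := n) (fun v σ => Progress Γ placed a m₀ σ.mem t r v ∧ σ.reg 1 = t ∧
        σ.reg 2 = r) (fun _ _ h => hn0 h.1)
        (fun _ _ _ h => ⟨h.1, by simpa using h.2.1, by simpa using h.2.2⟩) ?_
        ⟨h₃.1, h₃.2, hr₃⟩).mono le_rfl ?_
      · intro v hv σ₄ h₄ hv₄
        refine (ends_extendEntry hL hnd ha hle hK h₄.2.2 hv₄ hr hv h₄.1).mono le_rfl ?_
        rintro σ₅ ⟨h₅, hk⟩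
        exact ⟨⟨h₅, (hk 1 (by omega) (by omega)).trans h₄.2.1,
          (hk 2 (by omega) (by omega)).trans h₄.2.2⟩, (hk 3 (by omega) (by omega)).trans hv₄⟩
      · rintro σ₄ ⟨⟨d, hT, hS, hE⟩, h1, h2⟩
        exact ⟨⟨⟨d, hT, hS, hE.next_row⟩, h1⟩, h2⟩
    · rintro σ₃ ⟨⟨d, hT, hS, hE⟩, h1⟩
      exact ⟨⟨d, hT, hS, hE.next_round⟩, h1⟩
  · rintro σ₂ ⟨d, hT, hS, hE⟩
    refine ⟨hL.congr fun z hz => hT.input z (by omega), fun i hi j hj => ?_⟩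
    have he := entry_eq hG (posOf_range ha) hS hE hi hj
    rw [← hT.entry i hi j hj, posOf_eq hi, posOf_eq hj] at he
    rw [hT.row i hi, ← he]

end Fill

/-! ### The decision program and its running time. -/

/-- Decides unique production. -/
def decide : Program :=
  -- Rejecting when there are more tile types than placed tiles keeps the time independent of the
  -- number of types.
  .cond (.le (.mem (.const 1)) (.mem (.const 2))) (.seq fillTable (Form.verified.compile 0))
    (.assign 0 (.const 0))

/-- The leading five pays for the initial comparison. The neighbour search contributes to the fourth
and the third power, hence the factor two, and the remaining coefficients sum to 149. -/
theorem cost_bound (K L n : ℕ) (hn : 1 ≤ n) :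
    5 + (n * 32 + 8 + (n * (n * (n * ((n + 1) * (K + 13) + 50 + 10) + 8 + 10) + 8 + 10) + 8) +
      L * n ^ 5) ≤ (2 * (K + 13) + 150 + L) * n ^ 5 := by
  have p : ∀ k ≤ 5, n ^ k ≤ n ^ 5 := fun k hk => Nat.pow_le_pow_right hn hk
  have p0 := p 0 (by omega)
  have p1 := p 1 (by omega)
  have p2 := p 2 (by omega)
  have p3 := p 3 (by omega)
  have q4 := Nat.mul_le_mul_left (K + 13) (p 4 (by omega))
  have q3 := Nat.mul_le_mul_left (K + 13) p3
  have e : 5 + (n * 32 + 8 + (n * (n * (n * ((n + 1) * (K + 13) + 50 + 10) + 8 + 10) + 8 + 10) + 8) +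
      L * n ^ 5) = (K + 13) * n ^ 4 + (K + 13) * n ^ 3 + 60 * n ^ 3 + 18 * n ^ 2 + 50 * n ^ 1 +
        21 * n ^ 0 + L * n ^ 5 := by ring
  rw [e, show (2 * (K + 13) + 150 + L) * n ^ 5 = (K + 13) * n ^ 5 + (K + 13) * n ^ 5 +
    150 * n ^ 5 + L * n ^ 5 by ring]
  omega

section Decide

variable {s : ℕ} {Γ : System (Fin s)} {tiles : List (Tile (Fin s))}
  {placed : List ((ℤ × ℤ) × Tile (Fin s))} {a : Config (Fin s)}

theorem dom_eq_of_cells (ha : ∀ c, c ∈ placed ↔ c ∈ a.cells) :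
    a.dom = ↑(placed.map Prod.fst).toFinset := by
  ext p
  simp only [List.coe_toFinset, List.mem_map, Set.mem_ofPred_eq]
  constructor
  · rintro ⟨t, ht⟩
    exact ⟨(p, t), (ha _).2 ht, rfl⟩
  · rintro ⟨c, hc, rfl⟩
    exact ⟨c.2, (ha c).1 hc⟩

theorem ncard_dom_of_cells (hnd : placed.Nodup) (ha : ∀ c, c ∈ placed ↔ c ∈ a.cells) :
    a.dom.ncard = placed.length := by
  have hmap : (placed.map Prod.fst).Nodup :=
    hnd.map_on fun c hc c' hc' h => Form.eq_of_pos_eq ha hc hc' h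
  rw [dom_eq_of_cells ha, Set.ncard_coe_finset, List.toFinset_card_of_nodup hmap, List.length_map]

/-- Every type occurs among the placed tiles and is listed once. This justifies the early rejection.
-/
theorem length_le_of_verified (hnd : tiles.Nodup) (htiles : ∀ t, t ∈ tiles ↔ t ∈ Γ.tiles)
    (ha : ∀ c, c ∈ placed ↔ c ∈ a.cells) (h : Γ.Verified a) : tiles.length ≤ placed.length := by
  have hsub : tiles ⊆ placed.map Prod.snd := by
    intro t ht
    obtain ⟨p, hp⟩ := h.occurs t ((htiles t).1 ht)
    exact List.mem_map.2 ⟨(p, t), (ha _).2 hp, rfl⟩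
  simpa using (hnd.subperm hsub).length_le

open Classical in
theorem ends_decide {K L : ℕ} (hK : Form.reachedNeighbour.time placed.length ≤ K)
    (hL : Form.verified.time placed.length ≤ L * placed.length ^ 5) (hT : Γ.temp = 2)
    (htree : Γ.TreeBonded a.assembly) (hpos : 1 ≤ placed.length)
    (hnt : tiles.Nodup) (htiles : ∀ t, t ∈ tiles ↔ t ∈ Γ.tiles)
    (hnd : placed.Nodup) (ha : ∀ c, c ∈ placed ↔ c ∈ a.cells) :
    Ends decide (start (encode Γ.str tiles placed))
      ((2 * (K + 13) + 150 + L) * placed.length ^ 5) fun σ =>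
        σ.reg 0 = if Γ.UniquelyProduces a.assembly then 1 else 0 := by
  have hload := loaded_start Γ tiles placed
  set σ := start (encode Γ.str tiles placed) with hσ
  have hfin : a.dom.Finite := by
    rw [dom_eq_of_cells ha]
    exact Finset.finite_toSet _
  have hne : a.dom.Nonempty := by
    rw [← Set.ncard_pos hfin, ncard_dom_of_cells hnd ha]
    exact hpos
  have hG := System.grid_isAcyclic (htree a rfl)
  rw [System.uniquelyProduces_iff hT hfin hne htree]
  refine (Ends.cond (fun hb => ?_) fun hb => ?_).mono (cost_bound K L _ hpos) fun _ h => h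
  · have hle : tiles.length ≤ placed.length := by
      simp only [Test.Holds, eval, hload.num_tiles, hload.num_placed] at hb
      omega
    refine Ends.seq (ends_fillTable hload (fun z hz => ?_) hnd ha hle hG hK rfl) ?_
    · simp [hσ, start, not_le.2 hz]
    · rintro σ' ⟨hload', hF⟩
      refine (Form.ends_compile (N := placed.length) (by rw [hload'.num_tiles]; simpa using hle)
        (by rw [hload'.num_placed]; simp) Form.verified Form.verified_scoped σ' rfl).mono hL ?_
      rintro σ'' ⟨-, h0⟩
      rw [h0]
      exact if_congr (Form.holds_verified hload' htiles hnd ha hF hG) rfl rfl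
  · refine (Ends.assign (r := 0) (e := .const 0) ?_).mono (by simp [Expr.cost]; omega) fun _ h => h
    rw [if_neg]
    · simp [eval]
    · intro hv
      refine hb ?_
      have := length_le_of_verified hnt htiles ha hv
      simp only [Test.Holds, eval, hload.num_tiles, hload.num_placed]
      omega

end Decide

end TwoHAM.RAM

theorem theorem2 :
    ∃ (P : TwoHAM.RAM.Program) (K : ℕ),
      ∀ (s : ℕ) (Γ : TwoHAM.System (Fin s)) (A : TwoHAM.Assembly (Fin s)),
        Γ.temp = 2 → Γ.TreeBonded A → 0 < A.size →
        ∀ w : List ℤ, TwoHAM.IsInput Γ A w →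
          ∃ (σ : TwoHAM.RAM.State) (n : ℕ),
            TwoHAM.RAM.Runs P (TwoHAM.RAM.start w) σ n ∧ n ≤ K * A.size ^ 5 ∧
            (Γ.UniquelyProduces A → σ.reg 0 = 1) ∧
            (¬ Γ.UniquelyProduces A → σ.reg 0 = 0) := by
  -- Both constants belong to fixed formulas and are chosen before the instance, so the final bound
  -- is absolute.
  obtain ⟨K, hK⟩ := TwoHAM.RAM.Form.reachedNeighbour.time_le
  obtain ⟨L, hL⟩ := TwoHAM.RAM.Form.verified.time_le
  refine ⟨TwoHAM.RAM.decide, 2 * (K + 13) + 150 + L, ?_⟩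
  rintro s Γ A hT htree hsize w ⟨tiles, a, placed, hnt, htiles, rfl, hnd, ha, rfl⟩
  have hcard : a.assembly.size = placed.length := TwoHAM.RAM.ncard_dom_of_cells hnd ha
  rw [hcard] at hsize ⊢
  have hK' : TwoHAM.RAM.Form.reachedNeighbour.time placed.length ≤ K := by
    have := hK _ hsize
    rwa [show TwoHAM.RAM.Form.reachedNeighbour.deg = 0 by decide, pow_zero, mul_one] at this
  have hL' := hL _ hsize
  rw [TwoHAM.RAM.Form.verified_deg] at hL'
  obtain ⟨σ, n, hrun, hn, h0⟩ :=
    TwoHAM.RAM.ends_decide hK' hL' hT htree hsize hnt htiles hnd ha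
  refine ⟨σ, n, hrun, hn, fun h => ?_, fun h => ?_⟩
  · rw [h0, if_pos h]
  · rw [h0, if_neg h]
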